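/- Let $n\ge 1$ and let $G=\mathbb R^{2n}\times\mathbb R$ be the Heisenberg group with product $(x,t)(y,s)=(x+y,\,t+s+\tfrac12\omega(x,y))$, where $\omega(x,y)=\sum_{i=1}^n (x_iy_{n+i}-x_{n+i}y_i)$, with dilations $\delta_r(x,t)=(rx,r^2t)$ for $r>0$ and homogeneous dimension $Q=2n+2$. Let $k$ be a principal Heisenberg symbol of order zero, i.e. a tempered distribution on $G$ that is regular (on $G\setminus\{0\}$ it is given by a smooth function) and homogeneous of degree $-Q$ (i.e. $\langle k,\varphi\circ\delta_r\rangle=\langle k,\varphi\rangle$ for all $r>0$ and all Schwartz functions $\varphi$). For $z\in G\setminus\{0\}$ let $\tau_z(k):=k(z)$ be the value at $z$ of this smooth function. Let $\hat k$ be the Fourier transform, $\langle\hat k,\varphi\rangle=\langle k,\hat\varphi\rangle$ with $\hat\varphi(y,s)=\int\varphi(x,t)e^{-i(x\cdot y+ts)}\,dx\,dt$. Then $\hat k$ is given on $\mathbb R^{2n+1}\setminus\{0\}$ by a smooth function; put $\sigma_\pm(x):=\hat k(x,\pm1)$ for $x\in\mathbb R^{2n}$. There are functions $w_{2l}$ $(l=0,1,2,\dots)$,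 smooth on $\mathbb R^{2n}\setminus\{0\}$ and homogeneous of degree $-2l$, such that, as $\|x\|\to\infty$, $$\sigma_+(x)\sim\sum_{l\ge0}w_{2l}(x),\qquad \sigma_-(x)\sim\sum_{l\ge0}(-1)^lw_{2l}(x),$$ meaning that for every $N\ge 0$ the difference with the partial sum over $l<N$ is $O(\|x\|^{-2N})$. The function $$\mathcal R:=\sigma_+-(-1)^n\sigma_--\sum_{l=0}^{n-1}\bigl(1-(-1)^{n+l}\bigr)w_{2l}$$ is integrable on $\mathbb R^{2n}$. Put $$\tau(k):=\frac1{(2\pi)^n}\int_{\mathbb R^{2n}}\mathcal R(x)\,dx,\qquad \operatorname{Res}(k):=-\frac1{2(2\pi)^n}\int_{S^{2n-1}}a_{2n}(\theta)\,d\theta,\qquad a_{2n}:=w_{2n}|_{S^{2n-1}} ,$$ where $d\theta$ is the surface measure of the unit sphere. Then for every central element $z=(0,s)\in G$ with $s\ne0$, $$\frac{(2\pi)^{n+1}(-is)^{n+1}}{n!}\,\tau_z(k)=\begin{cases}\tau(k)+\pi i\operatorname{Res}(k)&\text{if }s>0,\\ \tau(k)-\pi i\operatorname{Res}(k)&\text{if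 }s<0.\end{cases}$$ -/

import Mathlib

open MeasureTheory
open scoped SchwartzMap FourierTransform ContDiff

noncomputable section

/-- The horizontal layer `ℝ^{2n}` with its Euclidean norm. -/
abbrev Horiz (n : ℕ) : Type := EuclideanSpace ℝ (Fin (2 * n))

/-- The underlying manifold `ℝ^{2n} × ℝ = ℝ^{2n+1}` of the Heisenberg group, with its
Euclidean norm and Lebesgue measure. -/
abbrev Heis (n : ℕ) : Type := WithLp 2 (Horiz n × ℝ)

/-- The point `(x, t)` of the Heisenberg group. -/
def heisPt {n : ℕ} (x : Horiz n) (t : ℝ) : Heis n := WithLp.toLp 2 (x, t)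

/-- The standard symplectic form `ω(x, y) = ∑ i, x_i y_{n+i} - x_{n+i} y_i` on `ℝ^{2n}`. -/
def sympl {n : ℕ} (x y : Horiz n) : ℝ :=
  ∑ i : Fin n, (x ⟨i, by omega⟩ * y ⟨n + i, by omega⟩ - x ⟨n + i, by omega⟩ * y ⟨i, by omega⟩)

/-- The group law `(x, t)(y, s) = (x + y, t + s + ω(x, y) / 2)`. -/
def heisMul {n : ℕ} (p q : Heis n) : Heis n :=
  heisPt (p.fst + q.fst) (p.snd + q.snd + sympl p.fst q.fst / 2)

/-- The points `(0, s)` are central in the Heisenberg group. -/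
theorem heisPt_zero_central {n : ℕ} (s : ℝ) (q : Heis n) :
    heisMul (heisPt 0 s) q = heisMul q (heisPt 0 s) := by
  simp [heisMul, heisPt, sympl, add_comm]

/-- The dilation `δ_r (x, t) = (r x, r² t)`, for `r ≠ 0`, as a linear isomorphism. -/
def dil (n : ℕ) (r : ℝ) (hr : r ≠ 0) : Heis n ≃L[ℝ] Heis n :=
  ((WithLp.prodContinuousLinearEquiv 2 ℝ (Horiz n) ℝ).trans
    ((ContinuousLinearEquiv.smulLeft (Units.mk0 r hr)).prodCongr
      (ContinuousLinearEquiv.smulLeft (Units.mk0 (r ^ 2) (pow_ne_zero 2 hr))))).trans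
    (WithLp.prodContinuousLinearEquiv 2 ℝ (Horiz n) ℝ).symm

theorem dil_apply {n : ℕ} (r : ℝ) (hr : r ≠ 0) (x : Horiz n) (t : ℝ) :
    dil n r hr (heisPt x t) = heisPt (r • x) (r ^ 2 * t) := rfl

/-- The homogeneous dimension `Q = 2n + 2`. -/
def homDim (n : ℕ) : ℕ := 2 * n + 2

/-- A distribution `u` is homogeneous of degree `d` if
`⟨u, φ ∘ δ_r⟩ = r ^ (-Q - d) ⟨u, φ⟩` for all `r > 0`. -/
def IsHomogeneousDist {n : ℕ} (u : 𝓢'(Heis n, ℂ)) (d : ℤ) : Prop :=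
  ∀ (r : ℝ) (hr : 0 < r) (φ : 𝓢(Heis n, ℂ)),
    u (SchwartzMap.compCLMOfContinuousLinearEquiv ℂ (dil n r hr.ne') φ)
      = (r : ℂ) ^ (-(homDim n : ℤ) - d) * u φ

/-- `f` is a smooth function on the complement of the origin, and the distribution `u` is given by
integration against `f` on the complement of the origin. -/
def IsDensityAwayZero {n : ℕ} (u : 𝓢'(Heis n, ℂ)) (f : Heis n → ℂ) : Prop :=
  ContDiffOn ℝ ∞ f {0}ᶜ ∧
    ∀ φ : 𝓢(Heis n, ℂ), HasCompactSupport φ → (0 : Heis n) ∉ tsupport φ →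
      u φ = ∫ p, f p * φ p

/-- Regular distributions: those that restrict to a smooth function on the complement of `0`. -/
def IsRegularDist {n : ℕ} (u : 𝓢'(Heis n, ℂ)) : Prop := ∃ f, IsDensityAwayZero u f

open Classical in
/-- The smooth function on the complement of `0` to which a regular distribution restricts.
(It is unique there; the value at `0`, and the values when `u` is not regular, carry no meaning.) -/
def density {n : ℕ} (u : 𝓢'(Heis n, ℂ)) : Heis n → ℂ :=
  if h : IsRegularDist u then h.choose else 0

/-- `k` represents an element of the algebra of principal Heisenberg symbols of order zero:
a regular distribution, homogeneous of degree `-Q`. -/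
structure IsSymbol {n : ℕ} (k : 𝓢'(Heis n, ℂ)) : Prop where
  regular : IsRegularDist k
  homogeneous : IsHomogeneousDist k (-(homDim n : ℤ))

/-- The Fourier transform of Schwartz functions, in the normalization
`φ ↦ (q ↦ ∫ φ(p) e^{-i ⟨p, q⟩} dp)`; see `fourierS_apply`. -/
def fourierS (n : ℕ) : 𝓢(Heis n, ℂ) →L[ℂ] 𝓢(Heis n, ℂ) :=
  (SchwartzMap.compCLMOfContinuousLinearEquiv ℂ
    (ContinuousLinearEquiv.smulLeft
      (Units.mk0 ((2 * Real.pi)⁻¹ : ℝ) (inv_ne_zero Real.two_pi_pos.ne')) :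
        Heis n ≃L[ℝ] Heis n)).comp
    (FourierTransform.fourierCLM ℂ 𝓢(Heis n, ℂ))

theorem fourierS_apply {n : ℕ} (φ : 𝓢(Heis n, ℂ)) (y : Horiz n) (s : ℝ) :
    fourierS n φ (heisPt y s)
      = ∫ p : Heis n, φ p * Complex.exp (-Complex.I * ((inner ℝ p.fst y + p.snd * s : ℝ) : ℂ)) := by
  have h : fourierS n φ (heisPt y s) = (𝓕 φ) ((2 * Real.pi)⁻¹ • heisPt y s) := rfl
  rw [h, SchwartzMap.fourier_coe, Real.fourier_eq']
  refine integral_congr_ae (Filter.Eventually.of_forall fun p => ?_)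
  simp only [smul_eq_mul, inner_smul_right, WithLp.prod_inner_apply, heisPt]
  rw [mul_comm]
  congr 2
  have hpi : (Real.pi : ℂ) ≠ 0 := by exact_mod_cast Real.pi_ne_zero
  simp
  field_simp

/-- The Fourier transform of tempered distributions, `⟨k̂, φ⟩ = ⟨k, φ̂⟩`. -/
def fourierD {n : ℕ} (k : 𝓢'(Heis n, ℂ)) : 𝓢'(Heis n, ℂ) :=
  PointwiseConvergenceCLM.precomp ℂ (fourierS n) k

theorem fourierD_apply {n : ℕ} (k : 𝓢'(Heis n, ℂ)) (φ : 𝓢(Heis n, ℂ)) :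
    fourierD k φ = k (fourierS n φ) := rfl

/-- `σ₊(x) = k̂(x, +1)`. -/
def sigmaPlus {n : ℕ} (k : 𝓢'(Heis n, ℂ)) (x : Horiz n) : ℂ := density (fourierD k) (heisPt x 1)

/-- `σ₋(x) = k̂(x, -1)`. -/
def sigmaMinus {n : ℕ} (k : 𝓢'(Heis n, ℂ)) (x : Horiz n) : ℂ :=
  density (fourierD k) (heisPt x (-1))

/-- `w l` (standing for `w_{2l}`) is smooth on `ℝ^{2n} \ 0` and homogeneous of degree `-2l`, and
`σ₊ ∼ ∑ w_{2l}`, `σ₋ ∼ ∑ (-1)^l w_{2l}` as `‖x‖ → ∞`. -/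
structure IsExpansion {n : ℕ} (k : 𝓢'(Heis n, ℂ)) (w : ℕ → Horiz n → ℂ) : Prop where
  smooth : ∀ l, ContDiffOn ℝ ∞ (w l) {0}ᶜ
  homogeneous : ∀ l (r : ℝ), 0 < r → ∀ x : Horiz n, x ≠ 0 →
    w l (r • x) = (r : ℂ) ^ (-(2 * l : ℤ)) * w l x
  plus : ∀ N : ℕ, (fun x => sigmaPlus k x - ∑ l ∈ Finset.range N, w l x)
    =O[Bornology.cobounded (Horiz n)] fun x => ‖x‖ ^ (-(2 * N : ℤ))
  minus : ∀ N : ℕ, (fun x => sigmaMinus k x - ∑ l ∈ Finset.range N, (-1) ^ l * w l x)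
    =O[Bornology.cobounded (Horiz n)] fun x => ‖x‖ ^ (-(2 * N : ℤ))

open Classical in
/-- The coefficient `w_{2l}` of the asymptotic expansions of `σ₊` and `σ₋`.
(It is unique on `ℝ^{2n} \ 0`; the values when there is no expansion carry no meaning.) -/
def coeffW {n : ℕ} (k : 𝓢'(Heis n, ℂ)) : ℕ → Horiz n → ℂ :=
  if h : ∃ w, IsExpansion k w then h.choose else 0

/-- `𝓡 = σ₊ - (-1)^n σ₋ - ∑_{l < n} (1 - (-1)^{n+l}) w_{2l}`. -/
def remainderR {n : ℕ} (k : 𝓢'(Heis n, ℂ)) (x : Horiz n) : ℂ :=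
  sigmaPlus k x - (-1) ^ n * sigmaMinus k x
    - ∑ l ∈ Finset.range n, (1 - (-1) ^ (n + l)) * coeffW k l x

/-- The trace `τ(k) = (2π)^{-n} ∫ 𝓡(x) dx`. -/
def tauTrace {n : ℕ} (k : 𝓢'(Heis n, ℂ)) : ℂ :=
  1 / (2 * (Real.pi : ℂ)) ^ n * ∫ x, remainderR k x

/-- The residue trace `Res(k) = -(1 / (2 (2π)^n)) ∫_{S^{2n-1}} a_{2n}(θ) dθ`, where `a_{2n}` is the
restriction of `w_{2n}` to the unit sphere and `dθ` is the surface measure. -/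
def resTrace {n : ℕ} (k : 𝓢'(Heis n, ℂ)) : ℂ :=
  -(1 / (2 * (2 * (Real.pi : ℂ)) ^ n)) *
    ∫ θ : Metric.sphere (0 : Horiz n) 1, coeffW k n θ ∂(volume : Measure (Horiz n)).toSphere

/-- The trace `τ_z(k) = k(z)`, for `z ≠ 0`. -/
def tauAt {n : ℕ} (z : Heis n) (k : 𝓢'(Heis n, ℂ)) : ℂ := density k z

end

/-! The formula is a regularised Fourier inversion on the centre. Formally (2π)^{2n+1} k(0,s) = ∫∫
k̂(x,t) e^{its} dx dt, but k̂ is homogeneous of degree zero and the x-integral diverges. By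
homogeneity k̂(x,t) behaves for large x like its Taylor series ∑ w_{2l}(x) t^l at t = 0. A
polynomial in t has its inverse Fourier transform supported at s = 0, so such terms can be
subtracted without affecting s ≠ 0. The terms with l < n are integrable near x = 0 and are
subtracted for all x. The term l = n has the critical degree -2n and is subtracted only for ‖x‖ ≥ 1.
The rest, `profile`, is integrable in x for each t ≠ 0.

Let P(t) be the integral of the profile over x. Everything in it is dilation invariant except the
cut at ‖x‖ = 1, whence P(t) = |t|^n P(±1) - t^n (C/2) log|t|, where C is the integral of w_{2n} over
the unit sphere (`integral_profile`). On a half line this is t^n (A - c log t), with Laplace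
transform z^{-n-1} (M + c n! log z) (`laplace_powLog`). The Fourier integrals over the half lines t
> 0 and t < 0 are its boundary values at z = -is and z = is. In their sum the transcendental
constant ∫ t^n log t e^{-t} dt cancels, the constants P(±1) combine to P(1) - (-1)^n P(-1) = ∫ 𝓡,
which gives τ, and log(-is) - log(is) = -iπ sgn(s) produces the residue term
(`powLogTransform_add`).

Two facts about k̂ support this. It is smooth off the origin: a dyadic decomposition writes it as a
constant plus a sum of dilates of one Schwartz function vanishing at 0 (`isRegularDist_fourierD`).
Being of degree zero, it has no mass at the origin and acts by integration against a bounded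
function (`IsDensityAwayZero.eq_integral`). The restriction of k to the centre is reached by pairing
with products A(y/ε) β(s) and letting ε tend to 0 (`two_pi_pow_mul_verticalPairing`). -/

open MeasureTheory Filter Topology
open scoped SchwartzMap FourierTransform ContDiff

/-! ### Convergence in Schwartz space and derivative bounds. -/

section Generic

variable {E : Type*} [NormedAddCommGroup E] [NormedSpace ℝ E]

/-- A sequence of Schwartz functions that are products `A j * B j` tends to zero when the products
of the derivatives of the factors decay uniformly. -/
theorem schwartz_tendsto_zero_of_mul {F : ℕ → 𝓢(E, ℂ)} {A B : ℕ → E → ℂ}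
    (hA : ∀ j, ContDiff ℝ ∞ (A j)) (hB : ∀ j, ContDiff ℝ ∞ (B j))
    (hF : ∀ j x, F j x = A j x * B j x) {ε : ℕ → ℝ} (hε : Tendsto ε atTop (𝓝 0))
    (H : ∀ k m l : ℕ, ∃ C : ℝ, ∀ j x, ‖x‖ ^ k * ‖iteratedFDeriv ℝ m (A j) x‖ *
      ‖iteratedFDeriv ℝ l (B j) x‖ ≤ C * ε j) :
    Tendsto F atTop (𝓝 0) := by
  rw [(schwartz_withSeminorms ℂ E ℂ).tendsto_nhds _ _]
  rintro ⟨k, m⟩ δ hδ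
  choose C hC using H
  set K := ∑ i ∈ Finset.range (m + 1), (m.choose i : ℝ) * C k i (m - i) with hK
  have key : ∀ j x, ‖x‖ ^ k * ‖iteratedFDeriv ℝ m (F j) x‖ ≤ K * ε j := by
    intro j x
    have h1 : (F j : E → ℂ) = fun y => A j y * B j y := funext (hF j)
    have h2 := norm_iteratedFDeriv_mul_le (hA j) (hB j) x (n := m) (by exact_mod_cast le_top)
    rw [h1]
    calc _ ≤ ‖x‖ ^ k * _ := mul_le_mul_of_nonneg_left h2 (by positivity)
      _ = ∑ i ∈ Finset.range (m + 1), (m.choose i : ℝ) * (‖x‖ ^ k *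
          ‖iteratedFDeriv ℝ i (A j) x‖ * ‖iteratedFDeriv ℝ (m - i) (B j) x‖) := by
        rw [Finset.mul_sum]; exact Finset.sum_congr rfl fun i _ => by ring
      _ ≤ ∑ i ∈ Finset.range (m + 1), (m.choose i : ℝ) * (C k i (m - i) * ε j) := by
        exact Finset.sum_le_sum fun i _ =>
          mul_le_mul_of_nonneg_left (hC k i (m - i) j x) (by positivity)
      _ = K * ε j := by rw [hK, Finset.sum_mul]; exact Finset.sum_congr rfl fun i _ => by ring
  have h3 : Tendsto (fun j => K * ε j) atTop (𝓝 0) := by simpa using hε.const_mul K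
  filter_upwards [h3.eventually_lt_const hδ] with j hj
  rw [sub_zero, SchwartzMap.schwartzSeminormFamily_apply]
  refine lt_of_le_of_lt (SchwartzMap.seminorm_le_bound ℂ k m (F j) ?_ (key j)) hj
  exact le_trans (by positivity) (key j 0)

theorem norm_iteratedFDeriv_comp_clm_le {F : Type*} [NormedAddCommGroup F] [NormedSpace ℝ F]
    {f : E → F} (hf : ContDiff ℝ ∞ f) (L : E →L[ℝ] E) (m : ℕ) (x : E) :
    ‖iteratedFDeriv ℝ m (fun y => f (L y)) x‖ ≤ ‖iteratedFDeriv ℝ m f (L x)‖ * ‖L‖ ^ m := by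
  have h := L.iteratedFDeriv_comp_right (f := f) hf x (i := m) (by exact_mod_cast le_top)
  rw [show (fun y => f (L y)) = f ∘ L from rfl, h]
  refine (ContinuousMultilinearMap.norm_compContinuousLinearMap_le _ _).trans_eq ?_
  simp

/-- All derivatives of a compactly supported smooth function are bounded. -/
theorem exists_bound_iteratedFDeriv {F : Type*} [NormedAddCommGroup F] [NormedSpace ℝ F]
    {f : E → F} (hf : ContDiff ℝ ∞ f) (hc : HasCompactSupport f) (m : ℕ) :
    ∃ C : ℝ, 0 ≤ C ∧ ∀ x, ‖iteratedFDeriv ℝ m f x‖ ≤ C := by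
  obtain ⟨C, h0, hC⟩ := (hc.toSchwartzMap hf).decay 0 m
  exact ⟨C, h0.le, fun x => by
    have := hC x
    rwa [pow_zero, one_mul] at this⟩

end Generic

/-! ### Metric and measure-theoretic properties of the dilations. -/

section Dilation

variable {n : ℕ}

@[simp] theorem dil_fst (r : ℝ) (hr : r ≠ 0) (p : Heis n) : (dil n r hr p).fst = r • p.fst := rfl

@[simp] theorem dil_snd (r : ℝ) (hr : r ≠ 0) (p : Heis n) : (dil n r hr p).snd = r ^ 2 * p.snd := rfl

theorem heis_norm_sq (p : Heis n) : ‖p‖ ^ 2 = ‖p.fst‖ ^ 2 + p.snd ^ 2 := by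
  rw [WithLp.prod_norm_sq_eq_of_L2]; simp

theorem heis_ext {p q : Heis n} (h1 : p.fst = q.fst) (h2 : p.snd = q.snd) : p = q :=
  (WithLp.ofLp_injective 2) (Prod.ext h1 h2)

theorem dil_dil (r s : ℝ) (hr : r ≠ 0) (hs : s ≠ 0) (p : Heis n) :
    dil n r hr (dil n s hs p) = dil n (r * s) (mul_ne_zero hr hs) p := by
  apply heis_ext
  · simp [mul_smul]
  · simp; ring

theorem dil_one (p : Heis n) (h : (1 : ℝ) ≠ 0) : dil n 1 h p = p := by
  apply heis_ext <;> simp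

theorem dil_mul_inv (r s : ℝ) (hr : r ≠ 0) (hs : s ≠ 0) (h : r * s = 1) (p : Heis n) :
    dil n r hr (dil n s hs p) = p := by
  rw [dil_dil]; convert dil_one p one_ne_zero

/-- The horizontal weight r and the central weight r² exchange roles at r = 1: the larger one bounds
the norm from above, the smaller one from below. -/
theorem norm_dil_le_of_le_one {r : ℝ} (hr : 0 < r) (hr1 : r ≤ 1) (p : Heis n) :
    ‖dil n r hr.ne' p‖ ≤ r * ‖p‖ := by
  refine le_of_sq_le_sq ?_ (by positivity)
  rw [mul_pow, heis_norm_sq, heis_norm_sq, dil_fst, dil_snd, norm_smul, Real.norm_of_nonneg hr.le]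
  have : r ^ 2 ≤ 1 := pow_le_one₀ hr.le hr1
  nlinarith [mul_nonneg (mul_nonneg (sq_nonneg r) (sub_nonneg.2 this)) (sq_nonneg p.snd)]

theorem norm_dil_le_of_one_le {r : ℝ} (hr : 0 < r) (hr1 : 1 ≤ r) (p : Heis n) :
    ‖dil n r hr.ne' p‖ ≤ r ^ 2 * ‖p‖ := by
  refine le_of_sq_le_sq ?_ (by positivity)
  rw [mul_pow, heis_norm_sq, heis_norm_sq, dil_fst, dil_snd, norm_smul, Real.norm_of_nonneg hr.le]
  have : 1 ≤ r ^ 2 := one_le_pow₀ hr1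
  nlinarith [mul_nonneg (mul_nonneg (sq_nonneg r) (sub_nonneg.2 this)) (sq_nonneg ‖p.fst‖)]

theorem le_norm_dil {r : ℝ} (hr : 0 < r) (hr1 : 1 ≤ r) (p : Heis n) :
    r * ‖p‖ ≤ ‖dil n r hr.ne' p‖ := by
  have h := norm_dil_le_of_le_one (inv_pos.2 hr) (inv_le_one_of_one_le₀ hr1) (dil n r hr.ne' p)
  rw [dil_mul_inv _ _ _ _ (inv_mul_cancel₀ hr.ne')] at h
  calc r * ‖p‖ ≤ r * (r⁻¹ * ‖dil n r hr.ne' p‖) := by gcongr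
    _ = _ := by field_simp

theorem opNorm_dil_le_of_le_one {r : ℝ} (hr : 0 < r) (hr1 : r ≤ 1) :
    ‖(dil n r hr.ne' : Heis n →L[ℝ] Heis n)‖ ≤ r :=
  ContinuousLinearMap.opNorm_le_bound _ hr.le (norm_dil_le_of_le_one hr hr1)

theorem opNorm_dil_le_of_one_le {r : ℝ} (hr : 0 < r) (hr1 : 1 ≤ r) :
    ‖(dil n r hr.ne' : Heis n →L[ℝ] Heis n)‖ ≤ r ^ 2 :=
  ContinuousLinearMap.opNorm_le_bound _ (by positivity) (norm_dil_le_of_one_le hr hr1)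

theorem inner_dil (r : ℝ) (hr : r ≠ 0) (p q : Heis n) :
    inner ℝ (dil n r hr p) q = inner ℝ p (dil n r hr q) := by
  simp only [WithLp.prod_inner_apply, ← WithLp.fst.eq_1]
  simp [dil, inner_smul_left, inner_smul_right]
  ring

theorem measurePreserving_heisPt :
    MeasurePreserving (fun q : Horiz n × ℝ => heisPt q.1 q.2) := WithLp.volume_preserving_toLp _ _

theorem measurableEmbedding_heisPt :
    MeasurableEmbedding (fun q : Horiz n × ℝ => heisPt q.1 q.2) :=
  (MeasurableEquiv.toLp 2 (Horiz n × ℝ)).measurableEmbedding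

theorem integral_heis (f : Heis n → ℂ) :
    ∫ p, f p = ∫ q : Horiz n × ℝ, f (heisPt q.1 q.2) :=
  (measurePreserving_heisPt.integral_comp measurableEmbedding_heisPt f).symm

theorem det_dil (r : ℝ) (hr : r ≠ 0) :
    LinearMap.det ((dil n r hr).toLinearEquiv : Heis n →ₗ[ℝ] Heis n) = r ^ homDim n := by
  have h : ((dil n r hr).toLinearEquiv : Heis n →ₗ[ℝ] Heis n) =
      ((WithLp.prodContinuousLinearEquiv 2 ℝ (Horiz n) ℝ).symm.toLinearEquiv :
        (Horiz n × ℝ) →ₗ[ℝ] Heis n) ∘ₗ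
      ((r • LinearMap.id : Horiz n →ₗ[ℝ] Horiz n).prodMap (r ^ 2 • LinearMap.id : ℝ →ₗ[ℝ] ℝ)) ∘ₗ
      ((WithLp.prodContinuousLinearEquiv 2 ℝ (Horiz n) ℝ).symm.toLinearEquiv.symm :
        Heis n →ₗ[ℝ] (Horiz n × ℝ)) := by
    ext p; all_goals rfl
  rw [h, LinearMap.det_conj, LinearMap.det_prodMap]
  simp [homDim, pow_add]

theorem integral_comp_dil {r : ℝ} (hr : 0 < r) (f : Heis n → ℂ) :
    ∫ p, f (dil n r hr.ne' p) = ((r : ℂ) ^ homDim n)⁻¹ * ∫ p, f p := by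
  have h1 := Measure.map_linearMap_addHaar_eq_smul_addHaar (volume : Measure (Heis n))
    (f := ((dil n r hr.ne').toLinearEquiv : Heis n →ₗ[ℝ] Heis n))
    (by rw [det_dil]; positivity)
  have h2 := (dil n r hr.ne').toHomeomorph.measurableEmbedding.integral_map
    (μ := volume) f
  have h3 : (volume : Measure (Heis n)).map (dil n r hr.ne').toHomeomorph =
    (volume : Measure (Heis n)).map ((dil n r hr.ne').toLinearEquiv : Heis n →ₗ[ℝ] Heis n) := rfl
  rw [h3, h1, det_dil, integral_smul_measure] at h2
  refine Eq.trans h2.symm ?_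
  rw [ENNReal.toReal_ofReal (by positivity), abs_of_pos (by positivity)]
  simp

end Dilation

/-! ### Derivatives after subtraction of a constant. -/

section SubConst

variable {E F : Type*} [NormedAddCommGroup E] [NormedSpace ℝ E] [NormedAddCommGroup F]
  [NormedSpace ℝ F]

theorem iteratedFDeriv_sub_const_of_ne {f : E → F} (hf : ContDiff ℝ ∞ f) (c : F) {m : ℕ}
    (hm : m ≠ 0) (x : E) :
    iteratedFDeriv ℝ m (fun y => f y - c) x = iteratedFDeriv ℝ m f x := by
  rw [fun_iteratedFDeriv_sub_apply (hf.contDiffAt.of_le (by exact_mod_cast le_top))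
    contDiffAt_const, iteratedFDeriv_const_of_ne hm]
  simp

end SubConst

/-! ### Dilated cutoffs and their limits in Schwartz space. -/

section Cutoff

variable {n : ℕ}

/-- A bump function on the Heisenberg group: one on the unit ball, zero off the ball of radius
two. -/
noncomputable def heisBump (n : ℕ) : ContDiffBump (0 : Heis n) := ⟨1, 2, one_pos, one_lt_two⟩

/-- The bump function `heisBump` with complex values. -/
noncomputable def cutoff (p : Heis n) : ℂ := ((heisBump n p : ℝ) : ℂ)

theorem cutoff_contDiff : ContDiff ℝ ∞ (cutoff (n := n)) :=
  Complex.ofRealCLM.contDiff.comp (heisBump n).contDiff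

theorem cutoff_eq_one {p : Heis n} (hp : ‖p‖ ≤ 1) : cutoff p = 1 := by
  rw [cutoff, (heisBump n).one_of_mem_closedBall (by simpa [heisBump] using hp)]; simp

theorem cutoff_eq_zero {p : Heis n} (hp : 2 ≤ ‖p‖) : cutoff p = 0 := by
  rw [cutoff, (heisBump n).zero_of_le_dist (by simpa [heisBump] using hp)]; simp

theorem norm_cutoff_le (p : Heis n) : ‖cutoff p‖ ≤ 1 := by
  rw [cutoff, Complex.norm_real, Real.norm_of_nonneg (heisBump n).nonneg]
  exact (heisBump n).le_one

theorem tsupport_cutoff_subset : tsupport (cutoff (n := n)) ⊆ Metric.closedBall 0 2 :=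
  closure_minimal (fun p hp => by
    rw [Metric.mem_closedBall, dist_zero_right]
    by_contra! h
    exact hp (cutoff_eq_zero h.le)) Metric.isClosed_closedBall

theorem cutoff_hasCompactSupport : HasCompactSupport (cutoff (n := n)) :=
  (isCompact_closedBall _ _).of_isClosed_subset (isClosed_tsupport _) tsupport_cutoff_subset

theorem cutoff_dil_contDiff (r : ℝ) (hr : r ≠ 0) :
    ContDiff ℝ ∞ (fun p : Heis n => cutoff (dil n r hr p)) :=
  cutoff_contDiff.comp (dil n r hr).contDiff

theorem cutoff_dil_hasCompactSupport (r : ℝ) (hr : r ≠ 0) :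
    HasCompactSupport (fun p : Heis n => cutoff (dil n r hr p)) :=
  cutoff_hasCompactSupport.comp_homeomorph (dil n r hr).toHomeomorph

theorem hasTemperateGrowth_of_compact {f : Heis n → ℂ} (hf : ContDiff ℝ ∞ f)
    (hc : HasCompactSupport f) : f.HasTemperateGrowth :=
  (hc.toSchwartzMap hf).hasTemperateGrowth

/-- Composition of a Schwartz function with a dilation. -/
noncomputable abbrev compDil (r : ℝ) (hr : r ≠ 0) : 𝓢(Heis n, ℂ) →L[ℂ] 𝓢(Heis n, ℂ) :=
  SchwartzMap.compCLMOfContinuousLinearEquiv ℂ (dil n r hr)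

theorem compDil_apply (r : ℝ) (hr : r ≠ 0) (φ : 𝓢(Heis n, ℂ)) (p : Heis n) :
    compDil r hr φ p = φ (dil n r hr p) := rfl

/-- The product of a Schwartz function with a dilated cutoff function. -/
noncomputable abbrev mulCutoff (r : ℝ) (hr : r ≠ 0) : 𝓢(Heis n, ℂ) →L[ℂ] 𝓢(Heis n, ℂ) :=
  SchwartzMap.smulLeftCLM ℂ (fun p => cutoff (dil n r hr p))

theorem mulCutoff_apply (r : ℝ) (hr : r ≠ 0) (φ : 𝓢(Heis n, ℂ)) (p : Heis n) :
    mulCutoff r hr φ p = cutoff (dil n r hr p) * φ p := by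
  rw [mulCutoff, SchwartzMap.smulLeftCLM_apply_apply
    (hasTemperateGrowth_of_compact (cutoff_dil_contDiff r hr) (cutoff_dil_hasCompactSupport r hr))]
  rfl

theorem half_pow_pos (j : ℕ) : 0 < (1 / 2 : ℝ) ^ j := by positivity

theorem half_pow_le_one (j : ℕ) : (1 / 2 : ℝ) ^ j ≤ 1 := pow_le_one₀ (by norm_num) (by norm_num)

theorem two_pow_pos (j : ℕ) : 0 < (2 : ℝ) ^ j := by positivity

theorem two_pow_mul_half_pow (j : ℕ) : (2 : ℝ) ^ j * (1 / 2) ^ j = 1 := by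
  rw [← mul_pow]; norm_num

theorem tendsto_half_pow : Tendsto (fun j : ℕ => (1 / 2 : ℝ) ^ j) atTop (𝓝 0) :=
  tendsto_pow_atTop_nhds_zero_of_lt_one (by norm_num) (by norm_num)

/-- Each derivative of the dilated cutoff gains a factor ‖δ_r‖ ≤ 1, so the bounds are uniform in r.
The summand 2 in the constant serves l = 0, where the constant 1 does not differentiate away. -/
theorem exists_bound_cutoff_dil_sub_one (l : ℕ) : ∃ K : ℝ, 0 ≤ K ∧ ∀ (r : ℝ) (hr : 0 < r), r ≤ 1 →
    ∀ x : Heis n, ‖iteratedFDeriv ℝ l (fun p : Heis n => cutoff (dil n r hr.ne' p) - 1) x‖ ≤ K := by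
  obtain ⟨C, hC0, hC⟩ := exists_bound_iteratedFDeriv (cutoff_contDiff (n := n))
    cutoff_hasCompactSupport l
  refine ⟨C + 2, by positivity, fun r hr hr1 x => ?_⟩
  rcases Nat.eq_zero_or_pos l with rfl | hl
  · rw [norm_iteratedFDeriv_zero]
    have := norm_sub_le (cutoff (dil n r hr.ne' x)) 1
    have := norm_cutoff_le (dil n r hr.ne' x)
    rw [norm_one] at *
    linarith
  · rw [iteratedFDeriv_sub_const_of_ne (cutoff_dil_contDiff r hr.ne') _ hl.ne']
    have h := norm_iteratedFDeriv_comp_clm_le (cutoff_contDiff (n := n))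
      (dil n r hr.ne' : Heis n →L[ℝ] Heis n) l x
    refine h.trans ?_
    have h1 : ‖(dil n r hr.ne' : Heis n →L[ℝ] Heis n)‖ ^ l ≤ 1 :=
      pow_le_one₀ (norm_nonneg _) ((opNorm_dil_le_of_le_one hr hr1).trans hr1)
    have h2 := hC ((dil n r hr.ne' : Heis n →L[ℝ] Heis n) x)
    nlinarith [norm_nonneg (iteratedFDeriv ℝ l (cutoff (n := n)) ((dil n r hr.ne' : Heis n →L[ℝ] Heis n) x))]

/-- The error factor cutoff - 1 vanishes where r‖x‖ < 1. Elsewhere 1 ≤ r‖x‖, and trading one more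
power of ‖x‖ for the factor r gives convergence in every seminorm. -/
theorem tendsto_mulCutoff (φ : 𝓢(Heis n, ℂ)) :
    Tendsto (fun j => mulCutoff ((1 / 2 : ℝ) ^ j) (half_pow_pos j).ne' φ) atTop (𝓝 φ) := by
  rw [← tendsto_sub_nhds_zero_iff]
  refine schwartz_tendsto_zero_of_mul (A := fun _ => φ)
    (B := fun j p => cutoff (dil n ((1 / 2 : ℝ) ^ j) (half_pow_pos j).ne' p) - 1)
    (fun _ => φ.smooth ⊤) (fun j => (cutoff_dil_contDiff _ _).sub contDiff_const) (fun j x => ?_)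
    tendsto_half_pow (fun k m l => ?_)
  · rw [sub_apply, mulCutoff_apply]; ring
  obtain ⟨K, hK0, hK⟩ := exists_bound_cutoff_dil_sub_one (n := n) l
  refine ⟨SchwartzMap.seminorm ℂ (k + 1) m φ * K, fun j x => ?_⟩
  set r := (1 / 2 : ℝ) ^ j with hr
  by_cases hx : r * ‖x‖ < 1
  · have h0 : iteratedFDeriv ℝ l (fun p : Heis n => cutoff (dil n r (half_pow_pos j).ne' p) - 1) x
        = 0 := by
      have : (fun p : Heis n => cutoff (dil n r (half_pow_pos j).ne' p) - 1) =ᶠ[𝓝 x]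
          fun _ => (0 : ℂ) := by
        filter_upwards [(isOpen_lt (continuous_const.mul continuous_norm) continuous_const).mem_nhds
          hx] with y hy
        rw [cutoff_eq_one ((norm_dil_le_of_le_one (half_pow_pos j) (half_pow_le_one j) y).trans
          (le_of_lt hy)), sub_self]
      rw [(this.iteratedFDeriv ℝ l).eq_of_nhds]
      simp
    rw [h0, norm_zero, mul_zero]
    have := half_pow_pos j
    positivity
  · push Not at hx
    have h1 := SchwartzMap.le_seminorm ℂ (k + 1) m φ x
    have h2 := hK r (half_pow_pos j) (half_pow_le_one j) x
    calc _ ≤ (‖x‖ ^ k * ‖iteratedFDeriv ℝ m φ x‖) * K := by gcongr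
      _ ≤ (‖x‖ ^ k * ‖iteratedFDeriv ℝ m φ x‖) * K * (r * ‖x‖) :=
        le_mul_of_one_le_right (by positivity) hx
      _ = (‖x‖ ^ (k + 1) * ‖iteratedFDeriv ℝ m φ x‖) * K * r := by ring
      _ ≤ _ := by have := half_pow_pos j; gcongr

theorem norm_comp_dil_sub_le (φ : 𝓢(Heis n, ℂ)) {r : ℝ} (hr : 0 < r) (hr1 : r ≤ 1) (x : Heis n) :
    ‖φ (dil n r hr.ne' x) - φ 0‖ ≤ SchwartzMap.seminorm ℂ 0 1 φ * (r * ‖x‖) := by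
  have h := Convex.norm_image_sub_le_of_norm_fderiv_le (𝕜 := ℝ) (f := φ) (s := Set.univ)
    (C := SchwartzMap.seminorm ℂ 0 1 φ) (fun y _ => φ.differentiableAt) (fun y _ => by
      have := SchwartzMap.norm_iteratedFDeriv_le_seminorm ℂ φ 1 y
      rwa [norm_iteratedFDeriv_one] at this)
    convex_univ (Set.mem_univ 0) (Set.mem_univ (dil n r hr.ne' x))
  refine h.trans ?_
  rw [sub_zero]
  gcongr
  exact norm_dil_le_of_le_one hr hr1 x

/-- The bump function as a Schwartz function. -/
noncomputable def cutoffS (n : ℕ) : 𝓢(Heis n, ℂ) := cutoff_hasCompactSupport.toSchwartzMap cutoff_contDiff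

theorem cutoffS_apply (p : Heis n) : cutoffS n p = cutoff p := rfl

/-- Multiplication by the bump function. -/
noncomputable abbrev mulBump : 𝓢(Heis n, ℂ) →L[ℂ] 𝓢(Heis n, ℂ) := SchwartzMap.smulLeftCLM ℂ (cutoff (n := n))

theorem mulBump_apply (φ : 𝓢(Heis n, ℂ)) (p : Heis n) : mulBump φ p = cutoff p * φ p := by
  rw [mulBump, SchwartzMap.smulLeftCLM_apply_apply
    (hasTemperateGrowth_of_compact cutoff_contDiff cutoff_hasCompactSupport)]
  rfl

/-- On the support of the bump, φ ∘ δ_r - φ(0) is O(r) by the mean value inequality, and its higher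
derivatives are O(r) because each of them contains at least one factor ‖δ_r‖. The limit detects only
φ(0), which is how a point mass at the origin would appear. -/
theorem tendsto_mulBump_compDil (φ : 𝓢(Heis n, ℂ)) :
    Tendsto (fun j => mulBump (compDil ((1 / 2 : ℝ) ^ j) (half_pow_pos j).ne' φ)) atTop
      (𝓝 (φ 0 • cutoffS n)) := by
  rw [← tendsto_sub_nhds_zero_iff]
  refine schwartz_tendsto_zero_of_mul
    (A := fun j p => φ (dil n ((1 / 2 : ℝ) ^ j) (half_pow_pos j).ne' p) - φ 0)
    (B := fun _ => cutoff)
    (fun j => ((φ.smooth ⊤).comp (dil n _ _).contDiff).sub contDiff_const)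
    (fun j => cutoff_contDiff) (fun j x => ?_)
    tendsto_half_pow (fun k m l => ?_)
  · rw [sub_apply, mulBump_apply, smul_apply, compDil_apply, cutoffS_apply,
      smul_eq_mul]
    ring
  obtain ⟨K, hK0, hK⟩ := exists_bound_iteratedFDeriv (cutoff_contDiff (n := n))
    cutoff_hasCompactSupport l
  refine ⟨2 ^ k * (SchwartzMap.seminorm ℂ 0 1 φ * 2 + SchwartzMap.seminorm ℂ 0 m φ) * K,
    fun j x => ?_⟩
  have hr := half_pow_pos j
  have hr1 := half_pow_le_one j
  set r := (1 / 2 : ℝ) ^ j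
  by_cases hx : ‖x‖ ≤ 2
  · have h1 : ‖iteratedFDeriv ℝ m (fun p : Heis n => φ (dil n r hr.ne' p) - φ 0) x‖ ≤
        (SchwartzMap.seminorm ℂ 0 1 φ * 2 + SchwartzMap.seminorm ℂ 0 m φ) * r := by
      rcases Nat.eq_zero_or_pos m with rfl | hm
      · rw [norm_iteratedFDeriv_zero]
        calc _ ≤ _ := norm_comp_dil_sub_le φ hr hr1 x
          _ ≤ SchwartzMap.seminorm ℂ 0 1 φ * (r * 2) := by gcongr
          _ = SchwartzMap.seminorm ℂ 0 1 φ * 2 * r := by ring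
          _ ≤ _ := by gcongr; exact le_add_of_nonneg_right (apply_nonneg _ _)
      · rw [iteratedFDeriv_sub_const_of_ne (f := fun p => φ (dil n r hr.ne' p))
          ((φ.smooth ⊤).comp (dil n r hr.ne').contDiff) _ hm.ne']
        have h := norm_iteratedFDeriv_comp_clm_le (φ.smooth ⊤)
          (dil n r hr.ne' : Heis n →L[ℝ] Heis n) m x
        have h2 := SchwartzMap.norm_iteratedFDeriv_le_seminorm ℂ φ m
          ((dil n r hr.ne' : Heis n →L[ℝ] Heis n) x)
        have h3 : ‖(dil n r hr.ne' : Heis n →L[ℝ] Heis n)‖ ^ m ≤ r :=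
          (pow_le_pow_left₀ (norm_nonneg _) (opNorm_dil_le_of_le_one hr hr1) m).trans
            (pow_le_of_le_one hr.le hr1 hm.ne')
        refine h.trans ?_
        calc _ ≤ SchwartzMap.seminorm ℂ 0 m φ * r := by gcongr
          _ ≤ _ := by gcongr; exact le_add_of_nonneg_left (by positivity)
    calc _ ≤ 2 ^ k * ((SchwartzMap.seminorm ℂ 0 1 φ * 2 + SchwartzMap.seminorm ℂ 0 m φ) * r) * K := by
          gcongr; exact hK x
      _ = _ := by ring
  · have h0 : iteratedFDeriv ℝ l (cutoff (n := n)) x = 0 := by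
      by_contra h
      exact hx (by simpa using tsupport_cutoff_subset (support_iteratedFDeriv_subset l h))
    rw [h0, norm_zero, mul_zero]
    positivity

end Cutoff

/-! ### Densities off the origin: uniqueness, homogeneity, truncation. -/

section Density

variable {n : ℕ} {u : 𝓢'(Heis n, ℂ)} {F : Heis n → ℂ} {d : ℤ}

theorem IsDensityAwayZero.continuousOn (hF : IsDensityAwayZero u F) : ContinuousOn F {0}ᶜ :=
  hF.1.continuousOn

theorem isDensityAwayZero_density (h : IsRegularDist u) : IsDensityAwayZero u (density u) := by
  rw [density, dif_pos h]; exact h.choose_spec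

theorem tsupport_subset_of_imp {X A B : Type*} [TopologicalSpace X] [Zero A] [Zero B] {f : X → A}
    {g : X → B} (h : ∀ x, g x = 0 → f x = 0) : tsupport f ⊆ tsupport g :=
  closure_mono fun x hx h0 => hx (h x h0)

theorem tsupport_mul_subset_left' {X : Type*} [TopologicalSpace X] {f g : X → ℂ} :
    tsupport (fun x => f x * g x) ⊆ tsupport f :=
  tsupport_subset_of_imp fun x h => by simp only [h, zero_mul]

/-- The fundamental lemma of the calculus of variations gives vanishing almost everywhere, and
continuity upgrades this to every point of the open set. -/
theorem eqOn_zero_of_integral_eq_zero {E : Type*} [NormedAddCommGroup E] [NormedSpace ℝ E]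
    [FiniteDimensional ℝ E] [MeasurableSpace E] [BorelSpace E] (μ : Measure E)
    [μ.IsOpenPosMeasure] [IsLocallyFiniteMeasure μ] {U : Set E} (hU : IsOpen U) {f : E → ℂ}
    (hf : ContinuousOn f U)
    (h : ∀ g : E → ℝ, ContDiff ℝ ∞ g → HasCompactSupport g → tsupport g ⊆ U →
      ∫ x, g x • f x ∂μ = 0) : Set.EqOn f 0 U := by
  have h1 := hU.ae_eq_zero_of_integral_contDiff_smul_eq_zero
    (hf.locallyIntegrableOn hU.measurableSet) h
  exact Measure.eqOn_open_of_ae_eq ((ae_restrict_iff' hU.measurableSet).2 h1) hU hf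
    continuousOn_const

/-- This makes the values of `density` off the origin independent of the choice in its definition.
-/
theorem IsDensityAwayZero.eqOn {F' : Heis n → ℂ} (hF : IsDensityAwayZero u F)
    (hF' : IsDensityAwayZero u F') : Set.EqOn F F' {0}ᶜ := by
  have h := eqOn_zero_of_integral_eq_zero (volume : Measure (Heis n)) isOpen_compl_singleton
    (hF.continuousOn.sub hF'.continuousOn) (fun g hg hc hs => by
      have hc' : HasCompactSupport (fun x => (g x : ℂ)) :=
        hc.comp_left (g := fun t : ℝ => (t : ℂ)) (by simp)
      have hg' : ContDiff ℝ ∞ (fun x => (g x : ℂ)) := Complex.ofRealCLM.contDiff.comp hg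
      have hs' : tsupport (fun x => (g x : ℂ)) ⊆ {0}ᶜ :=
        (tsupport_subset_of_imp fun x h => by simp only [h, Complex.ofReal_zero]).trans hs
      have h0 : (0 : Heis n) ∉ tsupport (hc'.toSchwartzMap hg') := fun h => hs' h rfl
      have e1 := hF.2 (hc'.toSchwartzMap hg') hc' h0
      have e2 := hF'.2 (hc'.toSchwartzMap hg') hc' h0
      have hi : ∀ {G : Heis n → ℂ}, ContinuousOn G {0}ᶜ →
          Integrable (fun x => G x * (g x : ℂ)) := fun {G} hG => by
        refine Continuous.integrable_of_hasCompactSupport ?_ ?_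
        · refine continuous_of_tsupport fun x hx => ?_
          have hx0 : x ∈ ({0}ᶜ : Set (Heis n)) := hs' (tsupport_subset_of_imp
            (fun y h => by simp only [h, mul_zero]) hx)
          exact ((hG.continuousAt (isOpen_compl_singleton.mem_nhds hx0)).mul
            hg'.continuous.continuousAt)
        · exact hc'.mul_left
      have e3 : ∫ x, F x * (g x : ℂ) = ∫ x, F' x * (g x : ℂ) := e1.symm.trans e2
      calc ∫ x, g x • (F - F') x = ∫ x, (F x * (g x : ℂ) - F' x * (g x : ℂ)) := by
            congr 1; ext x; simp; ring
        _ = 0 := by rw [integral_sub (hi hF.continuousOn) (hi hF'.continuousOn), e3, sub_self])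
  intro x hx
  exact sub_eq_zero.1 (h hx)

theorem dil_ne_zero {r : ℝ} (hr : r ≠ 0) {p : Heis n} (hp : p ≠ 0) : dil n r hr p ≠ 0 := by
  simpa using hp

/-- By a change of variables r^{-d} F ∘ δ_r is again a density of u, so uniqueness of the density
identifies it with F. -/
theorem IsDensityAwayZero.homogeneous (hF : IsDensityAwayZero u F) (hu : IsHomogeneousDist u d)
    {r : ℝ} (hr : 0 < r) {p : Heis n} (hp : p ≠ 0) :
    F (dil n r hr.ne' p) = (r : ℂ) ^ d * F p := by
  have hr' : (r : ℂ) ≠ 0 := by exact_mod_cast hr.ne'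
  have key : IsDensityAwayZero u (fun p => (r : ℂ) ^ (-d) * F (dil n r hr.ne' p)) := by
    constructor
    · refine contDiffOn_const.mul (hF.1.comp (dil n r hr.ne').contDiff.contDiffOn fun q hq => ?_)
      exact dil_ne_zero hr.ne' hq
    · intro φ hc h0
      have hri := inv_pos.2 hr
      set ψ := compDil r⁻¹ hri.ne' φ with hψ
      have hφ : φ = compDil r hr.ne' ψ := by
        ext q
        rw [hψ, compDil_apply, compDil_apply, dil_mul_inv _ _ _ _ (inv_mul_cancel₀ hr.ne')]
      have h1 : u ψ = (r : ℂ) ^ ((homDim n : ℤ) + d) * u φ := by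
        have := hu r hr ψ
        rw [show SchwartzMap.compCLMOfContinuousLinearEquiv ℂ (dil n r hr.ne') ψ = φ from hφ.symm]
          at this
        rw [this, ← mul_assoc, ← zpow_add₀ hr',
          show (homDim n : ℤ) + d + (-(homDim n : ℤ) - d) = 0 by ring]
        simp
      have hψc : HasCompactSupport ψ :=
        hc.comp_homeomorph (dil n r⁻¹ hri.ne').toHomeomorph
      have hψ0 : (0 : Heis n) ∉ tsupport ψ := by
        have : tsupport ψ = (dil n r⁻¹ hri.ne') ⁻¹' tsupport φ :=
          tsupport_comp_eq_preimage φ (dil n r⁻¹ hri.ne').toHomeomorph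
        rw [this]
        simpa using h0
      have h2 := hF.2 ψ hψc hψ0
      have h3 := integral_comp_dil hr (fun q => F q * ψ q)
      rw [← h2, h1] at h3
      have h4 : ∀ q, ψ (dil n r hr.ne' q) = φ q := fun q => by
        rw [hψ, compDil_apply, dil_mul_inv _ _ _ _ (inv_mul_cancel₀ hr.ne')]
      simp only [h4] at h3
      simp_rw [mul_assoc]
      rw [integral_const_mul, h3, zpow_add₀ hr', zpow_natCast, ← mul_assoc, ← mul_assoc,
        zpow_neg]
      field_simp
  have h := key.eqOn hF hp
  simp only at h
  rw [← h, ← mul_assoc, ← zpow_add₀ hr']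
  simp

/-- The part of φ concentrated near the origin is a dilate of a function at unit scale. Homogeneity
of u can therefore evaluate it. -/
theorem mulCutoff_two_pow (φ : 𝓢(Heis n, ℂ)) (j : ℕ) :
    mulCutoff ((2 : ℝ) ^ j) (two_pow_pos j).ne' φ = compDil ((2 : ℝ) ^ j) (two_pow_pos j).ne'
      (mulBump (compDil ((1 / 2 : ℝ) ^ j) (half_pow_pos j).ne' φ)) := by
  ext p
  rw [mulCutoff_apply, compDil_apply, mulBump_apply, compDil_apply,
    dil_mul_inv _ _ _ _ (by rw [mul_comm]; exact two_pow_mul_half_pow j)]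

theorem cutoff_sub_hasCompactSupport (r s : ℝ) (hr : r ≠ 0) (hs : s ≠ 0) :
    HasCompactSupport (fun p : Heis n => cutoff (dil n r hr p) - cutoff (dil n s hs p)) :=
  (cutoff_dil_hasCompactSupport r hr).sub (cutoff_dil_hasCompactSupport s hs)

theorem eventually_cutoff_dil_eq_one (r : ℝ) (hr : r ≠ 0) :
    ∀ᶠ p : Heis n in 𝓝 0, cutoff (dil n r hr p) = 1 := by
  have h : Tendsto (fun p : Heis n => ‖dil n r hr p‖) (𝓝 0) (𝓝 0) := by
    have := ((dil n r hr).continuous.norm).tendsto (0 : Heis n)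
    simpa using this
  filter_upwards [h.eventually_le_const zero_lt_one] with p hp using cutoff_eq_one hp

theorem zero_notMem_tsupport_cutoff_sub (r s : ℝ) (hr : r ≠ 0) (hs : s ≠ 0) :
    (0 : Heis n) ∉ tsupport (fun p : Heis n => cutoff (dil n r hr p) - cutoff (dil n s hs p)) := by
  rw [notMem_tsupport_iff_eventuallyEq]
  filter_upwards [eventually_cutoff_dil_eq_one (n := n) r hr,
    eventually_cutoff_dil_eq_one (n := n) s hs] with p h1 h2
  simp [h1, h2]

/-- A homogeneous regular distribution is computed by its density on annuli and its values near
the origin. -/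
theorem tendsto_truncation (hF : IsDensityAwayZero u F) (hu : IsHomogeneousDist u d)
    (φ : 𝓢(Heis n, ℂ)) :
    Tendsto (fun j : ℕ => (∫ p, F p * ((cutoff (dil n ((1 / 2 : ℝ) ^ j) (half_pow_pos j).ne' p) -
        cutoff (dil n ((2 : ℝ) ^ j) (two_pow_pos j).ne' p)) * φ p)) +
      (((2 : ℝ) ^ j : ℝ) : ℂ) ^ (-(homDim n : ℤ) - d) *
        u (mulBump (compDil ((1 / 2 : ℝ) ^ j) (half_pow_pos j).ne' φ))) atTop (𝓝 (u φ)) := by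
  have h1 : Tendsto (fun j : ℕ => u (mulCutoff ((1 / 2 : ℝ) ^ j) (half_pow_pos j).ne' φ)) atTop
      (𝓝 (u φ)) := (u.continuous.tendsto _).comp (tendsto_mulCutoff φ)
  refine h1.congr fun j => ?_
  -- The first summand is supported away from the origin and sees only the density. The second
  -- shrinks to the origin and is rescaled by homogeneity.
  have h2 : mulCutoff ((1 / 2 : ℝ) ^ j) (half_pow_pos j).ne' φ =
      (mulCutoff ((1 / 2 : ℝ) ^ j) (half_pow_pos j).ne' φ -
        mulCutoff ((2 : ℝ) ^ j) (two_pow_pos j).ne' φ) +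
      mulCutoff ((2 : ℝ) ^ j) (two_pow_pos j).ne' φ := by abel
  have h3 : ∀ p, (mulCutoff ((1 / 2 : ℝ) ^ j) (half_pow_pos j).ne' φ -
        mulCutoff ((2 : ℝ) ^ j) (two_pow_pos j).ne' φ) p =
      (cutoff (dil n ((1 / 2 : ℝ) ^ j) (half_pow_pos j).ne' p) -
        cutoff (dil n ((2 : ℝ) ^ j) (two_pow_pos j).ne' p)) * φ p := fun p => by
    rw [sub_apply, mulCutoff_apply, mulCutoff_apply]; ring
  have h4 := hF.2 (mulCutoff ((1 / 2 : ℝ) ^ j) (half_pow_pos j).ne' φ -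
        mulCutoff ((2 : ℝ) ^ j) (two_pow_pos j).ne' φ) (by
      rw [show ⇑(mulCutoff ((1 / 2 : ℝ) ^ j) (half_pow_pos j).ne' φ -
        mulCutoff ((2 : ℝ) ^ j) (two_pow_pos j).ne' φ) = _ from funext h3]
      exact (cutoff_sub_hasCompactSupport _ _ _ _).mul_right) (by
      rw [show ⇑(mulCutoff ((1 / 2 : ℝ) ^ j) (half_pow_pos j).ne' φ -
        mulCutoff ((2 : ℝ) ^ j) (two_pow_pos j).ne' φ) = _ from funext h3]
      exact fun h => zero_notMem_tsupport_cutoff_sub _ _ _ _ (tsupport_mul_subset_left' h))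
  simp_rw [h3] at h4
  rw [h2, map_add, h4, mulCutoff_two_pow]
  congr 1
  exact hu _ (two_pow_pos j) _

end Density

/-! ### Smoothness of locally convergent series. -/

section LocalSeries

universe v

/-- Induction on the order of differentiability, applied to the series of derivatives. The target
space varies in the induction because the derivatives take values in E →L[ℝ] F. Both spaces share
one universe so that this space is again admissible. -/
theorem contDiffOn_nat_tsum_of_isPreconnected {E : Type v} [NormedAddCommGroup E] [NormedSpace ℝ E]
    {V : Set E} (hV : IsOpen V) (hVc : IsPreconnected V) (N : ℕ) :
    ∀ {F : Type v} [NormedAddCommGroup F] [NormedSpace ℝ F] [CompleteSpace F] {f : ℕ → E → F},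
    (∀ i, ContDiff ℝ ∞ (f i)) →
    (∀ m : ℕ, ∃ w : ℕ → ℝ, Summable w ∧ ∀ i, ∀ x ∈ V, ‖iteratedFDeriv ℝ m (f i) x‖ ≤ w i) →
    ContDiffOn ℝ N (fun x => ∑' i, f i x) V := by
  induction N with
  | zero =>
    intro F _ _ _ f hf hb
    obtain ⟨w, hw, hb⟩ := hb 0
    rw [Nat.cast_zero, contDiffOn_zero]
    exact continuousOn_tsum (fun i => (hf i).continuous.continuousOn) hw
      fun i x hx => by simpa using hb i x hx
  | succ N ih =>
    intro F _ _ _ f hf hb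
    obtain ⟨w0, hw0, hb0⟩ := hb 0
    obtain ⟨w1, hw1, hb1⟩ := hb 1
    have hd : ∀ x ∈ V, HasFDerivAt (fun y => ∑' i, f i y) (∑' i, fderiv ℝ (f i) x) x := by
      intro x hx
      refine hasFDerivAt_tsum_of_isPreconnected hw1 hV hVc
        (fun i y _ => ((hf i).differentiable (by simp)).differentiableAt.hasFDerivAt)
        (fun i y hy => ?_) hx (Summable.of_norm_bounded hw0 fun i => ?_) hx
      · have := hb1 i y hy
        rwa [norm_iteratedFDeriv_one] at this
      · simpa using hb0 i x hx
    rw [Nat.cast_add, Nat.cast_one, contDiffOn_succ_iff_fderiv_of_isOpen hV]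
    refine ⟨fun x hx => (hd x hx).differentiableAt.differentiableWithinAt,
      fun h => absurd h (by simp), ?_⟩
    refine (ih (f := fun i => fderiv ℝ (f i)) (fun i => (hf i).fderiv_right (by simp))
      fun m => ?_).congr fun x hx => (hd x hx).fderiv
    obtain ⟨w, hw, hb⟩ := hb (m + 1)
    refine ⟨w, hw, fun i x hx => ?_⟩
    rw [norm_iteratedFDeriv_fderiv]
    exact hb i x hx

theorem contDiffOn_tsum_of_isPreconnected {E F : Type v} [NormedAddCommGroup E] [NormedSpace ℝ E]
    [NormedAddCommGroup F] [NormedSpace ℝ F] [CompleteSpace F] {V : Set E} (hV : IsOpen V)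
    (hVc : IsPreconnected V) {f : ℕ → E → F} (hf : ∀ i, ContDiff ℝ ∞ (f i))
    (hb : ∀ m : ℕ, ∃ w : ℕ → ℝ, Summable w ∧
      ∀ i, ∀ x ∈ V, ‖iteratedFDeriv ℝ m (f i) x‖ ≤ w i) :
    ContDiffOn ℝ ∞ (fun x => ∑' i, f i x) V :=
  contDiffOn_infty.2 fun N => contDiffOn_nat_tsum_of_isPreconnected hV hVc N hf hb

theorem contDiffAt_tsum_of_ball {E F : Type v} [NormedAddCommGroup E] [NormedSpace ℝ E]
    [NormedAddCommGroup F] [NormedSpace ℝ F] [CompleteSpace F] {x₀ : E} {δ : ℝ} (hδ : 0 < δ)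
    {f : ℕ → E → F} (hf : ∀ i, ContDiff ℝ ∞ (f i))
    (hb : ∀ m : ℕ, ∃ w : ℕ → ℝ, Summable w ∧
      ∀ i, ∀ x ∈ Metric.ball x₀ δ, ‖iteratedFDeriv ℝ m (f i) x‖ ≤ w i) :
    ContDiffAt ℝ ∞ (fun x => ∑' i, f i x) x₀ :=
  (contDiffOn_tsum_of_isPreconnected Metric.isOpen_ball (convex_ball x₀ δ).isPreconnected hf
    hb).contDiffAt (Metric.ball_mem_nhds x₀ hδ)

end LocalSeries

/-! ### The Fourier transform and dilations. -/

section Fourier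

variable {n : ℕ}

theorem fourierS_eq (φ : 𝓢(Heis n, ℂ)) (q : Heis n) :
    fourierS n φ q = ∫ p, φ p * Complex.exp (-Complex.I * ((inner ℝ p q : ℝ) : ℂ)) := by
  have h := fourierS_apply φ q.fst q.snd
  rw [show heisPt q.fst q.snd = q from rfl] at h
  rw [h]
  congr 1; ext p
  rw [WithLp.prod_inner_apply]
  congr 5
  simp [mul_comm]

theorem fourierS_zero (φ : 𝓢(Heis n, ℂ)) : fourierS n φ 0 = ∫ p, φ p := by
  simp [fourierS_eq]

theorem fourierS_compDil {r : ℝ} (hr : 0 < r) (φ : 𝓢(Heis n, ℂ)) (q : Heis n) :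
    fourierS n (compDil r hr.ne' φ) q =
      ((r : ℂ) ^ homDim n)⁻¹ * fourierS n φ (dil n r⁻¹ (inv_ne_zero hr.ne') q) := by
  rw [fourierS_eq, fourierS_eq, ← integral_comp_dil hr]
  congr 1; ext p
  rw [compDil_apply, inner_dil, dil_mul_inv _ _ _ _ (mul_inv_cancel₀ hr.ne')]

/-- Symmetry of the Fourier kernel, with the dilation and the factor 1/(2π) built into the bilinear
form L. The flipped form is the same one because δ_r is symmetric for the inner product. -/
theorem integral_mul_fourierS_dil {r : ℝ} (hr : r ≠ 0) (h φ : 𝓢(Heis n, ℂ)) :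
    ∫ p, h p * fourierS n φ (dil n r hr p) = ∫ q, fourierS n h (dil n r hr q) * φ q := by
  set L : Heis n →ₗ[ℝ] Heis n →ₗ[ℝ] ℝ :=
    ((2 * Real.pi)⁻¹ : ℝ) • (innerₗ (Heis n)).compl₂ (dil n r hr).toLinearEquiv.toLinearMap with hL
  have hLa : ∀ p q, L p q = (2 * Real.pi)⁻¹ * inner ℝ p (dil n r hr q) := fun p q => rfl
  have hLc : Continuous fun p : Heis n × Heis n => L p.1 p.2 := by
    simp only [hLa]
    exact continuous_const.mul
      (continuous_fst.inner ((dil n r hr).continuous.comp continuous_snd))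
  have hpi : (Real.pi : ℂ) ≠ 0 := by exact_mod_cast Real.pi_ne_zero
  have hchar : ∀ t : ℝ, (Real.fourierChar (-((2 * Real.pi)⁻¹ * t)) : ℂ) =
      Complex.exp (-Complex.I * (t : ℂ)) := fun t => by
    rw [Real.fourierChar_apply]
    congr 1
    push_cast
    field_simp
  have key := VectorFourier.integral_fourierIntegral_smul_eq_flip (μ := volume) (ν := volume)
    (L := L) (f := h) (g := φ) Real.continuous_fourierChar hLc h.integrable φ.integrable
  have e1 : ∀ q, VectorFourier.fourierIntegral Real.fourierChar volume L h q =
      fourierS n h (dil n r hr q) := fun q => by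
    rw [fourierS_eq, VectorFourier.fourierIntegral]
    congr 1; ext p
    rw [hLa, Circle.smul_def, hchar, smul_eq_mul, mul_comm]
  have e2 : ∀ q, VectorFourier.fourierIntegral Real.fourierChar volume L.flip φ q =
      fourierS n φ (dil n r hr q) := fun q => by
    rw [fourierS_eq, VectorFourier.fourierIntegral]
    congr 1; ext p
    rw [LinearMap.flip_apply, hLa, Circle.smul_def, hchar, smul_eq_mul, mul_comm,
      real_inner_comm, inner_dil]
  simp only [e1, e2, smul_eq_mul] at key
  exact key.symm

/-- The Jacobian r^{-Q} of the dilation turns degree -Q into degree 0. -/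
theorem isHomogeneousDist_fourierD {k : 𝓢'(Heis n, ℂ)}
    (hk : IsHomogeneousDist k (-(homDim n : ℤ))) : IsHomogeneousDist (fourierD k) 0 := by
  intro r hr φ
  rw [fourierD_apply, fourierD_apply]
  have h : fourierS n (compDil r hr.ne' φ) =
      ((r : ℂ) ^ homDim n)⁻¹ • compDil r⁻¹ (inv_ne_zero hr.ne') (fourierS n φ) := by
    ext q
    rw [fourierS_compDil hr, smul_apply, compDil_apply, smul_eq_mul]
  have h2 := hk r⁻¹ (inv_pos.2 hr) (fourierS n φ)
  rw [sub_self, zpow_zero, one_mul] at h2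
  rw [show SchwartzMap.compCLMOfContinuousLinearEquiv ℂ (dil n r hr.ne') φ =
    compDil r hr.ne' φ from rfl, h, map_smul, smul_eq_mul]
  rw [show k (compDil r⁻¹ (inv_ne_zero hr.ne') (fourierS n φ)) = k (fourierS n φ) from h2]
  simp

end Fourier

/-! ### Smoothness of k̂ off the origin by dyadic decomposition. -/

section Regularity

variable {n : ℕ}

theorem contDiff_mul_of_zero_notMem_tsupport {f ψ : Heis n → ℂ} (hf : ContDiffOn ℝ ∞ f {0}ᶜ)
    (hψ : ContDiff ℝ ∞ ψ) (h0 : (0 : Heis n) ∉ tsupport ψ) :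
    ContDiff ℝ ∞ (fun p => f p * ψ p) := by
  refine contDiff_iff_contDiffAt.2 fun x => ?_
  by_cases hx : x ∈ tsupport (fun p => f p * ψ p)
  swap
  · exact (contDiffAt_const (c := (0 : ℂ))).congr_of_eventuallyEq
      (notMem_tsupport_iff_eventuallyEq.1 hx)
  have hx0 : x ∈ ({0}ᶜ : Set (Heis n)) := fun h => by
    rw [Set.mem_singleton_iff] at h
    exact h0 (h ▸ tsupport_subset_of_imp (fun y hy => by simp only [hy, mul_zero]) hx)
  exact ((hf x hx0).contDiffAt (isOpen_compl_singleton.mem_nhds hx0)).mul hψ.contDiffAt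

/-- The difference of two dyadic cutoff functions. -/
noncomputable def annulus (p : Heis n) : ℂ :=
  cutoff (dil n (1 / 2) (by norm_num) p) - cutoff (dil n 1 one_ne_zero p)

theorem annulus_contDiff : ContDiff ℝ ∞ (annulus (n := n)) :=
  (cutoff_dil_contDiff _ _).sub (cutoff_dil_contDiff _ _)

theorem annulus_hasCompactSupport : HasCompactSupport (annulus (n := n)) :=
  cutoff_sub_hasCompactSupport _ _ _ _

theorem zero_notMem_tsupport_annulus : (0 : Heis n) ∉ tsupport (annulus (n := n)) :=
  zero_notMem_tsupport_cutoff_sub _ _ _ _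

theorem annulus_dil_contDiff (r : ℝ) (hr : r ≠ 0) :
    ContDiff ℝ ∞ (fun p : Heis n => annulus (dil n r hr p)) :=
  annulus_contDiff.comp (dil n r hr).contDiff

theorem annulus_dil_hasCompactSupport (r : ℝ) (hr : r ≠ 0) :
    HasCompactSupport (fun p : Heis n => annulus (dil n r hr p)) :=
  annulus_hasCompactSupport.comp_homeomorph (dil n r hr).toHomeomorph

theorem zero_notMem_tsupport_annulus_dil (r : ℝ) (hr : r ≠ 0) :
    (0 : Heis n) ∉ tsupport (fun p : Heis n => annulus (dil n r hr p)) := by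
  have : tsupport (fun p : Heis n => annulus (dil n r hr p)) = (dil n r hr) ⁻¹' tsupport annulus :=
    tsupport_comp_eq_preimage annulus (dil n r hr).toHomeomorph
  rw [this]
  simpa using zero_notMem_tsupport_annulus

theorem annulus_dil (r : ℝ) (hr : r ≠ 0) (p : Heis n) :
    annulus (dil n r hr p) = cutoff (dil n (1 / 2 * r) (by positivity) p) -
      cutoff (dil n r hr p) := by
  rw [annulus, dil_dil, dil_one]

/-- A telescoping sum. Its j-th step adds one annulus at the outer end and one at the inner end, so
that every dyadic scale occurs exactly once in the limit. -/
theorem cutoff_sub_eq_sum_annulus (j : ℕ) (p : Heis n) :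
    cutoff (dil n ((1 / 2 : ℝ) ^ j) (half_pow_pos j).ne' p) -
      cutoff (dil n ((2 : ℝ) ^ j) (two_pow_pos j).ne' p) =
    ∑ i ∈ Finset.range j, (annulus (dil n ((1 / 2 : ℝ) ^ i) (half_pow_pos i).ne' p) +
      annulus (dil n ((2 : ℝ) ^ (i + 1)) (two_pow_pos (i + 1)).ne' p)) := by
  induction j with
  | zero => simp
  | succ j ih =>
    rw [Finset.sum_range_succ, ← ih, annulus_dil, annulus_dil]
    have e1 : dil n (1 / 2 * (1 / 2 : ℝ) ^ j) (by positivity) p =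
        dil n ((1 / 2 : ℝ) ^ (j + 1)) (half_pow_pos _).ne' p := by
      congr 2; ring
    have e2 : dil n (1 / 2 * (2 : ℝ) ^ (j + 1)) (by positivity) p =
        dil n ((2 : ℝ) ^ j) (two_pow_pos _).ne' p := by
      congr 2; ring
    rw [e1, e2]
    ring

/-- The dyadic piece of a function on the complement of the origin. -/
noncomputable def dyadicPiece {f : Heis n → ℂ} (hf : ContDiffOn ℝ ∞ f {0}ᶜ) : 𝓢(Heis n, ℂ) :=
  HasCompactSupport.toSchwartzMap (f := fun p => f p * annulus p)
    annulus_hasCompactSupport.mul_left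
    (contDiff_mul_of_zero_notMem_tsupport hf annulus_contDiff zero_notMem_tsupport_annulus)

theorem dyadicPiece_apply {f : Heis n → ℂ} (hf : ContDiffOn ℝ ∞ f {0}ᶜ) (p : Heis n) :
    dyadicPiece hf p = f p * annulus p := rfl

variable {k : 𝓢'(Heis n, ℂ)} {f : Heis n → ℂ}

/-- The integral is k applied to the difference of a cutoff and its dilate, which vanishes since k
is invariant under dilation of test functions. This cancellation is what makes the series for k̂
converge at small dilations. -/
theorem integral_dyadicPiece (hf : IsDensityAwayZero k f)
    (hk : IsHomogeneousDist k (-(homDim n : ℤ))) : ∫ p, dyadicPiece hf.1 p = 0 := by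
  have h1 := hf.2 (annulus_hasCompactSupport.toSchwartzMap annulus_contDiff)
    annulus_hasCompactSupport zero_notMem_tsupport_annulus
  have h2 : annulus_hasCompactSupport.toSchwartzMap annulus_contDiff =
      compDil (1 / 2) (by norm_num) (cutoffS n) - cutoffS n := by
    ext p
    rw [sub_apply, compDil_apply, cutoffS_apply, cutoffS_apply]
    show annulus p = _
    rw [annulus, dil_one]
  have h3 := hk (1 / 2) (by norm_num) (cutoffS n)
  rw [sub_self, zpow_zero, one_mul] at h3
  rw [h2, map_sub, show k (compDil (1 / 2) (by norm_num) (cutoffS n)) = k (cutoffS n) from h3,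
    sub_self, ← h2] at h1
  exact h1.symm

/-- The density has degree -Q, which exactly cancels the Jacobian. All dyadic pieces are thus
dilates of a single one. -/
theorem integral_mul_annulus_dil (hf : IsDensityAwayZero k f)
    (hk : IsHomogeneousDist k (-(homDim n : ℤ))) {r s : ℝ} (hr : 0 < r) (hs : 0 < s)
    (hrs : r * s = 1) (Φ : 𝓢(Heis n, ℂ)) :
    ∫ p, f p * (annulus (dil n r hr.ne' p) * Φ p) =
      ∫ p, dyadicPiece hf.1 p * Φ (dil n s hs.ne' p) := by
  have hs' : (s : ℂ) ≠ 0 := by exact_mod_cast hs.ne'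
  have h := integral_comp_dil hs (fun p => f p * (annulus (dil n r hr.ne' p) * Φ p))
  rw [← mul_right_inj' (inv_ne_zero (pow_ne_zero (homDim n) hs')), ← h, ← integral_const_mul]
  congr 1; ext p
  rw [dil_mul_inv _ _ _ _ hrs, dyadicPiece_apply]
  by_cases hp : p = 0
  -- Homogeneity gives no information on f at the origin, but the annulus function vanishes there.
  · have : annulus (0 : Heis n) = 0 := image_eq_zero_of_notMem_tsupport zero_notMem_tsupport_annulus
    simp [hp, this]
  · rw [hf.homogeneous hk hs hp, zpow_neg, zpow_natCast]
    ring

/-- The dyadic pieces of the Fourier transform of a symbol. -/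
noncomputable def fourierPiece (H : 𝓢(Heis n, ℂ)) (i : ℕ) (q : Heis n) : ℂ :=
  H (dil n ((2 : ℝ) ^ i) (two_pow_pos i).ne' q) +
    H (dil n ((1 / 2 : ℝ) ^ (i + 1)) (half_pow_pos (i + 1)).ne' q)

theorem fourierPiece_contDiff (H : 𝓢(Heis n, ℂ)) (i : ℕ) : ContDiff ℝ ∞ (fourierPiece H i) :=
  ((H.smooth ⊤).comp (dil n _ _).contDiff).add ((H.smooth ⊤).comp (dil n _ _).contDiff)

theorem integral_truncation (hf : IsDensityAwayZero k f)
    (hk : IsHomogeneousDist k (-(homDim n : ℤ))) (φ : 𝓢(Heis n, ℂ)) (j : ℕ) :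
    ∫ p, f p * ((cutoff (dil n ((1 / 2 : ℝ) ^ j) (half_pow_pos j).ne' p) -
        cutoff (dil n ((2 : ℝ) ^ j) (two_pow_pos j).ne' p)) * fourierS n φ p) =
      ∑ i ∈ Finset.range j, ∫ q, fourierPiece (fourierS n (dyadicPiece hf.1)) i q * φ q := by
  have hi : ∀ r (hr : r ≠ 0),
      Integrable (fun p => f p * (annulus (dil n r hr p) * fourierS n φ p)) := fun r hr => by
    simp_rw [← mul_assoc]
    refine Continuous.integrable_of_hasCompactSupport
      ((contDiff_mul_of_zero_notMem_tsupport hf.1 (annulus_dil_contDiff r hr)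
        (zero_notMem_tsupport_annulus_dil r hr)).continuous.mul (fourierS n φ).continuous) ?_
    exact ((annulus_dil_hasCompactSupport r hr).mul_left).mul_right
  simp_rw [cutoff_sub_eq_sum_annulus, Finset.sum_mul, Finset.mul_sum]
  rw [integral_finsetSum _ fun i _ => by
    simp_rw [add_mul, mul_add]; exact (hi _ _).add (hi _ _)]
  refine Finset.sum_congr rfl fun i _ => ?_
  simp_rw [fourierPiece, add_mul, mul_add]
  have hI : ∀ r (hr : 0 < r), Integrable
      (fun q => fourierS n (dyadicPiece hf.1) (dil n r hr.ne' q) * φ q) := fun r hr =>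
    φ.integrable.bdd_mul
      (((fourierS n (dyadicPiece hf.1)).continuous.comp (dil n r hr.ne').continuous).aestronglyMeasurable)
      (Eventually.of_forall fun q => SchwartzMap.norm_le_seminorm ℂ _ _)
  rw [integral_add (hi _ _) (hi _ _), integral_add (hI _ (two_pow_pos i)) (hI _ (half_pow_pos (i + 1)))]
  congr 1
  · rw [integral_mul_annulus_dil hf hk (half_pow_pos i) (two_pow_pos i)
      (by rw [mul_comm]; exact two_pow_mul_half_pow i), integral_mul_fourierS_dil]
  · rw [integral_mul_annulus_dil hf hk (two_pow_pos (i + 1)) (half_pow_pos (i + 1))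
      (two_pow_mul_half_pow (i + 1)), integral_mul_fourierS_dil]

/-- On a shell away from 0 the expanding dilates are controlled by the Schwartz decay of H. The
contracting ones are controlled by H(0) = 0 for m = 0 and by the factor ‖δ_r‖^m for m ≥ 1. -/
theorem exists_bound_fourierPiece {H : 𝓢(Heis n, ℂ)} (hH : H 0 = 0) {a b : ℝ} (ha : 0 < a)
    (m : ℕ) : ∃ C : ℝ, ∀ i q, a ≤ ‖q‖ → ‖q‖ ≤ b →
      ‖iteratedFDeriv ℝ m (fourierPiece H i) q‖ ≤ C * (1 / 2) ^ i := by
  -- The m-th derivative of an expanding dilate costs ‖δ_r‖^m ≤ r^{2m}. Decay of order 2m + 1 pays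
  -- for this and leaves r^{-1} = 2^{-i}.
  refine ⟨SchwartzMap.seminorm ℂ (2 * m + 1) m H / a ^ (2 * m + 1) +
    (SchwartzMap.seminorm ℂ 0 1 H * b + SchwartzMap.seminorm ℂ 0 m H), fun i q haq hqb => ?_⟩
  have hq0 : 0 < ‖q‖ := ha.trans_le haq
  have hL : ∀ L : Heis n →L[ℝ] Heis n, ContDiff ℝ m (fun y => H (L y)) := fun L =>
    (H.smooth m).comp L.contDiff
  rw [show fourierPiece H i = (fun y => H ((dil n ((2 : ℝ) ^ i) (two_pow_pos i).ne' :
      Heis n →L[ℝ] Heis n) y)) + fun y => H ((dil n ((1 / 2 : ℝ) ^ (i + 1))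
      (half_pow_pos (i + 1)).ne' : Heis n →L[ℝ] Heis n) y) from rfl,
    iteratedFDeriv_add_apply (hL _).contDiffAt (hL _).contDiffAt, add_mul]
  refine (norm_add_le _ _).trans (add_le_add ?_ ?_)
  · refine (norm_iteratedFDeriv_comp_clm_le (H.smooth ⊤) _ m q).trans ?_
    set r := (2 : ℝ) ^ i with hr
    have hr0 : 0 < r := two_pow_pos i
    have hr1 : 1 ≤ r := one_le_pow₀ (by norm_num)
    set y := (dil n r (two_pow_pos i).ne' : Heis n →L[ℝ] Heis n) q
    have h1 : r * a ≤ ‖y‖ := (by gcongr : r * a ≤ r * ‖q‖).trans (le_norm_dil hr0 hr1 q)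
    have h2 := SchwartzMap.le_seminorm ℂ (2 * m + 1) m H y
    have h3 : ‖(dil n r (two_pow_pos i).ne' : Heis n →L[ℝ] Heis n)‖ ^ m ≤ (r ^ 2) ^ m := by
      gcongr; exact opNorm_dil_le_of_one_le hr0 hr1
    have h4 : (r * a) ^ (2 * m + 1) * ‖iteratedFDeriv ℝ m H y‖ ≤
        SchwartzMap.seminorm ℂ (2 * m + 1) m H := le_trans (by gcongr) h2
    have h5 : ((1 : ℝ) / 2) ^ i = r⁻¹ := by rw [hr, one_div, inv_pow]
    rw [h5]
    calc _ ≤ ‖iteratedFDeriv ℝ m H y‖ * (r ^ 2) ^ m := by gcongr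
      _ = ((r * a) ^ (2 * m + 1) * ‖iteratedFDeriv ℝ m H y‖) / a ^ (2 * m + 1) * r⁻¹ := by
        field_simp
        ring
      _ ≤ _ := by gcongr
  · have hr := half_pow_pos (i + 1)
    have hr1 := half_pow_le_one (i + 1)
    have hri : (1 / 2 : ℝ) ^ (i + 1) ≤ (1 / 2) ^ i :=
      pow_le_pow_of_le_one (by norm_num) (by norm_num) (Nat.le_succ i)
    set r := (1 / 2 : ℝ) ^ (i + 1) with hrdef
    have hb : 0 ≤ b := hq0.le.trans hqb
    rcases Nat.eq_zero_or_pos m with rfl | hm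
    · rw [norm_iteratedFDeriv_zero]
      have h1 := norm_comp_dil_sub_le H hr hr1 q
      rw [hH, sub_zero] at h1
      refine h1.trans ?_
      calc _ ≤ SchwartzMap.seminorm ℂ 0 1 H * ((1 / 2) ^ i * b) := by gcongr
        _ = SchwartzMap.seminorm ℂ 0 1 H * b * (1 / 2) ^ i := by ring
        _ ≤ _ := by gcongr; exact le_add_of_nonneg_right (apply_nonneg _ _)
    · refine (norm_iteratedFDeriv_comp_clm_le (H.smooth ⊤) _ m q).trans ?_
      have h3 : ‖(dil n r hr.ne' : Heis n →L[ℝ] Heis n)‖ ^ m ≤ r :=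
        (pow_le_pow_left₀ (norm_nonneg _) (opNorm_dil_le_of_le_one hr hr1) m).trans
          (pow_le_of_le_one hr.le hr1 hm.ne')
      have h2 := SchwartzMap.norm_iteratedFDeriv_le_seminorm ℂ H m
          ((dil n r hr.ne' : Heis n →L[ℝ] Heis n) q)
      calc _ ≤ SchwartzMap.seminorm ℂ 0 m H * (1 / 2) ^ i := by gcongr; exact h3.trans hri
        _ ≤ _ := by gcongr; exact le_add_of_nonneg_left (by positivity)

theorem summable_const_mul_half_pow (C : ℝ) : Summable (fun i : ℕ => C * (1 / 2 : ℝ) ^ i) :=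
  (summable_geometric_of_lt_one (by norm_num) (by norm_num)).mul_left C

theorem contDiffOn_tsum_fourierPiece {H : 𝓢(Heis n, ℂ)} (hH : H 0 = 0) :
    ContDiffOn ℝ ∞ (fun q => ∑' i, fourierPiece H i q) {0}ᶜ := by
  intro q hq
  have hq0 : 0 < ‖q‖ := norm_pos_iff.2 hq
  refine ContDiffAt.contDiffWithinAt ?_
  refine contDiffAt_tsum_of_ball (δ := ‖q‖ / 2) (half_pos hq0) (fourierPiece_contDiff H)
    fun m => ?_
  obtain ⟨C, hC⟩ := exists_bound_fourierPiece hH (a := ‖q‖ / 2) (b := 2 * ‖q‖) (half_pos hq0) m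
  refine ⟨_, summable_const_mul_half_pow C, fun i x hx => ?_⟩
  rw [Metric.mem_ball, dist_eq_norm] at hx
  have h1 := norm_sub_norm_le q x
  have h2 := norm_sub_norm_le x q
  rw [norm_sub_rev] at h1
  exact hC i x (by linarith) (by linarith)

/-- The support of φ lies in a shell a ≤ ‖q‖ ≤ b, where the pieces decay geometrically. Summation
and integration therefore commute. -/
theorem hasSum_integral_fourierPiece {H : 𝓢(Heis n, ℂ)} (hH : H 0 = 0) {φ : 𝓢(Heis n, ℂ)}
    (hc : HasCompactSupport φ) (h0 : (0 : Heis n) ∉ tsupport φ) :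
    HasSum (fun i => ∫ q, fourierPiece H i q * φ q)
      (∫ q, (∑' i, fourierPiece H i q) * φ q) := by
  obtain ⟨b, hb⟩ := hc.isCompact.isBounded.exists_norm_le
  obtain ⟨a, ha, hab⟩ := Metric.mem_nhds_iff.1 ((isClosed_tsupport φ).isOpen_compl.mem_nhds h0)
  have ha' : ∀ q ∈ tsupport φ, a ≤ ‖q‖ := fun q hq => by
    by_contra! h
    exact hab (by simpa using h) hq
  obtain ⟨C, hC⟩ := exists_bound_fourierPiece hH (b := b) ha 0
  have hbd : ∀ i q, ‖fourierPiece H i q * φ q‖ ≤ C * (1 / 2) ^ i * ‖φ q‖ := fun i q => by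
    by_cases hq : q ∈ tsupport φ
    · rw [norm_mul]
      gcongr
      have := hC i q (ha' q hq) (hb q hq)
      rwa [norm_iteratedFDeriv_zero] at this
    · simp [image_eq_zero_of_notMem_tsupport hq]
  have hint : ∀ i, Integrable (fun q => fourierPiece H i q * φ q) := fun i =>
    ((fourierPiece_contDiff H i).continuous.mul φ.continuous).integrable_of_hasCompactSupport
      hc.mul_left
  have h := hasSum_integral_of_summable_integral_norm hint
    (Summable.of_nonneg_of_le (fun i => integral_nonneg fun _ => norm_nonneg _) (fun i => by
      calc _ ≤ ∫ q, C * (1 / 2) ^ i * ‖φ q‖ :=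
            integral_mono (hint i).norm (φ.integrable.norm.const_mul _) (hbd i)
        _ = (C * ∫ q, ‖φ q‖) * (1 / 2) ^ i := by rw [integral_const_mul]; ring)
      (summable_const_mul_half_pow _))
  simpa only [tsum_mul_right] using h

/-- In degree -Q the factor in front of the term at the origin in `tendsto_truncation` is 1. Applied
to the transform of φ, that term converges to k(cutoff) ∫ φ, since the transform takes the value ∫ φ
at 0. Hence k̂ is the constant k(cutoff) plus the dyadic series. -/
theorem isRegularDist_fourierD (hk : IsSymbol k) : IsRegularDist (fourierD k) := by
  have hf := isDensityAwayZero_density hk.regular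
  set H := fourierS n (dyadicPiece hf.1) with hHdef
  have hH : H 0 = 0 := by rw [hHdef, fourierS_zero, integral_dyadicPiece hf hk.homogeneous]
  have hsm := contDiffOn_tsum_fourierPiece hH
  refine ⟨fun q => k (cutoffS n) + ∑' i, fourierPiece H i q, contDiffOn_const.add hsm, ?_⟩
  intro φ hc h0
  rw [fourierD_apply]
  refine tendsto_nhds_unique (tendsto_truncation hf hk.homogeneous (fourierS n φ)) ?_
  simp_rw [integral_truncation hf hk.homogeneous, sub_self, zpow_zero, one_mul]
  have h1 : Tendsto (fun j : ℕ => k (mulBump (compDil ((1 / 2 : ℝ) ^ j) (half_pow_pos j).ne'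
      (fourierS n φ)))) atTop (𝓝 (k (fourierS n φ 0 • cutoffS n))) :=
    (k.continuous.tendsto _).comp (tendsto_mulBump_compDil _)
  have h2 := (hasSum_integral_fourierPiece hH hc h0).tendsto_sum_nat.add h1
  convert h2 using 2
  rw [map_smul, smul_eq_mul, fourierS_zero, add_comm]
  simp_rw [add_mul]
  rw [integral_add (φ.integrable.const_mul _), integral_const_mul, mul_comm, add_comm]
  · refine Continuous.integrable_of_hasCompactSupport
      (contDiff_mul_of_zero_notMem_tsupport hsm (φ.smooth ⊤) h0).continuous hc.mul_left

end Regularity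

/-! ### Distributions of degree zero as bounded functions. -/

section Bounded

variable {n : ℕ} {u : 𝓢'(Heis n, ℂ)} {g : Heis n → ℂ}

/-- The norm along a dilation orbit is continuous in r and passes from at most 1 to at least 1, so
the intermediate value theorem applies. -/
theorem exists_norm_dil_eq_one {q : Heis n} (hq : q ≠ 0) :
    ∃ (r : ℝ) (hr : 0 < r), ‖dil n r hr.ne' q‖ = 1 := by
  have hq0 : 0 < ‖q‖ := norm_pos_iff.2 hq
  set F : ℝ → ℝ := fun r => r ^ 2 * ‖q.fst‖ ^ 2 + (r ^ 2 * q.snd) ^ 2 with hF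
  have hFn : ∀ r (hr : 0 < r), F r = ‖dil n r hr.ne' q‖ ^ 2 := fun r hr => by
    rw [heis_norm_sq, dil_fst, dil_snd, norm_smul, mul_pow, Real.norm_eq_abs, sq_abs]
  set a := min 1 ‖q‖⁻¹
  set b := max 1 ‖q‖⁻¹
  have ha : 0 < a := lt_min one_pos (inv_pos.2 hq0)
  have hab : a ≤ b := (min_le_left _ _).trans (le_max_left _ _)
  have hb : 0 < b := ha.trans_le hab
  have h1 : F a ≤ 1 := by
    rw [hFn a ha]
    refine pow_le_one₀ (norm_nonneg _) ((norm_dil_le_of_le_one ha (min_le_left _ _) q).trans ?_)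
    calc a * ‖q‖ ≤ ‖q‖⁻¹ * ‖q‖ := by gcongr; exact min_le_right _ _
      _ = 1 := inv_mul_cancel₀ hq0.ne'
  have h2 : 1 ≤ F b := by
    rw [hFn b hb]
    refine one_le_pow₀ (le_trans ?_ (le_norm_dil hb (le_max_left _ _) q))
    calc 1 = ‖q‖⁻¹ * ‖q‖ := (inv_mul_cancel₀ hq0.ne').symm
      _ ≤ b * ‖q‖ := by gcongr; exact le_max_right _ _
  obtain ⟨r, hr, hr1⟩ := intermediate_value_Icc hab (f := F) (by fun_prop) ⟨h1, h2⟩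
  have hr0 : 0 < r := ha.trans_le hr.1
  refine ⟨r, hr0, ?_⟩
  rw [hFn r hr0] at hr1
  exact (pow_eq_one_iff_of_nonneg (norm_nonneg _) two_ne_zero).1 hr1

/-- Every dilation orbit meets the compact unit sphere, and a function of degree zero is constant on
orbits. -/
theorem IsDensityAwayZero.exists_bound (hg : IsDensityAwayZero u g)
    (hu : IsHomogeneousDist u 0) : ∃ M : ℝ, 0 ≤ M ∧ ∀ q, q ≠ 0 → ‖g q‖ ≤ M := by
  obtain ⟨M, hM⟩ := (isCompact_sphere (0 : Heis n) 1).exists_bound_of_continuousOn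
    (f := g) (hg.continuousOn.mono fun q hq h => by
      rw [Set.mem_singleton_iff] at h
      simp [h] at hq)
  refine ⟨max M 0, le_max_right _ _, fun q hq => ?_⟩
  obtain ⟨r, hr, h1⟩ := exists_norm_dil_eq_one hq
  have h2 := hg.homogeneous hu hr hq
  rw [zpow_zero, one_mul] at h2
  rw [← h2]
  exact (hM _ (by simpa using h1)).trans (le_max_left _ _)

instance : Nontrivial (Heis n) :=
  ⟨⟨heisPt 0 1, 0, fun h => by simpa [heisPt] using congrArg (fun p : Heis n => p.snd) h⟩⟩

theorem ae_ne_zero_of_nontrivial {E : Type*} [NormedAddCommGroup E] [InnerProductSpace ℝ E]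
    [FiniteDimensional ℝ E] [MeasurableSpace E] [BorelSpace E] [Nontrivial E] :
    ∀ᵐ p : E, p ≠ 0 :=
  compl_mem_ae_iff.2 (measure_singleton 0)

theorem ae_ne_zero_heis : ∀ᵐ p : Heis n, p ≠ 0 := ae_ne_zero_of_nontrivial

theorem IsDensityAwayZero.aestronglyMeasurable (hg : IsDensityAwayZero u g) :
    AEStronglyMeasurable g (volume : Measure (Heis n)) := by
  have h := hg.continuousOn.aestronglyMeasurable (μ := (volume : Measure (Heis n)))
    (measurableSet_singleton (0 : Heis n)).compl
  rwa [Measure.restrict_eq_self_of_ae_mem (s := ({0}ᶜ : Set (Heis n))) ae_ne_zero_heis] at h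

theorem tendsto_cutoff_sub {p : Heis n} (hp : p ≠ 0) :
    Tendsto (fun j : ℕ => cutoff (dil n ((1 / 2 : ℝ) ^ j) (half_pow_pos j).ne' p) -
      cutoff (dil n ((2 : ℝ) ^ j) (two_pow_pos j).ne' p)) atTop (𝓝 1) := by
  have h1 : Tendsto (fun j : ℕ => (1 / 2 : ℝ) ^ j * ‖p‖) atTop (𝓝 0) := by
    simpa using tendsto_half_pow.mul_const ‖p‖
  have h2 : Tendsto (fun j : ℕ => (2 : ℝ) ^ j * ‖p‖) atTop atTop :=
    (tendsto_pow_atTop_atTop_of_one_lt one_lt_two).atTop_mul_const (norm_pos_iff.2 hp)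
  refine tendsto_const_nhds.congr' ?_
  filter_upwards [h1.eventually_le_const zero_lt_one, h2.eventually_ge_atTop 2] with j hj1 hj2
  rw [cutoff_eq_one ((norm_dil_le_of_le_one (half_pow_pos j) (half_pow_le_one j) p).trans hj1),
    cutoff_eq_zero (hj2.trans (le_norm_dil (two_pow_pos j) (one_le_pow₀ one_le_two) p)), sub_zero]

/-- A homogeneous regular distribution of degree zero is given by its density. -/
theorem IsDensityAwayZero.eq_integral (hg : IsDensityAwayZero u g)
    (hu : IsHomogeneousDist u 0) (φ : 𝓢(Heis n, ℂ)) : u φ = ∫ p, g p * φ p := by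
  obtain ⟨M, hM0, hM⟩ := hg.exists_bound hu
  refine tendsto_nhds_unique (tendsto_truncation hg hu φ) ?_
  rw [← add_zero (∫ p, g p * φ p)]
  refine Tendsto.add ?_ ?_
  · refine tendsto_integral_of_dominated_convergence (fun p => M * (2 * ‖φ p‖)) (fun j => ?_)
      ((φ.integrable.norm.const_mul 2).const_mul M) (fun j => ?_) ?_
    · exact hg.aestronglyMeasurable.mul ((((cutoff_dil_contDiff _ _).continuous.sub
        (cutoff_dil_contDiff _ _).continuous).mul φ.continuous).aestronglyMeasurable)
    · filter_upwards [ae_ne_zero_heis] with p hp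
      rw [norm_mul, norm_mul]
      gcongr
      · exact hM p hp
      · refine (norm_sub_le _ _).trans ?_
        linarith [norm_cutoff_le (dil n ((1 / 2 : ℝ) ^ j) (half_pow_pos j).ne' p),
          norm_cutoff_le (dil n ((2 : ℝ) ^ j) (two_pow_pos j).ne' p)]
    · filter_upwards [ae_ne_zero_heis] with p hp
      simpa using ((tendsto_cutoff_sub hp).mul_const (φ p)).const_mul (g p)
  -- In degree zero the term at the origin carries the factor 2^{-jQ} and tends to 0, so no point
  -- mass survives.
  · have h1 : Tendsto (fun j : ℕ => u (mulBump (compDil ((1 / 2 : ℝ) ^ j) (half_pow_pos j).ne' φ)))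
        atTop (𝓝 (u (φ 0 • cutoffS n))) :=
      (u.continuous.tendsto _).comp (tendsto_mulBump_compDil _)
    have h2 : Tendsto (fun j : ℕ => (((2 : ℝ) ^ j : ℝ) : ℂ) ^ (-(homDim n : ℤ) - 0)) atTop
        (𝓝 0) := by
      have h3 : Tendsto (fun j : ℕ => ((1 / 2 : ℂ) ^ homDim n) ^ j) atTop (𝓝 0) := by
        refine tendsto_pow_atTop_nhds_zero_of_norm_lt_one ?_
        rw [norm_pow]
        exact pow_lt_one₀ (norm_nonneg _) (by norm_num) (by simp [homDim])
      refine h3.congr fun j => ?_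
      rw [sub_zero, zpow_neg, zpow_natCast, ← pow_mul, mul_comm, pow_mul]
      push_cast
      rw [one_div, inv_pow, inv_pow]
    simpa using h2.mul h1

end Bounded

/-! ### Taylor's formula with a crude remainder. -/

section Taylor

/-- The derivative of the remainder of order N + 1 is the remainder of order N for the shifted
sequence h (l + 1). The mean value inequality then gives one more power of |t|. The factor 1/N! is
given up. -/
theorem norm_sub_taylor_sum_le (N : ℕ) : ∀ {h : ℕ → ℝ → ℂ} {M : ℝ},
    (∀ l t, |t| ≤ 1 → HasDerivAt (h l) (h (l + 1) t) t) → (∀ t, |t| ≤ 1 → ‖h N t‖ ≤ M) →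
    ∀ t, |t| ≤ 1 →
      ‖h 0 t - ∑ l ∈ Finset.range N, (t : ℂ) ^ l / (l.factorial : ℂ) * h l 0‖ ≤ M * |t| ^ N := by
  induction N with
  | zero => intro h M _ hM t ht; simpa using hM t ht
  | succ N ih =>
    intro h M hd hM t ht
    set R : ℝ → ℂ := fun s =>
      h 0 s - ∑ l ∈ Finset.range (N + 1), (s : ℂ) ^ l / (l.factorial : ℂ) * h l 0 with hR
    have hder : ∀ s, |s| ≤ 1 → HasDerivAt R
        (h 1 s - ∑ l ∈ Finset.range N, (s : ℂ) ^ l / (l.factorial : ℂ) * h (l + 1) 0) s := by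
      intro s hs
      refine (hd 0 s hs).sub ?_
      have h1 : ∀ l ∈ Finset.range (N + 1), HasDerivAt
          (fun s : ℝ => (s : ℂ) ^ l / (l.factorial : ℂ) * h l 0)
          ((l : ℂ) * (s : ℂ) ^ (l - 1) / (l.factorial : ℂ) * h l 0) s := fun l _ => by
        have := ((Complex.ofRealCLM.hasDerivAt (x := s)).pow l).div_const (l.factorial : ℂ)
        simpa using this.mul_const (h l 0)
      refine (HasDerivAt.fun_sum h1).congr_deriv ?_
      rw [Finset.sum_range_succ']
      simp only [Nat.cast_zero, zero_mul, zero_div, add_zero]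
      refine Finset.sum_congr rfl fun l _ => ?_
      rw [Nat.factorial_succ, Nat.add_sub_cancel]
      have : ((l + 1 : ℕ) : ℂ) ≠ 0 := Nat.cast_ne_zero.2 (Nat.succ_ne_zero l)
      have : (l.factorial : ℂ) ≠ 0 := Nat.cast_ne_zero.2 l.factorial_ne_zero
      push_cast
      field_simp
    have hM0 : 0 ≤ M := (norm_nonneg _).trans (hM 0 (by simp))
    have hsub : ∀ s ∈ Set.Icc (-|t|) |t|, |s| ≤ |t| := fun s hs => abs_le.2 hs
    have hmv := (convex_Icc (-|t|) |t|).norm_image_sub_le_of_norm_hasDerivWithin_le (f := R)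
      (C := M * |t| ^ N)
      (fun s hs => (hder s ((hsub s hs).trans ht)).hasDerivWithinAt) (fun s hs => by
        have := ih (h := fun l => h (l + 1)) (fun l => hd (l + 1)) hM s ((hsub s hs).trans ht)
        exact this.trans (mul_le_mul_of_nonneg_left
          (pow_le_pow_left₀ (abs_nonneg s) (hsub s hs) N) hM0)) (x := 0) (y := t) (by simp) ⟨neg_abs_le t, le_abs_self t⟩
    have hR0 : R 0 = 0 := by
      simp only [hR]
      rw [Finset.sum_range_succ', Finset.sum_eq_zero fun l _ => by simp]
      simp
    rw [hR0, sub_zero, sub_zero, Real.norm_eq_abs] at hmv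
    rw [pow_succ, ← mul_assoc]
    exact hmv

end Taylor

/-! ### Asymptotic expansion of k̂ from its Taylor series in the central variable. -/

section Expansion

theorem fderiv_apply_of_comp_eq_const_mul {E : Type*} [NormedAddCommGroup E] [NormedSpace ℝ E]
    {G : E → ℂ} {p : E} {L : E →L[ℝ] E} {c : ℂ} {A B : E →L[ℝ] ℂ} (hA : HasFDerivAt G A (L p))
    (hB : HasFDerivAt G B p) (h : ∀ᶠ q in 𝓝 p, G (L q) = c * G q) (v : E) :
    A (L v) = c * B v := by
  have h3 := (hA.comp p L.hasFDerivAt).unique ((hB.const_mul c).congr_of_eventuallyEq h)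
  exact DFunLike.congr_fun h3 v

theorem hasDerivAt_comp_line {E : Type*} [NormedAddCommGroup E] [NormedSpace ℝ E]
    {G : E → ℂ} (a v : E) (t : ℝ) {A : E →L[ℝ] ℂ} (hA : HasFDerivAt G A (a + t • v)) :
    HasDerivAt (fun s : ℝ => G (a + s • v)) (A v) t := by
  have h : HasDerivAt (fun s : ℝ => a + s • v) v t := by
    simpa using ((hasDerivAt_id t).smul_const v).const_add a
  exact hA.comp_hasDerivAt t h

variable {n : ℕ} {g : Heis n → ℂ}

/-- The derivative in the central direction. -/
noncomputable def centralDeriv (g : Heis n → ℂ) (p : Heis n) : ℂ := fderiv ℝ g p (heisPt 0 1)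

/-- Iterated derivatives in the central direction. -/
noncomputable def iterCentralDeriv (g : Heis n → ℂ) (l : ℕ) : Heis n → ℂ := centralDeriv^[l] g

theorem iterCentralDeriv_succ (l : ℕ) :
    iterCentralDeriv g (l + 1) = centralDeriv (iterCentralDeriv g l) :=
  Function.iterate_succ_apply' _ _ _

theorem iterCentralDeriv_contDiffOn (hg : ContDiffOn ℝ ∞ g {0}ᶜ) (l : ℕ) :
    ContDiffOn ℝ ∞ (iterCentralDeriv g l) {0}ᶜ := by
  induction l with
  | zero => exact hg
  | succ l ih =>
    rw [iterCentralDeriv_succ]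
    exact (ih.fderiv_of_isOpen isOpen_compl_singleton (by simp)).clm_apply contDiffOn_const

theorem differentiableAt_of_contDiffOn_compl {G : Heis n → ℂ} (hG : ContDiffOn ℝ ∞ G {0}ᶜ)
    {p : Heis n} (hp : p ≠ 0) : DifferentiableAt ℝ G p :=
  ((hG p hp).contDiffAt (isOpen_compl_singleton.mem_nhds hp)).differentiableAt (by simp)

theorem dil_heisPt_zero_one {r : ℝ} (hr : r ≠ 0) :
    dil n r hr (heisPt 0 1) = r ^ 2 • heisPt 0 1 := by
  rw [dil_apply]; apply heis_ext <;> simp [heisPt]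

/-- Differentiating the homogeneity relation in the central direction, which δ_r scales by r²,
lowers the degree by 2 each time. -/
theorem iterCentralDeriv_dil (hg : ContDiffOn ℝ ∞ g {0}ᶜ)
    (hh : ∀ (r : ℝ) (hr : 0 < r) (p : Heis n), p ≠ 0 → g (dil n r hr.ne' p) = g p) (l : ℕ) :
    ∀ (r : ℝ) (hr : 0 < r) (p : Heis n), p ≠ 0 →
      iterCentralDeriv g l (dil n r hr.ne' p) = (r : ℂ) ^ (-(2 * l : ℤ)) * iterCentralDeriv g l p := by
  induction l with
  | zero => intro r hr p hp; simpa [iterCentralDeriv] using hh r hr p hp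
  | succ l ih =>
    intro r hr p hp
    have hr' : (r : ℂ) ≠ 0 := by exact_mod_cast hr.ne'
    have hG := iterCentralDeriv_contDiffOn hg l
    rw [iterCentralDeriv_succ, centralDeriv, centralDeriv]
    have h1 := (differentiableAt_of_contDiffOn_compl hG (dil_ne_zero hr.ne' hp)).hasFDerivAt
    have h2 := (differentiableAt_of_contDiffOn_compl hG hp).hasFDerivAt
    have h4 := fderiv_apply_of_comp_eq_const_mul h1 h2 (c := (r : ℂ) ^ (-(2 * l : ℤ)))
      (L := (dil n r hr.ne' : Heis n →L[ℝ] Heis n)) (by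
        filter_upwards [isOpen_compl_singleton.mem_nhds hp] with q hq using ih r hr q hq)
      (heisPt 0 1)
    rw [ContinuousLinearEquiv.coe_coe, dil_heisPt_zero_one, map_smul, Complex.real_smul] at h4
    push_cast at h4 ⊢
    rw [show -(2 * ((l : ℤ) + 1)) = -(2 * (l : ℤ)) + -2 by ring, zpow_add₀ hr', mul_right_comm, ← h4,
      zpow_neg _ 2, zpow_ofNat]
    field_simp

theorem hasDerivAt_iterCentralDeriv (hg : ContDiffOn ℝ ∞ g {0}ᶜ) {x : Horiz n} (hx : x ≠ 0)
    (l : ℕ) (t : ℝ) : HasDerivAt (fun t => iterCentralDeriv g l (heisPt x t))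
      (iterCentralDeriv g (l + 1) (heisPt x t)) t := by
  have h0 : heisPt x t ≠ 0 := fun h => hx (by simpa [heisPt] using congrArg (·.fst) h)
  have h2 : ∀ t : ℝ, heisPt x t = heisPt x 0 + t • heisPt (0 : Horiz n) 1 := fun t => by
    apply heis_ext <;> simp [heisPt]
  rw [iterCentralDeriv_succ]
  have h3 := (differentiableAt_of_contDiffOn_compl (iterCentralDeriv_contDiffOn hg l)
    h0).hasFDerivAt
  rw [h2 t] at h3
  have h4 := hasDerivAt_comp_line _ _ t h3
  simp only [← h2] at h4
  exact h4

theorem heisPt_continuous : Continuous (fun q : Horiz n × ℝ => heisPt q.1 q.2) :=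
  WithLp.prod_continuous_toLp 2 _ _

theorem heisPt_ne_zero_of_fst {x : Horiz n} (hx : x ≠ 0) (t : ℝ) : heisPt x t ≠ 0 :=
  fun h => hx (by simpa [heisPt] using congrArg (fun p : Heis n => p.fst) h)

theorem heisPt_ne_zero_of_snd (x : Horiz n) {t : ℝ} (ht : t ≠ 0) : heisPt x t ≠ 0 :=
  fun h => ht (by simpa [heisPt] using congrArg (fun p : Heis n => p.snd) h)

/-- The coefficients of the expansion of a function of homogeneous degree zero. -/
noncomputable def taylorCoeff (g : Heis n → ℂ) (l : ℕ) (x : Horiz n) : ℂ :=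
  iterCentralDeriv g l (heisPt x 0) / (l.factorial : ℂ)

theorem taylorCoeff_contDiffOn (hg : ContDiffOn ℝ ∞ g {0}ᶜ) (l : ℕ) :
    ContDiffOn ℝ ∞ (taylorCoeff g l) {0}ᶜ := by
  refine ContDiffOn.div_const ?_ _
  refine (iterCentralDeriv_contDiffOn hg l).comp (f := fun x : Horiz n => heisPt x 0) ?_
    fun x hx => heisPt_ne_zero_of_fst hx 0
  have : (fun x : Horiz n => heisPt x 0) =
    (WithLp.prodContinuousLinearEquiv 2 ℝ (Horiz n) ℝ).symm ∘ fun x => (x, 0) := rfl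
  rw [this]
  exact ((ContinuousLinearEquiv.contDiff _).comp
    (contDiff_id.prodMk contDiff_const)).contDiffOn

theorem taylorCoeff_smul (hg : ContDiffOn ℝ ∞ g {0}ᶜ)
    (hh : ∀ (r : ℝ) (hr : 0 < r) (p : Heis n), p ≠ 0 → g (dil n r hr.ne' p) = g p) (l : ℕ)
    (r : ℝ) (hr : 0 < r) (x : Horiz n) (hx : x ≠ 0) :
    taylorCoeff g l (r • x) = (r : ℂ) ^ (-(2 * l : ℤ)) * taylorCoeff g l x := by
  have h := iterCentralDeriv_dil hg hh l r hr (heisPt x 0) (heisPt_ne_zero_of_fst hx 0)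
  rw [dil_apply, mul_zero] at h
  rw [taylorCoeff, taylorCoeff, h, mul_div_assoc]

/-- By homogeneity g(x, e) = g(x/‖x‖, e/‖x‖²). Large x thus becomes a small central variable over
the compact unit sphere, where Taylor's formula is uniform. The powers e^l are the source of the
signs in the expansion of σ₋. -/
theorem exists_bound_sub_taylorCoeff (hg : ContDiffOn ℝ ∞ g {0}ᶜ)
    (hh : ∀ (r : ℝ) (hr : 0 < r) (p : Heis n), p ≠ 0 → g (dil n r hr.ne' p) = g p) (N : ℕ) :
    ∃ M : ℝ, ∀ e : ℝ, |e| = 1 → ∀ x : Horiz n, 1 ≤ ‖x‖ →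
      ‖g (heisPt x e) - ∑ l ∈ Finset.range N, (e : ℂ) ^ l * taylorCoeff g l x‖ ≤
        M * ‖x‖ ^ (-(2 * N : ℤ)) := by
  obtain ⟨M, hM⟩ := ((isCompact_sphere (0 : Horiz n) 1).prod
    (isCompact_Icc (a := (-1 : ℝ)) (b := 1))).exists_bound_of_continuousOn
      (f := fun q => iterCentralDeriv g N (heisPt q.1 q.2))
      ((iterCentralDeriv_contDiffOn hg N).continuousOn.comp heisPt_continuous.continuousOn
        fun q hq => heisPt_ne_zero_of_fst (fun h => by
          have := hq.1; rw [h] at this; simp at this) _)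
  refine ⟨M, fun e he x hx => ?_⟩
  have hx0 : 0 < ‖x‖ := one_pos.trans_le hx
  have hxne : x ≠ 0 := norm_pos_iff.1 hx0
  set r := ‖x‖⁻¹ with hr
  have hr0 : 0 < r := inv_pos.2 hx0
  have hr' : (r : ℂ) ≠ 0 := by exact_mod_cast hr0.ne'
  have hy : ‖r • x‖ = 1 := by
    rw [norm_smul, Real.norm_of_nonneg hr0.le, hr, inv_mul_cancel₀ hx0.ne']
  have hyne : r • x ≠ 0 := norm_pos_iff.1 (hy ▸ one_pos)
  have hr1 : r ^ 2 ≤ 1 := pow_le_one₀ hr0.le (inv_le_one_of_one_le₀ hx)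
  have habs : |r ^ 2 * e| = r ^ 2 := by
    rw [abs_mul, he, mul_one, abs_of_nonneg (by positivity)]
  have h1 := norm_sub_taylor_sum_le N (h := fun l t => iterCentralDeriv g l (heisPt (r • x) t))
    (M := M) (fun l t _ => hasDerivAt_iterCentralDeriv hg hyne l t)
    (fun t ht => hM (r • x, t) ⟨by simpa using hy, abs_le.1 ht⟩) (r ^ 2 * e) (by rw [habs]; exact hr1)
  have h2 : iterCentralDeriv g 0 (heisPt (r • x) (r ^ 2 * e)) = g (heisPt x e) := by
    rw [← dil_apply r hr0.ne']
    exact hh r hr0 _ (heisPt_ne_zero_of_fst hxne e)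
  simp only [h2, habs] at h1
  have h3 : ∀ l : ℕ, ((r ^ 2 * e : ℝ) : ℂ) ^ l / (l.factorial : ℂ) *
      iterCentralDeriv g l (heisPt (r • x) 0) = (e : ℂ) ^ l * taylorCoeff g l x := fun l => by
    have := taylorCoeff_smul hg hh l r hr0 x hxne
    rw [taylorCoeff] at this
    rw [div_mul_eq_mul_div, mul_div_assoc, this, zpow_neg]
    push_cast
    rw [mul_pow, ← pow_mul, show ((r : ℂ) ^ (2 * (l : ℤ))) = (r : ℂ) ^ (2 * l) by
      rw [← zpow_natCast]; push_cast; rfl]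
    field_simp
  simp only [h3] at h1
  refine h1.trans_eq ?_
  rw [hr, inv_pow, inv_pow, ← pow_mul, zpow_neg, ← zpow_natCast]
  push_cast
  rfl

theorem exists_isExpansion {k : 𝓢'(Heis n, ℂ)} (hk : IsSymbol k) : ∃ w, IsExpansion k w := by
  have hg := isDensityAwayZero_density (isRegularDist_fourierD hk)
  have hh : ∀ (r : ℝ) (hr : 0 < r) (p : Heis n), p ≠ 0 →
      density (fourierD k) (dil n r hr.ne' p) = density (fourierD k) p := fun r hr p hp => by
    simpa using hg.homogeneous (isHomogeneousDist_fourierD hk.homogeneous) hr hp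
  refine ⟨taylorCoeff (density (fourierD k)), taylorCoeff_contDiffOn hg.1,
    taylorCoeff_smul hg.1 hh, fun N => ?_, fun N => ?_⟩
  · obtain ⟨M, hM⟩ := exists_bound_sub_taylorCoeff hg.1 hh N
    refine Asymptotics.IsBigO.of_bound M ?_
    filter_upwards [eventually_cobounded_le_norm 1] with x hx
    have := hM 1 (by simp) x hx
    simp only [Complex.ofReal_one, one_pow, one_mul] at this
    rwa [Real.norm_of_nonneg (by positivity)]
  · obtain ⟨M, hM⟩ := exists_bound_sub_taylorCoeff hg.1 hh N
    refine Asymptotics.IsBigO.of_bound M ?_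
    filter_upwards [eventually_cobounded_le_norm 1] with x hx
    have := hM (-1) (by simp) x hx
    simp only [Complex.ofReal_neg, Complex.ofReal_one] at this
    rwa [Real.norm_of_nonneg (by positivity)]

end Expansion

/-! ### Integrals over annuli in the critical degree. -/

section Polar

variable {E : Type*} [NormedAddCommGroup E] [NormedSpace ℝ E] [FiniteDimensional ℝ E]
  [Nontrivial E] [MeasurableSpace E] [BorelSpace E]

/-- The radial density r^{d-1} against r^{-d} leaves 1/r, whose integral is the logarithm. -/
theorem integral_Ico_volumeIoiPow {d : ℕ} (hd : 1 ≤ d) {a b : ℝ} (ha : 0 < a) (hab : a ≤ b) :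
    ∫ r : Set.Ioi (0 : ℝ), (Set.Ico a b).indicator (fun r : ℝ => (r : ℂ) ^ (-(d : ℤ))) r
      ∂Measure.volumeIoiPow (d - 1) = (Real.log (b / a) : ℂ) := by
  simp only [Measure.volumeIoiPow, ENNReal.ofReal]
  rw [integral_withDensity_eq_integral_smul ((measurable_subtype_coe.pow_const _).real_toNNReal),
    integral_subtype_comap measurableSet_Ioi fun r : ℝ => Real.toNNReal (r ^ (d - 1)) •
      (Set.Ico a b).indicator (fun r : ℝ => (r : ℂ) ^ (-(d : ℤ))) r]
  have h1 : ∀ r ∈ Set.Ioi (0 : ℝ), Real.toNNReal (r ^ (d - 1)) •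
      (Set.Ico a b).indicator (fun r : ℝ => (r : ℂ) ^ (-(d : ℤ))) r =
      (Set.Ico a b).indicator (fun r : ℝ => ((r⁻¹ : ℝ) : ℂ)) r := fun r hr => by
    have hr' : (r : ℂ) ≠ 0 := by exact_mod_cast (ne_of_gt hr)
    by_cases h : r ∈ Set.Ico a b
    · rw [Set.indicator_of_mem h, Set.indicator_of_mem h, NNReal.smul_def,
        Real.coe_toNNReal _ (pow_nonneg (le_of_lt hr) _), Complex.real_smul, zpow_neg,
        zpow_natCast]
      push_cast
      obtain ⟨e, rfl⟩ : ∃ e, d = e + 1 := ⟨d - 1, by omega⟩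
      rw [Nat.add_sub_cancel, pow_succ]
      field_simp
    · rw [Set.indicator_of_notMem h, Set.indicator_of_notMem h, smul_zero]
  rw [setIntegral_congr_fun measurableSet_Ioi h1, setIntegral_indicator measurableSet_Ico,
    Set.inter_eq_right.2 (show Set.Ico a b ⊆ Set.Ioi 0 from fun r hr => ha.trans_le hr.1), integral_Ico_eq_integral_Ioc,
    ← intervalIntegral.integral_of_le hab, intervalIntegral.integral_ofReal,
    integral_inv_of_pos ha (ha.trans_le hab)]

/-- The integral over an annulus of a function that is homogeneous of the critical degree. -/
theorem setIntegral_annulus_of_homogeneous (μ : Measure E) [μ.IsAddHaarMeasure] {V : E → ℂ}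
    (hV : ∀ r : ℝ, 0 < r → ∀ x, x ≠ 0 →
      V (r • x) = (r : ℂ) ^ (-(Module.finrank ℝ E : ℤ)) * V x)
    {a b : ℝ} (ha : 0 < a) (hab : a ≤ b) :
    ∫ x in {x | a ≤ ‖x‖ ∧ ‖x‖ < b}, V x ∂μ =
      (∫ θ : Metric.sphere (0 : E) 1, V θ ∂μ.toSphere) * Real.log (b / a) := by
  have hm : MeasurableSet {x : E | a ≤ ‖x‖ ∧ ‖x‖ < b} :=
    (measurableSet_le measurable_const measurable_norm).inter
      (measurableSet_lt measurable_norm measurable_const)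
  rw [← integral_indicator hm, ← integral_Ico_volumeIoiPow (d := Module.finrank ℝ E)
    Module.finrank_pos ha hab]
  rw [← integral_prod_mul (μ := μ.toSphere) (ν := Measure.volumeIoiPow (Module.finrank ℝ E - 1))
    (fun θ : Metric.sphere (0 : E) 1 => V θ)
    (fun r : Set.Ioi (0 : ℝ) => (Set.Ico a b).indicator
      (fun r : ℝ => (r : ℂ) ^ (-(Module.finrank ℝ E : ℤ))) r)]
  rw [← μ.measurePreserving_homeomorphUnitSphereProd.integral_comp
    (Homeomorph.measurableEmbedding _)]
  have e1 := integral_subtype_comap (μ := μ) (measurableSet_singleton (0 : E)).compl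
    ({x : E | a ≤ ‖x‖ ∧ ‖x‖ < b}.indicator V)
  rw [restrict_compl_singleton] at e1
  rw [← e1]
  refine integral_congr_ae (Eventually.of_forall ?_)
  rintro ⟨x, hx⟩
  dsimp only
  have hx0 : 0 < ‖x‖ := norm_pos_iff.2 hx
  have hx' : ((‖x‖ : ℝ) : ℂ) ≠ 0 := by exact_mod_cast hx0.ne'
  rw [homeomorphUnitSphereProd_apply_snd_coe, homeomorphUnitSphereProd_apply_fst_coe]
  by_cases h : ‖x‖ ∈ Set.Ico a b
  · have h' : x ∈ {x : E | a ≤ ‖x‖ ∧ ‖x‖ < b} := h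
    rw [Set.indicator_of_mem h, Set.indicator_of_mem h', hV _ (inv_pos.2 hx0) _ hx]
    push_cast
    rw [inv_zpow, mul_right_comm, inv_mul_cancel₀ (zpow_ne_zero _ hx'), one_mul]
  · have h' : x ∉ {x : E | a ≤ ‖x‖ ∧ ‖x‖ < b} := h
    rw [Set.indicator_of_notMem h, Set.indicator_of_notMem h', mul_zero]

end Polar

/-! ### Bounds and integrability for homogeneous functions on the horizontal layer. -/

section Homogeneous

variable {n : ℕ}

theorem exists_bound_of_homogeneous {v : Horiz n → ℂ} {l : ℕ} (hc : ContinuousOn v {0}ᶜ)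
    (hh : ∀ r : ℝ, 0 < r → ∀ x : Horiz n, x ≠ 0 → v (r • x) = (r : ℂ) ^ (-(2 * l : ℤ)) * v x) :
    ∃ C : ℝ, 0 ≤ C ∧ ∀ x, x ≠ 0 → ‖v x‖ ≤ C * ‖x‖ ^ (-(2 * l : ℤ)) := by
  obtain ⟨M, hM⟩ := (isCompact_sphere (0 : Horiz n) 1).exists_bound_of_continuousOn
    (f := v) (hc.mono fun q hq h => by
      rw [Set.mem_singleton_iff] at h
      simp [h] at hq)
  refine ⟨max M 0, le_max_right _ _, fun x hx => ?_⟩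
  have hx0 : 0 < ‖x‖ := norm_pos_iff.2 hx
  have h1 : ‖‖x‖⁻¹ • x‖ = 1 := by
    rw [norm_smul, norm_inv, norm_norm, inv_mul_cancel₀ hx0.ne']
  have h2 := hh ‖x‖ hx0 (‖x‖⁻¹ • x) (norm_pos_iff.1 (h1 ▸ one_pos))
  rw [smul_smul, mul_inv_cancel₀ hx0.ne', one_smul] at h2
  rw [h2, norm_mul, norm_zpow, Complex.norm_real, norm_norm, mul_comm]
  gcongr
  exact (hM _ (by simpa using h1)).trans (le_max_left _ _)

theorem nontrivial_horiz (hn : 1 ≤ n) : Nontrivial (Horiz n) :=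
  have : Nonempty (Fin (2 * n)) := ⟨⟨0, by omega⟩⟩
  inferInstance

theorem finrank_horiz : Module.finrank ℝ (Horiz n) = 2 * n := by simp

theorem ae_ne_zero_horiz (hn : 1 ≤ n) : ∀ᵐ x : Horiz n, x ≠ 0 :=
  have := nontrivial_horiz hn
  ae_ne_zero_of_nontrivial

theorem integrableOn_ball_norm_zpow {l : ℕ} (hl : l < n) (R : ℝ) :
    IntegrableOn (fun x : Horiz n => ‖x‖ ^ (-(2 * l : ℤ))) (Metric.ball 0 R) := by
  have := nontrivial_horiz (n := n) (by omega)
  rw [integrableOn_fun_norm_addHaar volume (f := fun y : ℝ => y ^ (-(2 * l : ℤ))), finrank_horiz]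
  have h : ∀ y ∈ Set.Ioo (0 : ℝ) R, y ^ (2 * n - 1 - 2 * l) =
      y ^ (2 * n - 1) • y ^ (-(2 * l : ℤ)) := fun y hy => by
    have hy' : y ≠ 0 := hy.1.ne'
    obtain ⟨m, hm⟩ : ∃ m, 2 * n - 1 = m + 2 * l := ⟨2 * n - 1 - 2 * l, by omega⟩
    rw [hm, Nat.add_sub_cancel, smul_eq_mul, zpow_neg, pow_add,
      show y ^ (2 * (l : ℤ)) = y ^ (2 * l) by rw [← zpow_natCast]; push_cast; rfl]
    field_simp
  refine IntegrableOn.congr_fun ?_ h measurableSet_Ioo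
  exact (continuous_pow _).continuousOn.integrableOn_Icc.mono_set Set.Ioo_subset_Icc_self

theorem integrableOn_compl_ball_norm_zpow {R : ℝ} (hR : 1 ≤ R) :
    IntegrableOn (fun x : Horiz n => ‖x‖ ^ (-(2 * (n + 1 : ℕ) : ℤ))) (Metric.ball 0 R)ᶜ := by
  have h := (integrable_one_add_norm (E := Horiz n) (μ := volume) (r := ((2 * (n + 1) : ℕ) : ℝ))
    (by rw [finrank_horiz]; push_cast; linarith)).const_mul ((2 : ℝ) ^ (2 * (n + 1)))
  refine Integrable.mono' (h.integrableOn (s := (Metric.ball 0 R)ᶜ)) ?_ ?_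
  · exact (measurable_norm.pow_const _).aestronglyMeasurable
  · filter_upwards [ae_restrict_mem measurableSet_ball.compl] with x hx
    have hx1 : 1 ≤ ‖x‖ := hR.trans (by simpa using hx)
    rw [Real.norm_of_nonneg (by positivity), Real.rpow_neg (by positivity), Real.rpow_natCast,
      zpow_neg, show ‖x‖ ^ (2 * (n + 1 : ℕ) : ℤ) = ‖x‖ ^ (2 * (n + 1)) by
        rw [← zpow_natCast]; push_cast; rfl, ← div_eq_mul_inv, le_div_iff₀ (by positivity),
      inv_mul_le_iff₀ (by positivity), ← mul_pow]
    gcongr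
    linarith

end Homogeneous

/-! ### The regularised transform and its relation to 𝓡. -/

section Profile

variable {n : ℕ} {k : 𝓢'(Heis n, ℂ)} {w : ℕ → Horiz n → ℂ}

/-- The Fourier transform of a symbol minus its singular part with respect to integration over the
horizontal layer. -/
noncomputable def profile (k : 𝓢'(Heis n, ℂ)) (w : ℕ → Horiz n → ℂ) (x : Horiz n) (t : ℝ) : ℂ :=
  density (fourierD k) (heisPt x t) - (∑ l ∈ Finset.range n, w l x * (t : ℂ) ^ l) -
    {x | 1 ≤ ‖x‖}.indicator (w n) x * (t : ℂ) ^ n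

theorem measurableSet_one_le_norm (s : ℝ) : MeasurableSet {x : Horiz n | s ≤ ‖x‖} :=
  measurableSet_le measurable_const measurable_norm

theorem aestronglyMeasurable_of_continuousOn_compl (hn : 1 ≤ n) {v : Horiz n → ℂ}
    (hv : ContinuousOn v {0}ᶜ) : AEStronglyMeasurable v volume := by
  have h := hv.aestronglyMeasurable (μ := (volume : Measure (Horiz n)))
    (measurableSet_singleton (0 : Horiz n)).compl
  rwa [Measure.restrict_eq_self_of_ae_mem (s := ({0}ᶜ : Set (Horiz n))) (ae_ne_zero_horiz hn)] at h

theorem IsExpansion.isBigO (hw : IsExpansion k w) {e : ℝ} (he : e = 1 ∨ e = -1) (N : ℕ) :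
    (fun x => density (fourierD k) (heisPt x e) - ∑ l ∈ Finset.range N, w l x * (e : ℂ) ^ l)
      =O[Bornology.cobounded (Horiz n)] fun x => ‖x‖ ^ (-(2 * N : ℤ)) := by
  rcases he with rfl | rfl
  · simpa [sigmaPlus] using hw.plus N
  · simpa [sigmaMinus, mul_comm] using hw.minus N

theorem density_fourierD_spec (hk : IsSymbol k) :
    IsDensityAwayZero (fourierD k) (density (fourierD k)) :=
  isDensityAwayZero_density (isRegularDist_fourierD hk)

theorem density_fourierD_bound (hk : IsSymbol k) :
    ∃ M : ℝ, 0 ≤ M ∧ ∀ q, q ≠ 0 → ‖density (fourierD k) q‖ ≤ M :=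
  (density_fourierD_spec hk).exists_bound (isHomogeneousDist_fourierD hk.homogeneous)

theorem density_fourierD_dil (hk : IsSymbol k) {r : ℝ} (hr : 0 < r) {p : Heis n} (hp : p ≠ 0) :
    density (fourierD k) (dil n r hr.ne' p) = density (fourierD k) p := by
  simpa using (density_fourierD_spec hk).homogeneous
    (isHomogeneousDist_fourierD hk.homogeneous) hr hp

/-- On a ball every term is integrable on its own: k̂ is bounded, the degrees -2l with l < n are
integrable at 0, and the critical term is cut off there. Outside the ball the profile is the
remainder after n + 1 terms, hence O(‖x‖^{-2n-2}). -/
theorem integrable_profile (hn : 1 ≤ n) (hk : IsSymbol k) (hw : IsExpansion k w) {e : ℝ}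
    (he : e = 1 ∨ e = -1) : Integrable (fun x => profile k w x e) := by
  have he0 : e ≠ 0 := by rcases he with rfl | rfl <;> norm_num
  have hm1 : Continuous (fun x : Horiz n => density (fourierD k) (heisPt x e)) :=
    (density_fourierD_spec hk).continuousOn.comp_continuous
      (heisPt_continuous.comp (continuous_id.prodMk continuous_const))
      fun x => heisPt_ne_zero_of_snd x he0
  have hmw : ∀ l, AEStronglyMeasurable (w l) volume := fun l =>
    aestronglyMeasurable_of_continuousOn_compl hn (hw.smooth l).continuousOn
  have hbw := fun l => exists_bound_of_homogeneous (hw.smooth l).continuousOn (hw.homogeneous l)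
  obtain ⟨C, hC⟩ := (hw.isBigO he (n + 1)).bound
  obtain ⟨R₀, hR₀⟩ := (Filter.hasBasis_cobounded_norm.eventually_iff).1 hC
  -- Beyond this radius the asymptotic bound holds and the indicator in the profile equals 1.
  set R := max 1 R₀
  rw [← integrableOn_univ, ← Set.union_compl_self (Metric.ball (0 : Horiz n) R)]
  refine IntegrableOn.union ?_ ?_
  · have hfin : volume (Metric.ball (0 : Horiz n) R) ≠ ⊤ := measure_ball_lt_top.ne
    refine Integrable.sub (Integrable.sub ?_ ?_) ?_
    · obtain ⟨M, hM0, hM⟩ := density_fourierD_bound hk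
      exact (integrableOn_const (C := M) hfin).mono' hm1.aestronglyMeasurable
        (Eventually.of_forall fun x => hM _ (heisPt_ne_zero_of_snd x he0))
    · refine integrable_finsetSum _ fun l hl => Integrable.mul_const ?_ _
      obtain ⟨C, hC0, hC⟩ := hbw l
      exact ((integrableOn_ball_norm_zpow (Finset.mem_range.1 hl) R).const_mul C).mono'
        (hmw l).restrict (ae_restrict_of_ae ((ae_ne_zero_horiz hn).mono hC))
    · obtain ⟨C, hC0, hC⟩ := hbw n
      refine Integrable.mul_const ?_ _
      refine (integrableOn_const (C := C) hfin).mono'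
        ((hmw n).indicator (measurableSet_one_le_norm 1)).restrict (Eventually.of_forall fun x => ?_)
      by_cases hx : x ∈ {x : Horiz n | 1 ≤ ‖x‖}
      · rw [Set.indicator_of_mem hx]
        refine (hC x (norm_pos_iff.1 (one_pos.trans_le hx))).trans ?_
        refine mul_le_of_le_one_right hC0 ?_
        rw [zpow_neg]
        exact inv_le_one_of_one_le₀ (one_le_zpow₀ hx (by positivity))
      · rw [Set.indicator_of_notMem hx, norm_zero]; exact hC0
  · refine Integrable.mono' ((integrableOn_compl_ball_norm_zpow (le_max_left 1 R₀)).const_mul C)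
      ?_ ?_
    · refine (AEStronglyMeasurable.sub (hm1.aestronglyMeasurable.sub ?_) ?_).restrict
      · exact Finset.aestronglyMeasurable_fun_sum _ fun l _ => (hmw l).mul_const _
      · exact ((hmw n).indicator (measurableSet_one_le_norm 1)).mul_const _
    · filter_upwards [ae_restrict_mem measurableSet_ball.compl] with x hx
      have hxR : R ≤ ‖x‖ := by simpa using hx
      have h1 := hR₀.2 (x := x) ((le_max_right 1 R₀).trans hxR)
      have hx1 : x ∈ {x : Horiz n | 1 ≤ ‖x‖} := (le_max_left 1 R₀).trans hxR
      rw [Finset.sum_range_succ, ← sub_sub, Real.norm_of_nonneg (by positivity)] at h1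
      rw [profile, Set.indicator_of_mem hx1]
      exact h1

/-- In this combination the critical terms cut at ‖x‖ = 1 cancel, since (-1)^n (-1)^n = 1. Hence 𝓡
contains no w_{2n}. -/
theorem remainderR_eq (x : Horiz n) : remainderR k x =
    profile k (coeffW k) x 1 - (-1) ^ n * profile k (coeffW k) x (-1) := by
  simp only [remainderR, profile, sigmaPlus, sigmaMinus]
  push_cast
  have h : ∑ l ∈ Finset.range n, (1 - (-1 : ℂ) ^ (n + l)) * coeffW k l x =
      (∑ l ∈ Finset.range n, coeffW k l x * 1 ^ l) -
        (-1) ^ n * ∑ l ∈ Finset.range n, coeffW k l x * (-1) ^ l := by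
    rw [Finset.mul_sum, ← Finset.sum_sub_distrib]
    refine Finset.sum_congr rfl fun l _ => ?_
    rw [pow_add, one_pow]; ring
  have h2 : ((-1 : ℂ) ^ n) * (-1) ^ n = 1 := by rw [← mul_pow]; norm_num
  rw [h, one_pow]
  linear_combination -({x : Horiz n | 1 ≤ ‖x‖}.indicator (coeffW k n) x) * h2

theorem isExpansion_coeffW (hk : IsSymbol k) : IsExpansion k (coeffW k) := by
  rw [coeffW, dif_pos (exists_isExpansion hk)]
  exact (exists_isExpansion hk).choose_spec

theorem integrable_remainderR (hn : 1 ≤ n) (hk : IsSymbol k) : Integrable (remainderR k) := by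
  rw [show remainderR k = _ from funext remainderR_eq]
  exact (integrable_profile hn hk (isExpansion_coeffW hk) (Or.inl rfl)).sub
    ((integrable_profile hn hk (isExpansion_coeffW hk) (Or.inr rfl)).const_mul _)

theorem integral_remainderR (hn : 1 ≤ n) (hk : IsSymbol k) :
    ∫ x, remainderR k x = (∫ x, profile k (coeffW k) x 1) -
      (-1) ^ n * ∫ x, profile k (coeffW k) x (-1) := by
  simp_rw [remainderR_eq]
  rw [integral_sub (integrable_profile hn hk (isExpansion_coeffW hk) (Or.inl rfl))
    ((integrable_profile hn hk (isExpansion_coeffW hk) (Or.inr rfl)).const_mul _),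
    integral_const_mul]

end Profile

/-! ### Scaling of the integrated profile and the logarithm. -/

section ProfileIntegral

variable {n : ℕ} {k : 𝓢'(Heis n, ℂ)} {w : ℕ → Horiz n → ℂ}

/-- The integral over the unit sphere. -/
noncomputable def sphereIntegral (v : Horiz n → ℂ) : ℂ :=
  ∫ θ : Metric.sphere (0 : Horiz n) 1, v θ ∂(volume : Measure (Horiz n)).toSphere

/-- The difference of the truncations of a function to the complements of two balls. -/
noncomputable def cutDiff (v : Horiz n → ℂ) (s : ℝ) (x : Horiz n) : ℂ :=
  {x | s ≤ ‖x‖}.indicator v x - {x | 1 ≤ ‖x‖}.indicator v x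

theorem cutDiff_of_le_one (v : Horiz n → ℂ) {s : ℝ} (hs : s ≤ 1) :
    cutDiff v s = {x | s ≤ ‖x‖ ∧ ‖x‖ < 1}.indicator v := by
  ext x
  simp only [cutDiff, Set.indicator_apply, Set.mem_ofPred_eq]
  by_cases h1 : s ≤ ‖x‖ <;> by_cases h2 : ‖x‖ < 1
  · simp [h1, h2, not_le.2 h2]
  · simp [h1, h2, not_lt.1 h2]
  · simp [h1, not_le.2 h2]
  · exact absurd (hs.trans (not_lt.1 h2)) h1

theorem cutDiff_of_one_le (v : Horiz n → ℂ) {s : ℝ} (hs : 1 ≤ s) :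
    cutDiff v s = -{x | 1 ≤ ‖x‖ ∧ ‖x‖ < s}.indicator v := by
  ext x
  simp only [cutDiff, Set.indicator_apply, Set.mem_ofPred_eq, Pi.neg_apply]
  by_cases h1 : 1 ≤ ‖x‖ <;> by_cases h2 : ‖x‖ < s
  · simp [h1, h2, not_le.2 h2]
  · simp [h1, h2, not_lt.1 h2]
  · simp [h1, not_le.2 h2]
  · exact absurd (hs.trans (not_lt.1 h2)) h1

theorem measurableSet_annulus (a b : ℝ) : MeasurableSet {x : Horiz n | a ≤ ‖x‖ ∧ ‖x‖ < b} :=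
  (measurableSet_le measurable_const measurable_norm).inter
    (measurableSet_lt measurable_norm measurable_const)

theorem integrableOn_annulus {v : Horiz n → ℂ} (hc : ContinuousOn v {0}ᶜ)
    {a b : ℝ} (ha : 0 < a) : IntegrableOn v {x | a ≤ ‖x‖ ∧ ‖x‖ < b} := by
  have hK : IsCompact {x : Horiz n | a ≤ ‖x‖ ∧ ‖x‖ ≤ b} := by
    refine (isCompact_closedBall (0 : Horiz n) b).of_isClosed_subset
      ((isClosed_le continuous_const continuous_norm).inter
        (isClosed_le continuous_norm continuous_const)) fun x hx => by simpa using hx.2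
  have hc' : ContinuousOn v {x : Horiz n | a ≤ ‖x‖ ∧ ‖x‖ ≤ b} := hc.mono fun x hx h => by
    rw [Set.mem_singleton_iff] at h
    have := hx.1
    rw [h, norm_zero] at this
    linarith
  exact (hc'.integrableOn_compact (μ := volume) hK).mono_set fun x hx => ⟨hx.1, hx.2.le⟩

theorem setIntegral_annulus_horiz (hn : 1 ≤ n) {v : Horiz n → ℂ}
    (hh : ∀ r : ℝ, 0 < r → ∀ x : Horiz n, x ≠ 0 → v (r • x) = (r : ℂ) ^ (-(2 * n : ℤ)) * v x)
    {a b : ℝ} (ha : 0 < a) (hab : a ≤ b) :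
    ∫ x in {x | a ≤ ‖x‖ ∧ ‖x‖ < b}, v x = sphereIntegral v * Real.log (b / a) := by
  have := nontrivial_horiz hn
  refine setIntegral_annulus_of_homogeneous volume (fun r hr x hx => ?_) ha hab
  rw [hh r hr x hx, finrank_horiz]
  push_cast
  rfl

theorem integrable_cutDiff {v : Horiz n → ℂ} (hc : ContinuousOn v {0}ᶜ) {s : ℝ}
    (hs : 0 < s) : Integrable (cutDiff v s) := by
  rcases le_total s 1 with h | h
  · rw [cutDiff_of_le_one v h, integrable_indicator_iff (measurableSet_annulus _ _)]
    exact integrableOn_annulus hc hs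
  · rw [cutDiff_of_one_le v h]
    refine Integrable.neg ?_
    rw [integrable_indicator_iff (measurableSet_annulus _ _)]
    exact integrableOn_annulus hc one_pos

/-- Moving the cut from radius 1 to radius s adds or removes an annulus, and both cases give the
same signed logarithm. -/
theorem integral_cutDiff (hn : 1 ≤ n) {v : Horiz n → ℂ}
    (hh : ∀ r : ℝ, 0 < r → ∀ x : Horiz n, x ≠ 0 → v (r • x) = (r : ℂ) ^ (-(2 * n : ℤ)) * v x)
    {s : ℝ} (hs : 0 < s) : ∫ x, cutDiff v s x = -(sphereIntegral v * Real.log s) := by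
  rcases le_total s 1 with h | h
  · rw [cutDiff_of_le_one v h, integral_indicator (measurableSet_annulus _ _),
      setIntegral_annulus_horiz hn hh hs h, one_div, Real.log_inv]
    push_cast; ring
  · rw [cutDiff_of_one_le v h]
    simp_rw [Pi.neg_apply]
    rw [integral_neg, integral_indicator (measurableSet_annulus _ _),
      setIntegral_annulus_horiz hn hh one_pos h, div_one]

/-- The norm of v is homogeneous of the same critical degree, so the annulus formula applies to it
as well. -/
theorem exists_integral_norm_cutDiff (hn : 1 ≤ n) {v : Horiz n → ℂ}
    (hh : ∀ r : ℝ, 0 < r → ∀ x : Horiz n, x ≠ 0 → v (r • x) = (r : ℂ) ^ (-(2 * n : ℤ)) * v x) :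
    ∃ C : ℝ, 0 ≤ C ∧ ∀ s : ℝ, 0 < s → ∫ x, ‖cutDiff v s x‖ = C * |Real.log s| := by
  have hh' : ∀ r : ℝ, 0 < r → ∀ x : Horiz n, x ≠ 0 →
      ((‖v (r • x)‖ : ℝ) : ℂ) = (r : ℂ) ^ (-(2 * n : ℤ)) * ((‖v x‖ : ℝ) : ℂ) := fun r hr x hx => by
    rw [hh r hr x hx, norm_mul, norm_zpow, Complex.norm_real, Real.norm_of_nonneg hr.le]
    push_cast; rfl
  have key : ∀ a b : ℝ, 0 < a → a ≤ b → ∫ x in {x : Horiz n | a ≤ ‖x‖ ∧ ‖x‖ < b}, ‖v x‖ =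
      (∫ θ : Metric.sphere (0 : Horiz n) 1, ‖v θ‖ ∂(volume : Measure (Horiz n)).toSphere) *
        Real.log (b / a) := fun a b ha hab => by
    have h := setIntegral_annulus_horiz hn (v := fun x => ((‖v x‖ : ℝ) : ℂ)) hh' ha hab
    rw [sphereIntegral, integral_complex_ofReal, integral_complex_ofReal] at h
    exact_mod_cast h
  refine ⟨∫ θ : Metric.sphere (0 : Horiz n) 1, ‖v θ‖ ∂(volume : Measure (Horiz n)).toSphere,
    integral_nonneg fun _ => norm_nonneg _, fun s hs => ?_⟩
  rcases le_total s 1 with h | h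
  · rw [cutDiff_of_le_one v h]
    simp_rw [norm_indicator_eq_indicator_norm]
    rw [integral_indicator (measurableSet_annulus _ _), key s 1 hs h, one_div, Real.log_inv,
      abs_of_nonpos (Real.log_nonpos hs.le h)]
  · rw [cutDiff_of_one_le v h]
    simp_rw [Pi.neg_apply, norm_neg, norm_indicator_eq_indicator_norm]
    rw [integral_indicator (measurableSet_annulus _ _), key 1 s one_pos h, div_one,
      abs_of_nonneg (Real.log_nonneg h)]

/-- Both k̂(x,t) and the products w_{2l}(x) t^l are invariant under dilation. Only the cut at ‖x‖ =
1 moves, to ‖x‖ = s, and `cutDiff` records the change. -/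
theorem profile_eq_scaled (hk : IsSymbol k) (hw : IsExpansion k w) {s e t : ℝ} (hs : 0 < s)
    (hset : s ^ 2 * e = t) {x : Horiz n} (hx : x ≠ 0) :
    profile k w x t = profile k w (s⁻¹ • x) e + (t : ℂ) ^ n * cutDiff (w n) s x := by
  have hs' : (s : ℂ) ≠ 0 := by exact_mod_cast hs.ne'
  have hsi := inv_pos.2 hs
  have h1 : density (fourierD k) (heisPt (s⁻¹ • x) e) = density (fourierD k) (heisPt x t) := by
    rw [← density_fourierD_dil hk hsi (heisPt_ne_zero_of_fst hx t), dil_apply, ← hset]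
    congr 2
    field_simp
  have h2 : ∀ l : ℕ, w l (s⁻¹ • x) * (e : ℂ) ^ l = w l x * (t : ℂ) ^ l := fun l => by
    rw [hw.homogeneous l _ hsi x hx, ← hset]
    push_cast
    rw [inv_zpow, zpow_neg, inv_inv, show (s : ℂ) ^ (2 * (l : ℤ)) = (s : ℂ) ^ (2 * l) by
      rw [← zpow_natCast]; push_cast; rfl]
    ring
  have h3 : {x : Horiz n | 1 ≤ ‖x‖}.indicator (w n) (s⁻¹ • x) * (e : ℂ) ^ n =
      {x : Horiz n | s ≤ ‖x‖}.indicator (w n) x * (t : ℂ) ^ n := by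
    have hiff : (s⁻¹ • x) ∈ {x : Horiz n | 1 ≤ ‖x‖} ↔ x ∈ {x : Horiz n | s ≤ ‖x‖} := by
      rw [Set.mem_ofPred_eq, Set.mem_ofPred_eq, norm_smul, Real.norm_of_nonneg hsi.le,
        ← div_eq_inv_mul, le_div_iff₀ hs, one_mul]
    by_cases h : x ∈ {x : Horiz n | s ≤ ‖x‖}
    · rw [Set.indicator_of_mem h, Set.indicator_of_mem (hiff.2 h), h2]
    · rw [Set.indicator_of_notMem h, Set.indicator_of_notMem (fun h' => h (hiff.1 h')), zero_mul,
        zero_mul]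
  simp only [profile, h1, h2, h3, cutDiff]
  ring

theorem integral_comp_inv_smul_horiz {s : ℝ} (hs : 0 < s) {F : Type*} [NormedAddCommGroup F]
    [NormedSpace ℝ F] (f : Horiz n → F) :
    ∫ x, f (s⁻¹ • x) = (s ^ 2) ^ n • ∫ x, f x := by
  rw [Measure.integral_comp_inv_smul, finrank_horiz, abs_of_nonneg (by positivity), pow_mul]

/-- The integrals of the profile over horizontal layers. -/
theorem integral_profile (hn : 1 ≤ n) (hk : IsSymbol k) (hw : IsExpansion k w) {s e t : ℝ}
    (hs : 0 < s) (he : e = 1 ∨ e = -1) (hset : s ^ 2 * e = t) :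
    Integrable (fun x => profile k w x t) ∧
    ∫ x, profile k w x t = ((s ^ 2 : ℝ) : ℂ) ^ n * (∫ x, profile k w x e) -
      (t : ℂ) ^ n * (sphereIntegral (w n) * Real.log s) ∧
    ∫ x, ‖profile k w x t‖ ≤ |t| ^ n * ((∫ x, ‖profile k w x e‖) +
      ∫ x, ‖cutDiff (w n) s x‖) := by
  have hae : (fun x => profile k w x t) =ᵐ[volume] fun x =>
      profile k w (s⁻¹ • x) e + (t : ℂ) ^ n * cutDiff (w n) s x :=
    (ae_ne_zero_horiz hn).mono fun x hx => profile_eq_scaled hk hw hs hset hx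
  have hI1 : Integrable (fun x => profile k w (s⁻¹ • x) e) :=
    (integrable_profile hn hk hw he).comp_smul (inv_ne_zero hs.ne')
  have hI2 : Integrable (fun x => (t : ℂ) ^ n * cutDiff (w n) s x) :=
    (integrable_cutDiff (hw.smooth n).continuousOn hs).const_mul _
  refine ⟨(hI1.add hI2).congr hae.symm, ?_, ?_⟩
  · rw [integral_congr_ae hae, integral_add hI1 hI2,
      integral_comp_inv_smul_horiz hs (fun x => profile k w x e), integral_const_mul,
      integral_cutDiff hn (hw.homogeneous n) hs, Complex.real_smul]
    push_cast
    ring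
  · have ht : |t| = s ^ 2 := by
      rw [← hset, abs_mul, abs_of_nonneg (sq_nonneg s)]
      rcases he with rfl | rfl <;> simp
    calc ∫ x, ‖profile k w x t‖ = ∫ x, ‖profile k w (s⁻¹ • x) e + (t : ℂ) ^ n * cutDiff (w n) s x‖ :=
          integral_congr_ae (hae.mono fun x hx => by simp only [hx])
      _ ≤ ∫ x, (‖profile k w (s⁻¹ • x) e‖ + ‖(t : ℂ) ^ n * cutDiff (w n) s x‖) :=
          integral_mono (hI1.add hI2).norm (hI1.norm.add hI2.norm) fun x => norm_add_le _ _
      _ = |t| ^ n * ((∫ x, ‖profile k w x e‖) + ∫ x, ‖cutDiff (w n) s x‖) := by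
          rw [integral_add hI1.norm hI2.norm,
            integral_comp_inv_smul_horiz hs (fun x => ‖profile k w x e‖)]
          simp_rw [norm_mul, norm_pow, Complex.norm_real, Real.norm_eq_abs]
          rw [integral_const_mul, ht, smul_eq_mul, mul_add]

/-- For |t| ≤ 1 one of the n ≥ 1 factors |t| absorbs the logarithm; for |t| ≥ 1 the logarithm is at
most |t|. -/
theorem pow_mul_abs_log_le (hn : 1 ≤ n) {t : ℝ} (ht : t ≠ 0) :
    |t| ^ n * |Real.log t| ≤ 1 + |t| ^ (n + 1) := by
  have ht0 : 0 < |t| := abs_pos.2 ht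
  rcases le_total |t| 1 with h | h
  · have h1 := Real.abs_log_mul_self_lt |t| ht0 h
    rw [Real.log_abs, abs_mul, abs_abs] at h1
    obtain ⟨m, rfl⟩ : ∃ m, n = m + 1 := ⟨n - 1, by omega⟩
    calc |t| ^ (m + 1) * |Real.log t| = |t| ^ m * (|Real.log t| * |t|) := by ring
      _ ≤ 1 * 1 := by gcongr; exact pow_le_one₀ ht0.le h
      _ ≤ _ := by rw [one_mul]; exact le_add_of_nonneg_right (by positivity)
  · have h1 : |Real.log t| ≤ |t| := by
      rw [← Real.log_abs, abs_of_nonneg (Real.log_nonneg h)]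
      exact (Real.log_le_sub_one_of_pos ht0).trans (by linarith)
    calc |t| ^ n * |Real.log t| ≤ |t| ^ n * |t| := by gcongr
      _ = |t| ^ (n + 1) := (pow_succ _ _).symm
      _ ≤ _ := by linarith

theorem exists_sign_decomposition {t : ℝ} (ht : t ≠ 0) :
    ∃ s e : ℝ, 0 < s ∧ (e = 1 ∨ e = -1) ∧ s ^ 2 * e = t ∧ Real.log s = Real.log t / 2 := by
  have h1 : √|t| ^ 2 = |t| := Real.sq_sqrt (abs_nonneg t)
  have h2 : Real.log √|t| = Real.log t / 2 := by rw [Real.log_sqrt (abs_nonneg t), Real.log_abs]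
  rcases lt_or_gt_of_ne ht with h | h
  · exact ⟨√|t|, -1, Real.sqrt_pos.2 (abs_pos.2 ht), Or.inr rfl,
      by rw [h1, abs_of_neg h]; ring, h2⟩
  · exact ⟨√|t|, 1, Real.sqrt_pos.2 (abs_pos.2 ht), Or.inl rfl,
      by rw [h1, abs_of_pos h]; ring, h2⟩

/-- Polynomial growth in t is what allows Fubini against Schwartz functions of the central variable.
-/
theorem exists_bound_integral_norm_profile (hn : 1 ≤ n) (hk : IsSymbol k) (hw : IsExpansion k w) :
    ∃ K : ℝ, ∀ t : ℝ, t ≠ 0 → Integrable (fun x => profile k w x t) ∧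
      ∫ x, ‖profile k w x t‖ ≤ K * (1 + |t| ^ n + |t| ^ (n + 1)) := by
  obtain ⟨C, hC0, hC⟩ := exists_integral_norm_cutDiff hn (hw.homogeneous n)
  set I₁ := ∫ x, ‖profile k w x 1‖
  set I₂ := ∫ x, ‖profile k w x (-1)‖
  have h1 : 0 ≤ I₁ := integral_nonneg fun _ => norm_nonneg _
  have h2 : 0 ≤ I₂ := integral_nonneg fun _ => norm_nonneg _
  refine ⟨I₁ + I₂ + C, fun t ht => ?_⟩
  obtain ⟨s, e, hs, he, hset, hlog⟩ := exists_sign_decomposition ht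
  obtain ⟨hI, -, hb⟩ := integral_profile hn hk hw hs he hset
  refine ⟨hI, hb.trans ?_⟩
  have h3 : ∫ x, ‖profile k w x e‖ ≤ I₁ + I₂ := by
    rcases he with rfl | rfl
    · exact le_add_of_nonneg_right h2
    · exact le_add_of_nonneg_left h1
  rw [hC s hs, hlog, abs_div, abs_two]
  have h4 := pow_mul_abs_log_le hn ht
  have h5 : 0 ≤ |t| ^ n := by positivity
  have h6 : 0 ≤ |t| ^ (n + 1) := by positivity
  calc |t| ^ n * ((∫ x, ‖profile k w x e‖) + C * (|Real.log t| / 2))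
      ≤ |t| ^ n * ((I₁ + I₂) + C * (|Real.log t| / 2)) := by gcongr
    _ = (I₁ + I₂) * |t| ^ n + C / 2 * (|t| ^ n * |Real.log t|) := by ring
    _ ≤ (I₁ + I₂) * |t| ^ n + C / 2 * (1 + |t| ^ (n + 1)) := by gcongr
    _ ≤ (I₁ + I₂ + C) * (1 + |t| ^ n + |t| ^ (n + 1)) := by
        nlinarith [mul_nonneg hC0 h5, mul_nonneg hC0 h6, mul_nonneg (add_nonneg h1 h2) h6]

theorem aestronglyMeasurable_profile (hn : 1 ≤ n) (hk : IsSymbol k) (hw : IsExpansion k w) :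
    AEStronglyMeasurable (fun q : Horiz n × ℝ => profile k w q.1 q.2) volume := by
  have hmw : ∀ l, AEStronglyMeasurable (w l) volume := fun l =>
    aestronglyMeasurable_of_continuousOn_compl hn (hw.smooth l).continuousOn
  have hpow : ∀ l : ℕ, AEStronglyMeasurable (fun q : Horiz n × ℝ => (q.2 : ℂ) ^ l) volume :=
    fun l => (by fun_prop : Continuous fun q : Horiz n × ℝ => (q.2 : ℂ) ^ l).aestronglyMeasurable
  refine AEStronglyMeasurable.sub (AEStronglyMeasurable.sub ?_ ?_) ?_
  · exact (density_fourierD_spec hk).aestronglyMeasurable.comp_measurePreserving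
      measurePreserving_heisPt
  · exact Finset.aestronglyMeasurable_fun_sum _ fun l _ => ((hmw l).comp_fst).mul (hpow l)
  · exact (((hmw n).indicator (measurableSet_one_le_norm 1)).comp_fst).mul (hpow n)

theorem integrable_pow_abs_mul_norm (B : 𝓢(ℝ, ℂ)) (m : ℕ) :
    Integrable (fun t : ℝ => |t| ^ m * ‖B t‖) := by
  simpa using B.integrable_pow_mul volume m

/-- The product of the profile with a Schwartz function of the central variable is integrable. -/
theorem integrable_profile_mul (hn : 1 ≤ n) (hk : IsSymbol k) (hw : IsExpansion k w)
    (B : 𝓢(ℝ, ℂ)) : Integrable (fun q : Horiz n × ℝ => profile k w q.1 q.2 * B q.2) := by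
  obtain ⟨K, hK⟩ := exists_bound_integral_norm_profile hn hk hw
  have hm : AEStronglyMeasurable (fun q : Horiz n × ℝ => profile k w q.1 q.2 * B q.2) volume :=
    (aestronglyMeasurable_profile hn hk hw).mul
      (B.continuous.comp continuous_snd).aestronglyMeasurable
  have hne : ∀ᵐ t : ℝ, t ≠ 0 := ae_ne_zero_of_nontrivial
  rw [Measure.volume_eq_prod] at hm ⊢
  -- The slices are taken at fixed t ≠ 0, where integrability in x is known.
  rw [integrable_prod_iff' hm]
  refine ⟨hne.mono fun t ht => (hK t ht).1.mul_const (B t), ?_⟩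
  have hdom : Integrable (fun t : ℝ => K * (‖B t‖ + |t| ^ n * ‖B t‖ + |t| ^ (n + 1) * ‖B t‖)) :=
    ((B.integrable.norm.add (integrable_pow_abs_mul_norm B n)).add
      (integrable_pow_abs_mul_norm B (n + 1))).const_mul K
  refine hdom.mono' hm.norm.prod_swap.integral_prod_right' (hne.mono fun t ht => ?_)
  simp only [norm_mul]
  rw [integral_mul_const, norm_mul, norm_norm, Real.norm_of_nonneg
    (integral_nonneg fun _ => norm_nonneg _)]
  calc _ ≤ K * (1 + |t| ^ n + |t| ^ (n + 1)) * ‖B t‖ := by gcongr; exact (hK t ht).2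
    _ = _ := by ring

end ProfileIntegral

/-! ### Test functions on the centre and their vanishing moments. -/

section CentralTest

theorem hasCompactSupport_comp_two_pi {β : ℝ → ℂ} (hc : HasCompactSupport β) :
    HasCompactSupport (fun s => β (2 * Real.pi * s)) :=
  hc.comp_homeomorph (Homeomorph.mulLeft₀ (2 * Real.pi) Real.two_pi_pos.ne')

theorem contDiff_comp_two_pi {β : ℝ → ℂ} (hβ : ContDiff ℝ ∞ β) :
    ContDiff ℝ ∞ (fun s => β (2 * Real.pi * s)) :=
  hβ.comp (contDiff_const.mul contDiff_id)

/-- The inverse Fourier transform of a test function of the central variable. -/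
noncomputable def centralInv {β : ℝ → ℂ} (hβ : ContDiff ℝ ∞ β) (hc : HasCompactSupport β) :
    𝓢(ℝ, ℂ) :=
  𝓕⁻ ((hasCompactSupport_comp_two_pi hc).toSchwartzMap (contDiff_comp_two_pi hβ))

theorem fourierInv_apply_eq_integral {V : Type*} [NormedAddCommGroup V] [InnerProductSpace ℝ V]
    [FiniteDimensional ℝ V] [MeasurableSpace V] [BorelSpace V] (φ : 𝓢(V, ℂ)) (x : V) :
    𝓕⁻ φ x = ∫ y, Complex.exp (((2 * Real.pi * inner ℝ y x : ℝ) : ℂ) * Complex.I) * φ y := by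
  rw [SchwartzMap.fourierInv_coe, Real.fourierInv_eq']
  rfl

theorem centralInv_apply {β : ℝ → ℂ} (hβ : ContDiff ℝ ∞ β) (hc : HasCompactSupport β) (t : ℝ) :
    centralInv hβ hc t =
      ∫ s, Complex.exp (((2 * Real.pi * (t * s) : ℝ) : ℂ) * Complex.I) * β (2 * Real.pi * s) := by
  rw [centralInv, fourierInv_apply_eq_integral]
  rfl

theorem integrable_ofReal_pow_mul (B : 𝓢(ℝ, ℂ)) (l : ℕ) :
    Integrable (fun t : ℝ => (t : ℂ) ^ l * B t) := by
  refine (integrable_pow_abs_mul_norm B l).mono'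
    (by fun_prop : Continuous fun t : ℝ => (t : ℂ) ^ l * B t).aestronglyMeasurable
    (Eventually.of_forall fun t => ?_)
  rw [norm_mul, norm_pow, Complex.norm_real, Real.norm_eq_abs]

/-- All moments of the inverse Fourier transform vanish if the test function vanishes near zero. -/
theorem integral_pow_mul_centralInv {β : ℝ → ℂ} (hβ : ContDiff ℝ ∞ β) (hc : HasCompactSupport β)
    (h0 : (0 : ℝ) ∉ tsupport β) (l : ℕ) : ∫ t : ℝ, (t : ℂ) ^ l * centralInv hβ hc t = 0 := by
  set B := centralInv hβ hc with hB
  have h1 : (𝓕 (B : ℝ → ℂ)) = fun s => β (2 * Real.pi * s) := by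
    rw [← SchwartzMap.fourier_coe, hB, centralInv, FourierTransform.fourier_fourierInv_eq]
    rfl
  have h2 := Real.iteratedDeriv_fourier (f := (B : ℝ → ℂ)) (N := ⊤) (n := l) (fun m _ => by
    refine (integrable_ofReal_pow_mul B m).congr (Eventually.of_forall fun t => ?_)
    simp only [Complex.real_smul]
    push_cast
    rfl) le_top
  -- Up to a nonzero constant the moments are the derivatives at 0 of the Fourier transform β(2πs),
  -- which vanishes identically near 0.
  have h3 : iteratedDeriv l (fun s => β (2 * Real.pi * s)) 0 = 0 := by
    have h4 : (fun s => β (2 * Real.pi * s)) =ᶠ[𝓝 0] fun _ => (0 : ℂ) := by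
      have h5 : Tendsto (fun s : ℝ => 2 * Real.pi * s) (𝓝 0) (𝓝 0) := by
        have h : Continuous fun s : ℝ => 2 * Real.pi * s := continuous_const.mul continuous_id
        have h' := h.tendsto 0
        rwa [mul_zero] at h'
      exact h5.eventually (notMem_tsupport_iff_eventuallyEq.1 h0)
    rw [h4.iteratedDeriv_eq l]
    simp
  rw [h1] at h2
  have h6 := congrFun h2 0
  rw [h3, Real.fourier_real_eq] at h6
  have h7 : (0 : ℂ) = (-2 * Real.pi * Complex.I) ^ l * ∫ t : ℝ, (t : ℂ) ^ l * B t := by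
    rw [h6, ← integral_const_mul]
    congr 1; ext t
    simp only [mul_zero, neg_zero, AddChar.map_zero_eq_one, one_smul, smul_eq_mul]
    rw [mul_pow, mul_assoc]
  have hpi : (-2 * Real.pi * Complex.I : ℂ) ^ l ≠ 0 := by
    refine pow_ne_zero _ ?_
    simp [Real.pi_ne_zero, Complex.I_ne_zero]
  exact (mul_eq_zero.1 h7.symm).resolve_left hpi

end CentralTest

/-! ### Restriction of k to the centre through concentrating test functions. -/

section Pairing

variable {n : ℕ} {k : 𝓢'(Heis n, ℂ)} {w : ℕ → Horiz n → ℂ} {a : Horiz n → ℂ} {β : ℝ → ℂ}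

theorem fourierS_fourierInv (Φ : 𝓢(Heis n, ℂ)) (q : Heis n) :
    fourierS n (𝓕⁻ Φ) q = Φ ((2 * Real.pi)⁻¹ • q) := by
  have h : fourierS n (𝓕⁻ Φ) q = (𝓕 (𝓕⁻ Φ)) ((2 * Real.pi)⁻¹ • q) := rfl
  rw [h, FourierTransform.fourier_fourierInv_eq]

/-- The tensor product of functions of the horizontal and central variables. -/
noncomputable def tensorFun (a : Horiz n → ℂ) (b : ℝ → ℂ) (p : Heis n) : ℂ := a p.fst * b p.snd

theorem tensorFun_contDiff (ha : ContDiff ℝ ∞ a) (hβ : ContDiff ℝ ∞ β) :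
    ContDiff ℝ ∞ (tensorFun a β) := by
  have h1 : ContDiff ℝ ∞ (fun p : Heis n => (p.fst, p.snd)) :=
    (WithLp.prodContinuousLinearEquiv 2 ℝ (Horiz n) ℝ).contDiff
  exact (ha.comp (contDiff_fst.comp h1)).mul (hβ.comp (contDiff_snd.comp h1))

theorem tensorFun_hasCompactSupport (hac : HasCompactSupport a) (hc : HasCompactSupport β) :
    HasCompactSupport (tensorFun a β) := by
  refine HasCompactSupport.of_support_subset_isCompact
    ((hac.isCompact.prod hc.isCompact).image heisPt_continuous) fun p hp => ?_
  refine ⟨(p.fst, p.snd), ⟨subset_tsupport _ fun h => ?_, subset_tsupport _ fun h => ?_⟩, rfl⟩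
  · exact hp (by rw [tensorFun, h, zero_mul])
  · exact hp (by rw [tensorFun, h, mul_zero])

theorem zero_notMem_tsupport_tensorFun (h0 : (0 : ℝ) ∉ tsupport β) :
    (0 : Heis n) ∉ tsupport (tensorFun a β) := by
  rw [notMem_tsupport_iff_eventuallyEq] at h0 ⊢
  have h1 : Continuous (fun p : Heis n => p.snd) :=
    continuous_snd.comp (WithLp.prodContinuousLinearEquiv 2 ℝ (Horiz n) ℝ).continuous
  have h2 : Tendsto (fun p : Heis n => p.snd) (𝓝 0) (𝓝 0) := h1.tendsto 0
  filter_upwards [h2.eventually h0] with p hp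
  rw [tensorFun, hp, Pi.zero_apply, mul_zero, Pi.zero_apply]

theorem fourierInv_tensorFun {Φ : 𝓢(Heis n, ℂ)} {A : 𝓢(Horiz n, ℂ)} {b : 𝓢(ℝ, ℂ)}
    (h : ∀ p, Φ p = A p.fst * b p.snd) (x : Horiz n) (t : ℝ) :
    𝓕⁻ Φ (heisPt x t) = 𝓕⁻ A x * 𝓕⁻ b t := by
  rw [fourierInv_apply_eq_integral, fourierInv_apply_eq_integral, fourierInv_apply_eq_integral,
    integral_heis, ← integral_prod_mul, ← Measure.volume_eq_prod]
  congr 1; ext q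
  rw [h, WithLp.prod_inner_apply]
  rw [show inner ℝ (heisPt q.1 q.2).ofLp.1 (heisPt x t).ofLp.1 +
      inner ℝ (heisPt q.1 q.2).ofLp.2 (heisPt x t).ofLp.2 = inner ℝ q.1 x + inner ℝ q.2 t from rfl,
    mul_add, Complex.ofReal_add, add_mul, Complex.exp_add]
  simp only [heisPt, WithLp.toLp_fst, WithLp.toLp_snd]
  ring

theorem fourierInv_comp_inv_smul {A A' : 𝓢(Horiz n, ℂ)} {ε : ℝ} (hε : 0 < ε)
    (h : ∀ y, A' y = A (ε⁻¹ • y)) (x : Horiz n) :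
    𝓕⁻ A' x = ((ε ^ 2) ^ n : ℝ) * 𝓕⁻ A (ε • x) := by
  rw [fourierInv_apply_eq_integral, fourierInv_apply_eq_integral, ← Complex.real_smul,
    ← integral_comp_inv_smul_horiz hε]
  congr 1; ext y
  rw [h, inner_smul_left, inner_smul_right, conj_trivial, ← mul_assoc ε⁻¹,
    inv_mul_cancel₀ hε.ne', one_mul]

/-- The pairing of a density with a test function of the central variable. -/
noncomputable def verticalPairing (f : Heis n → ℂ) (β : ℝ → ℂ) (y : Horiz n) : ℂ :=
  ∫ s, f (heisPt y s) * β s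

theorem continuous_density_mul_central {f : Heis n → ℂ} (hf : ContinuousOn f {0}ᶜ)
    (hβ : Continuous β) (h0 : (0 : ℝ) ∉ tsupport β) :
    Continuous (fun q : Horiz n × ℝ => f (heisPt q.1 q.2) * β q.2) := by
  refine continuous_iff_continuousAt.2 fun q => ?_
  by_cases hq : q.2 = 0
  · refine (continuousAt_const (y := (0 : ℂ))).congr ?_
    have h2 : Tendsto (fun q : Horiz n × ℝ => q.2) (𝓝 q) (𝓝 0) := by
      rw [← hq]; exact continuous_snd.tendsto q
    filter_upwards [h2.eventually (notMem_tsupport_iff_eventuallyEq.1 h0)] with r hr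
    rw [hr, Pi.zero_apply, mul_zero]
  · refine ContinuousAt.mul ?_ (hβ.comp continuous_snd).continuousAt
    exact ContinuousAt.comp (f := fun q : Horiz n × ℝ => heisPt q.1 q.2) (g := f)
      (hf.continuousAt (isOpen_compl_singleton.mem_nhds (heisPt_ne_zero_of_snd q.1 hq)))
      heisPt_continuous.continuousAt

theorem continuous_verticalPairing {f : Heis n → ℂ} (hf : ContinuousOn f {0}ᶜ)
    (hβ : Continuous β) (hc : HasCompactSupport β) (h0 : (0 : ℝ) ∉ tsupport β) :
    Continuous (verticalPairing f β) := by
  have h := continuous_parametric_integral_of_continuous (μ := (volume : Measure ℝ))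
    (f := fun (y : Horiz n) (s : ℝ) => f (heisPt y s) * β s)
    (continuous_density_mul_central hf hβ h0) hc.isCompact
  refine h.congr fun y => ?_
  refine setIntegral_eq_integral_of_forall_compl_eq_zero fun s hs => ?_
  rw [image_eq_zero_of_notMem_tsupport hs, mul_zero]

theorem fst_two_pi_inv_smul (p : Heis n) :
    ((2 * Real.pi)⁻¹ • p).fst = (2 * Real.pi)⁻¹ • p.fst := rfl

theorem snd_two_pi_inv_smul (p : Heis n) :
    ((2 * Real.pi)⁻¹ • p).snd = (2 * Real.pi)⁻¹ * p.snd := rfl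

/-- The pairing of a symbol with the Fourier transforms of concentrating test functions, evaluated
on both sides of the Fourier transform. -/
theorem integral_verticalPairing_eq (hk : IsSymbol k) (A : 𝓢(Horiz n, ℂ))
    (hA : HasCompactSupport A) (hβ : ContDiff ℝ ∞ β) (hc : HasCompactSupport β)
    (h0 : (0 : ℝ) ∉ tsupport β) {ε : ℝ} (hε : 0 < ε) :
    (2 * Real.pi : ℂ) ^ (2 * n) *
        ∫ y, A y * verticalPairing (density k) β ((2 * Real.pi * ε) • y) =
      ∫ q : Horiz n × ℝ, density (fourierD k) (heisPt q.1 q.2) *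
        (𝓕⁻ A (ε • q.1) * centralInv hβ hc q.2) := by
  have hf := isDensityAwayZero_density hk.regular
  have hεi := inv_pos.2 hε
  have hac' : HasCompactSupport (fun y => A (ε⁻¹ • y)) :=
    hA.comp_homeomorph (Homeomorph.smulOfNeZero ε⁻¹ hεi.ne')
  have ha' : ContDiff ℝ ∞ (fun y => A (ε⁻¹ • y)) := (A.smooth ⊤).comp (contDiff_const_smul _)
  have hb0 : (0 : ℝ) ∉ tsupport (fun s => β (2 * Real.pi * s)) := by
    have : tsupport (fun s => β (2 * Real.pi * s)) =
        (fun s => 2 * Real.pi * s) ⁻¹' tsupport β :=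
      tsupport_comp_eq_preimage β (Homeomorph.mulLeft₀ (2 * Real.pi) Real.two_pi_pos.ne')
    rw [this]
    simpa using h0
  set A' : 𝓢(Horiz n, ℂ) := hac'.toSchwartzMap ha' with hA'
  set b : 𝓢(ℝ, ℂ) :=
    (hasCompactSupport_comp_two_pi hc).toSchwartzMap (contDiff_comp_two_pi hβ) with hb
  have hΦc := tensorFun_hasCompactSupport hac' (hasCompactSupport_comp_two_pi hc)
  have hΦs := tensorFun_contDiff ha' (contDiff_comp_two_pi hβ)
  set Φ : 𝓢(Heis n, ℂ) := hΦc.toSchwartzMap hΦs with hΦ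
  have hΦa : ∀ p, Φ p = A' p.fst * b p.snd := fun p => rfl
  -- The inverse transform of Φ need not vanish near 0 nor have compact support, so the absence of a
  -- point mass in k̂ is used here.
  have e1 := (density_fourierD_spec hk).eq_integral (isHomogeneousDist_fourierD hk.homogeneous)
    (𝓕⁻ Φ)
  have hpi : (2 * Real.pi)⁻¹ ≠ 0 := inv_ne_zero Real.two_pi_pos.ne'
  have hfun : ⇑(fourierS n (𝓕⁻ Φ)) = fun q => tensorFun (fun y => A (ε⁻¹ • y))
      (fun s => β (2 * Real.pi * s)) ((2 * Real.pi)⁻¹ • q) := by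
    ext q; rw [fourierS_fourierInv]; rfl
  -- On the side of k the test function is supported away from the origin, since β vanishes near 0;
  -- the density of k suffices.
  have e2 := hf.2 (fourierS n (𝓕⁻ Φ)) (by
      rw [hfun]
      exact hΦc.comp_homeomorph (Homeomorph.smulOfNeZero (2 * Real.pi)⁻¹ hpi)) (by
      rw [hfun]
      have : tsupport (fun q : Heis n => tensorFun (fun y => A (ε⁻¹ • y))
          (fun s => β (2 * Real.pi * s)) ((2 * Real.pi)⁻¹ • q)) =
          (fun q : Heis n => (2 * Real.pi)⁻¹ • q) ⁻¹' tsupport (tensorFun (fun y => A (ε⁻¹ • y))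
            (fun s => β (2 * Real.pi * s))) :=
        tsupport_comp_eq_preimage (tensorFun (fun y => A (ε⁻¹ • y))
          (fun s => β (2 * Real.pi * s))) (Homeomorph.smulOfNeZero (2 * Real.pi)⁻¹ hpi)
      rw [this]
      have h := zero_notMem_tsupport_tensorFun (n := n) (a := fun y => A (ε⁻¹ • y)) hb0
      simpa using h)
  rw [fourierD_apply, e2] at e1
  have hε2 : (((ε ^ 2) ^ n : ℝ) : ℂ) ≠ 0 := by
    exact_mod_cast (pow_pos (pow_pos hε 2) n).ne'
  have hfun2 : ∀ q : Horiz n × ℝ, density k (heisPt q.1 q.2) *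
      fourierS n (𝓕⁻ Φ) (heisPt q.1 q.2) =
      A ((2 * Real.pi * ε)⁻¹ • q.1) * (density k (heisPt q.1 q.2) * β q.2) := fun q => by
    rw [hfun]
    simp only [tensorFun, fst_two_pi_inv_smul, snd_two_pi_inv_smul, heisPt, WithLp.toLp_fst,
      WithLp.toLp_snd]
    rw [smul_smul, ← mul_inv, mul_comm ε, ← mul_assoc (2 * Real.pi),
      mul_inv_cancel₀ Real.two_pi_pos.ne', one_mul]
    ring
  have hpε : 0 < 2 * Real.pi * ε := by positivity
  have hL : ∫ p, density k p * fourierS n (𝓕⁻ Φ) p = (((2 * Real.pi * ε) ^ 2) ^ n : ℝ) *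
      ∫ y, A y * verticalPairing (density k) β ((2 * Real.pi * ε) • y) := by
    rw [integral_heis, integral_congr_ae (Eventually.of_forall hfun2), Measure.volume_eq_prod,
      integral_prod]
    · have := integral_comp_inv_smul_horiz hpε
        (fun y => A y * verticalPairing (density k) β ((2 * Real.pi * ε) • y))
      rw [Complex.real_smul] at this
      rw [← this]
      congr 1; ext y
      dsimp only
      rw [integral_const_mul, verticalPairing, smul_smul, mul_inv_cancel₀ hpε.ne', one_smul]
    · rw [← Measure.volume_eq_prod]
      refine Continuous.integrable_of_hasCompactSupport ?_ ?_
      · exact (A.continuous.comp (continuous_fst.const_smul (2 * Real.pi * ε)⁻¹)).mul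
          (continuous_density_mul_central hf.continuousOn hβ.continuous h0)
      · refine HasCompactSupport.of_support_subset_isCompact
          ((hA.comp_homeomorph (Homeomorph.smulOfNeZero (2 * Real.pi * ε)⁻¹
            (inv_ne_zero hpε.ne'))).isCompact.prod hc.isCompact) fun q hq => ?_
        refine ⟨subset_tsupport _ fun h => hq ?_, subset_tsupport _ fun h => hq ?_⟩
        · have h' : A ((2 * Real.pi * ε)⁻¹ • q.1) = 0 := h
          simp only [h', zero_mul]
        · simp only [h, mul_zero]
  have hR : ∫ p, density (fourierD k) p * 𝓕⁻ Φ p = (((ε ^ 2) ^ n : ℝ) : ℂ) *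
      ∫ q : Horiz n × ℝ, density (fourierD k) (heisPt q.1 q.2) *
        (𝓕⁻ A (ε • q.1) * centralInv hβ hc q.2) := by
    rw [integral_heis, ← integral_const_mul]
    congr 1; ext q
    rw [fourierInv_tensorFun hΦa, fourierInv_comp_inv_smul (A := A) hε fun y => rfl]
    rw [centralInv, ← hb]
    ring
  rw [hL, hR] at e1
  -- The scaling factor (2πε)^{2n} on one side and ε^{2n} on the other leave (2π)^{2n}.
  rw [← mul_right_inj' hε2, ← e1, ← mul_assoc]
  congr 1
  push_cast
  rw [← pow_mul, ← pow_mul, mul_pow (2 * (Real.pi : ℂ)), mul_comm]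

theorem integrable_density_mul_test (hk : IsSymbol k) (A : 𝓢(Horiz n, ℂ))
    {B : 𝓢(ℝ, ℂ)} : Integrable (fun q : Horiz n × ℝ =>
      density (fourierD k) (heisPt q.1 q.2) * (A q.1 * B q.2)) := by
  obtain ⟨M, hM0, hM⟩ := density_fourierD_bound hk
  refine Integrable.bdd_mul (c := M) (A.integrable.mul_prod B.integrable) ?_ ?_
  · exact (density_fourierD_spec hk).aestronglyMeasurable.comp_measurePreserving
      measurePreserving_heisPt
  · exact (measurePreserving_heisPt.quasiMeasurePreserving.ae ae_ne_zero_heis).mono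
      fun q hq => hM _ hq

/-- The singular part of the Fourier transform does not contribute. -/
theorem integral_density_mul_test (hn : 1 ≤ n) (hk : IsSymbol k) (hw : IsExpansion k w)
    (A : 𝓢(Horiz n, ℂ)) (hβ : ContDiff ℝ ∞ β) (hc : HasCompactSupport β)
    (h0 : (0 : ℝ) ∉ tsupport β) :
    ∫ q : Horiz n × ℝ, density (fourierD k) (heisPt q.1 q.2) * (A q.1 * centralInv hβ hc q.2) =
      ∫ q : Horiz n × ℝ, A q.1 * (profile k w q.1 q.2 * centralInv hβ hc q.2) := by
  set B := centralInv hβ hc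
  have hI1 := integrable_density_mul_test hk A (B := B)
  have hI2 : Integrable (fun q : Horiz n × ℝ => A q.1 * (profile k w q.1 q.2 * B q.2)) :=
    (integrable_profile_mul hn hk hw B).bdd_mul
      (A.continuous.comp continuous_fst).aestronglyMeasurable
      (Eventually.of_forall fun q => SchwartzMap.norm_le_seminorm ℂ A q.1)
  rw [← sub_eq_zero, ← integral_sub hI1 hI2]
  have hI3 := hI1.sub hI2
  rw [Measure.volume_eq_prod] at hI3 ⊢
  -- The t-integral is the inner one. At fixed x the difference is a polynomial in t times B, which
  -- integrates to zero by the vanishing moments; the individual terms need not be integrable in x.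
  have h1 := integral_prod _ hI3
  simp only [Pi.sub_apply] at h1
  rw [h1]
  refine integral_eq_zero_of_ae (Eventually.of_forall fun x => ?_)
  simp only [Pi.zero_apply]
  have hB := integrable_ofReal_pow_mul B
  have h2 : ∀ t : ℝ, density (fourierD k) (heisPt x t) * (A x * B t) -
      A x * (profile k w x t * B t) = A x * ((∑ l ∈ Finset.range n, w l x * ((t : ℂ) ^ l * B t)) +
        {x | 1 ≤ ‖x‖}.indicator (w n) x * ((t : ℂ) ^ n * B t)) := fun t => by
    simp_rw [← mul_assoc (w _ x)]
    rw [← Finset.sum_mul, profile]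
    ring
  simp_rw [h2]
  rw [integral_const_mul, integral_add (integrable_finsetSum _ fun l _ => (hB l).const_mul _)
    ((hB n).const_mul _), integral_finsetSum _ fun l _ => (hB l).const_mul _, integral_const_mul]
  simp_rw [integral_const_mul]
  rw [Finset.sum_eq_zero fun l _ => by rw [integral_pow_mul_centralInv hβ hc h0, mul_zero],
    integral_pow_mul_centralInv hβ hc h0]
  simp

/-- As ε tends to 0 the left side of `integral_verticalPairing_eq` concentrates at y = 0 and 𝓕⁻
A(εx) tends to 𝓕⁻ A(0). Dominated convergence is available only after k̂ has been replaced by the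
profile. The common factor ∫ A = 𝓕⁻ A(0) ≠ 0 is divided out. -/
theorem two_pi_pow_mul_verticalPairing (hn : 1 ≤ n) (hk : IsSymbol k) (hw : IsExpansion k w)
    (hβ : ContDiff ℝ ∞ β) (hc : HasCompactSupport β) (h0 : (0 : ℝ) ∉ tsupport β) :
    (2 * Real.pi : ℂ) ^ (2 * n) * verticalPairing (density k) β 0 =
      ∫ t, (∫ x, profile k w x t) * centralInv hβ hc t := by
  set B := centralInv hβ hc with hBdef
  set bump : ContDiffBump (0 : Horiz n) := ⟨1, 2, one_pos, one_lt_two⟩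
  have hbc : HasCompactSupport (fun y => ((bump y : ℝ) : ℂ)) :=
    bump.hasCompactSupport.comp_left (g := fun t : ℝ => (t : ℂ)) (by simp)
  set A : 𝓢(Horiz n, ℂ) := hbc.toSchwartzMap (Complex.ofRealCLM.contDiff.comp bump.contDiff)
  have hAc : HasCompactSupport A := hbc
  have hAne : ∫ y, A y ≠ 0 := by
    have h1 : ∫ y, A y = ((∫ y, bump y : ℝ) : ℂ) := integral_complex_ofReal
    rw [h1]
    exact_mod_cast (bump.integral_pos (μ := volume)).ne'
  have hJ := continuous_verticalPairing (isDensityAwayZero_density hk.regular).continuousOn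
    hβ.continuous hc h0
  have hlim1 : Tendsto (fun ε : ℝ => (2 * Real.pi : ℂ) ^ (2 * n) *
      ∫ y, A y * verticalPairing (density k) β ((2 * Real.pi * ε) • y)) (𝓝[>] 0)
      (𝓝 ((2 * Real.pi : ℂ) ^ (2 * n) * ((∫ y, A y) * verticalPairing (density k) β 0))) := by
    have hcont : Continuous fun ε : ℝ => ∫ y in tsupport A,
        A y * verticalPairing (density k) β ((2 * Real.pi * ε) • y) := by
      refine continuous_parametric_integral_of_continuous (μ := (volume : Measure (Horiz n)))
        (f := fun (ε : ℝ) y => A y * verticalPairing (density k) β ((2 * Real.pi * ε) • y)) ?_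
        hAc.isCompact
      exact (A.continuous.comp continuous_snd).mul (hJ.comp (by fun_prop))
    have hcont' : Continuous fun ε : ℝ => ∫ y,
        A y * verticalPairing (density k) β ((2 * Real.pi * ε) • y) :=
      hcont.congr fun ε => setIntegral_eq_integral_of_forall_compl_eq_zero fun y hy => by
        rw [image_eq_zero_of_notMem_tsupport hy, zero_mul]
    have h := (hcont'.tendsto 0).mono_left (nhdsWithin_le_nhds (s := Set.Ioi 0))
    simp only [mul_zero, zero_smul] at h
    rw [integral_mul_const] at h
    exact h.const_mul _
  have hlim2 : Tendsto (fun ε : ℝ => ∫ q : Horiz n × ℝ, 𝓕⁻ A (ε • q.1) *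
      (profile k w q.1 q.2 * B q.2)) (𝓝[>] 0)
      (𝓝 (∫ q : Horiz n × ℝ, 𝓕⁻ A 0 * (profile k w q.1 q.2 * B q.2))) := by
    have hI := integrable_profile_mul hn hk hw B
    refine tendsto_integral_filter_of_dominated_convergence
      (fun q => SchwartzMap.seminorm ℂ 0 0 (𝓕⁻ A) * ‖profile k w q.1 q.2 * B q.2‖)
      (Eventually.of_forall fun ε => ?_) (Eventually.of_forall fun ε => ?_)
      (hI.norm.const_mul _) ?_
    · exact ((𝓕⁻ A).continuous.comp (continuous_fst.const_smul ε)).aestronglyMeasurable.mul hI.1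
    · refine Eventually.of_forall fun q => ?_
      rw [norm_mul]
      gcongr
      exact SchwartzMap.norm_le_seminorm ℂ _ _
    · refine Eventually.of_forall fun q => Tendsto.mul_const _ ?_
      have h : Continuous fun ε : ℝ => 𝓕⁻ A (ε • q.1) :=
        (𝓕⁻ A).continuous.comp (continuous_id.smul continuous_const)
      have h' := (h.tendsto 0).mono_left (nhdsWithin_le_nhds (s := Set.Ioi 0))
      rwa [zero_smul] at h'
  have heq : ∀ᶠ ε : ℝ in 𝓝[>] 0, (2 * Real.pi : ℂ) ^ (2 * n) *
      ∫ y, A y * verticalPairing (density k) β ((2 * Real.pi * ε) • y) =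
      ∫ q : Horiz n × ℝ, 𝓕⁻ A (ε • q.1) * (profile k w q.1 q.2 * B q.2) := by
    filter_upwards [self_mem_nhdsWithin] with ε hε
    have hε' : (0 : ℝ) < ε := hε
    rw [integral_verticalPairing_eq hk A hAc hβ hc h0 hε']
    exact integral_density_mul_test hn hk hw (SchwartzMap.compCLMOfContinuousLinearEquiv ℂ
      (ContinuousLinearEquiv.smulLeft (Units.mk0 ε hε'.ne') : Horiz n ≃L[ℝ] Horiz n) (𝓕⁻ A))
      hβ hc h0
  have key := tendsto_nhds_unique (hlim1.congr' heq) hlim2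
  have hA0 : 𝓕⁻ A 0 = ∫ y, A y := by
    rw [fourierInv_apply_eq_integral]; simp
  have hI := integrable_profile_mul hn hk hw B
  rw [integral_const_mul, hA0, Measure.volume_eq_prod, integral_prod_symm _
    (by rwa [← Measure.volume_eq_prod])] at key
  simp_rw [integral_mul_const] at key
  rw [← mul_right_inj' hAne, ← key]
  ring

end Pairing

/-! ### Laplace transforms of t^n (A - c log t) and their boundary values. -/

section Laplace

/-- The Laplace transform on the half line. -/
noncomputable def laplace (p : ℝ → ℂ) (z : ℂ) : ℂ :=
  ∫ t in Set.Ioi (0 : ℝ), p t * Complex.exp (-(z * t))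

variable {p : ℝ → ℂ} {D : ℝ} {m : ℕ}

theorem integrableOn_pow_mul_exp_neg_mul (m : ℕ) {η : ℝ} (hη : 0 < η) :
    IntegrableOn (fun t : ℝ => t ^ m * Real.exp (-(η * t))) (Set.Ioi 0) := by
  have h := integrableOn_rpow_mul_exp_neg_mul_rpow (p := 1) (s := m) (b := η)
    (by have : (0:ℝ) ≤ m := by positivity
        linarith) one_pos hη
  refine h.congr_fun (fun t _ => ?_) measurableSet_Ioi
  simp

theorem norm_cexp_neg_mul_ofReal (z : ℂ) (t : ℝ) :
    ‖Complex.exp (-(z * t))‖ = Real.exp (-(z.re * t)) := by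
  rw [Complex.norm_exp]; simp

theorem integrableOn_laplace_of_bound (hp : Measurable p)
    (hb : ∀ t, 0 < t → ‖p t‖ ≤ D * (1 + t ^ m)) {z : ℂ} (hz : 0 < z.re) :
    IntegrableOn (fun t : ℝ => p t * Complex.exp (-(z * t))) (Set.Ioi 0) := by
  have h0 := integrableOn_pow_mul_exp_neg_mul 0 hz
  have hm := integrableOn_pow_mul_exp_neg_mul m hz
  refine ((h0.add hm).const_mul D).mono' (by fun_prop) ?_
  refine (ae_restrict_iff' measurableSet_Ioi).2 (Eventually.of_forall fun t ht => ?_)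
  rw [norm_mul, norm_cexp_neg_mul_ofReal]
  calc ‖p t‖ * Real.exp (-(z.re * t)) ≤ D * (1 + t ^ m) * Real.exp (-(z.re * t)) := by
        gcongr; exact hb t ht
    _ = _ := by simp; ring

theorem differentiableOn_laplace (hp : Measurable p)
    (hb : ∀ t, 0 < t → ‖p t‖ ≤ D * (1 + t ^ m)) :
    DifferentiableOn ℂ (laplace p) {z | 0 < z.re} := by
  intro z hz
  have hz' : 0 < z.re := hz
  -- On the disc of this radius around z real parts stay above η, which gives one integrable
  -- majorant for the differentiated integrand.
  set η := z.re / 2 with hη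
  have hη0 : 0 < η := by positivity
  have hre : ∀ w ∈ Metric.ball z η, η < w.re := fun w hw => by
    have h1 : |(w - z).re| ≤ ‖w - z‖ := Complex.abs_re_le_norm _
    rw [Metric.mem_ball, dist_eq_norm] at hw
    have h2 := (abs_lt.1 (h1.trans_lt hw)).1
    rw [Complex.sub_re] at h2
    linarith
  refine (HasDerivAt.differentiableAt (hasDerivAt_integral_of_dominated_loc_of_deriv_le
    (μ := volume.restrict (Set.Ioi (0 : ℝ)))
    (F := fun w (t : ℝ) => p t * Complex.exp (-(w * t)))
    (F' := fun w (t : ℝ) => p t * (Complex.exp (-(w * t)) * (-(t : ℂ))))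
    (bound := fun t => D * (t ^ 1 * Real.exp (-(η * t)) + t ^ (m + 1) * Real.exp (-(η * t))))
    (Metric.ball_mem_nhds z hη0) (Eventually.of_forall fun w => by fun_prop)
    (integrableOn_laplace_of_bound hp hb hz') (by fun_prop) ?_
    (((integrableOn_pow_mul_exp_neg_mul 1 hη0).add
      (integrableOn_pow_mul_exp_neg_mul (m + 1) hη0)).const_mul D) ?_).2).differentiableWithinAt
  · refine (ae_restrict_iff' measurableSet_Ioi).2 (Eventually.of_forall fun t ht w hw => ?_)
    have ht0 : (0 : ℝ) < t := ht
    rw [norm_mul, norm_mul, norm_cexp_neg_mul_ofReal, norm_neg, Complex.norm_real,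
      Real.norm_of_nonneg ht0.le]
    calc ‖p t‖ * (Real.exp (-(w.re * t)) * t) ≤
          D * (1 + t ^ m) * (Real.exp (-(η * t)) * t) := by
          have := hre w hw
          have h3 := hb t ht0
          have h4 : 0 ≤ D * (1 + t ^ m) := (norm_nonneg _).trans h3
          gcongr
      _ = _ := by ring
  · refine Eventually.of_forall fun t w _ => ?_
    have h : HasDerivAt (fun w : ℂ => -(w * t)) (-(t : ℂ)) w := by
      have h := ((hasDerivAt_id w).mul_const (t : ℂ)).neg
      rw [one_mul] at h
      exact h
    exact h.cexp.const_mul _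

/-- Pairing with a Fourier integral of a test function vanishing near zero is pairing the test
function with the boundary values of the Laplace transform. -/
theorem integral_Ioi_mul_fourier_eq (hp : Measurable p)
    (hb : ∀ t, 0 < t → ‖p t‖ ≤ D * (1 + t ^ m)) {F : ℂ → ℂ}
    (hF : ContinuousOn F Complex.slitPlane) (hpF : ∀ z : ℂ, 0 < z.re → laplace p z = F z)
    {b : ℝ → ℂ} (hbc : Continuous b) (hbs : HasCompactSupport b) (hb0 : (0 : ℝ) ∉ tsupport b)
    {κ : ℝ} (hκ : κ ≠ 0) {B : ℝ → ℂ} (hBc : Measurable B)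
    (hB : ∀ t, B t = ∫ s, Complex.exp (((κ * (t * s) : ℝ) : ℂ) * Complex.I) * b s)
    (hpB : IntegrableOn (fun t => p t * B t) (Set.Ioi 0)) :
    ∫ t in Set.Ioi (0 : ℝ), p t * B t = ∫ s, b s * F (-(Complex.I * (κ * s : ℝ))) := by
  -- The damping e^{-ηt} makes Fubini legitimate. The inner integral is then the Laplace transform
  -- at η - iκs, which tends to the boundary value F(-iκs) because s stays away from 0 on the
  -- support of b.
  have hlim1 : Tendsto (fun η : ℝ => ∫ t in Set.Ioi (0 : ℝ), Real.exp (-(η * t)) • (p t * B t))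
      (𝓝[>] 0) (𝓝 (∫ t in Set.Ioi (0 : ℝ), p t * B t)) := by
    refine tendsto_integral_filter_of_dominated_convergence (fun t => ‖p t * B t‖)
      (Eventually.of_forall fun η => by fun_prop) ?_ hpB.norm ?_
    · filter_upwards [self_mem_nhdsWithin] with η hη
      refine (ae_restrict_iff' measurableSet_Ioi).2 (Eventually.of_forall fun t ht => ?_)
      rw [norm_smul, Real.norm_of_nonneg (Real.exp_pos _).le]
      refine mul_le_of_le_one_left (norm_nonneg _) (Real.exp_le_one_iff.2 ?_)
      exact neg_nonpos.2 (mul_nonneg (le_of_lt hη) (le_of_lt ht))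
    · refine Eventually.of_forall fun t => ?_
      have h : Continuous fun η : ℝ => Real.exp (-(η * t)) • (p t * B t) := by fun_prop
      have h' := (h.tendsto 0).mono_left (nhdsWithin_le_nhds (s := Set.Ioi 0))
      simpa using h'
  have hlim2 : Tendsto (fun η : ℝ => ∫ s, b s * F ((|η| : ℝ) - Complex.I * (κ * s : ℝ)))
      (𝓝[>] 0) (𝓝 (∫ s, b s * F (-(Complex.I * (κ * s : ℝ))))) := by
    have hG : Continuous fun q : ℝ × ℝ => b q.2 * F ((|q.1| : ℝ) - Complex.I * (κ * q.2 : ℝ)) := by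
      refine continuous_iff_continuousAt.2 fun q => ?_
      by_cases hq : q.2 ∈ tsupport b
      · have hq0 : q.2 ≠ 0 := fun h => hb0 (h ▸ hq)
        have hmem : ((|q.1| : ℝ) - Complex.I * (κ * q.2 : ℝ) : ℂ) ∈ Complex.slitPlane := by
          refine Complex.mem_slitPlane_iff.2 (Or.inr ?_)
          simp [hκ, hq0]
        refine ContinuousAt.mul (hbc.comp continuous_snd).continuousAt ?_
        refine ContinuousAt.comp (f := fun q : ℝ × ℝ =>
          ((|q.1| : ℝ) - Complex.I * (κ * q.2 : ℝ) : ℂ)) (g := F)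
          (hF.continuousAt (Complex.isOpen_slitPlane.mem_nhds hmem)) ?_
        exact Continuous.continuousAt (by fun_prop)
      · have h : ∀ᶠ q' : ℝ × ℝ in 𝓝 q, b q'.2 = 0 :=
          continuous_snd.continuousAt.eventually (notMem_tsupport_iff_eventuallyEq.1 hq)
        refine (continuousAt_const (y := (0 : ℂ))).congr (h.mono fun q' hq' => ?_)
        simp [hq']
    have hcont : Continuous fun η : ℝ => ∫ s in tsupport b,
        b s * F ((|η| : ℝ) - Complex.I * (κ * s : ℝ)) :=
      continuous_parametric_integral_of_continuous hG hbs.isCompact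
    have hcont' : Continuous fun η : ℝ => ∫ s,
        b s * F ((|η| : ℝ) - Complex.I * (κ * s : ℝ)) :=
      hcont.congr fun η => setIntegral_eq_integral_of_forall_compl_eq_zero fun s hs => by
        rw [image_eq_zero_of_notMem_tsupport hs, zero_mul]
    have h := (hcont'.tendsto 0).mono_left (nhdsWithin_le_nhds (s := Set.Ioi 0))
    simpa using h
  refine tendsto_nhds_unique (hlim1.congr' ?_) hlim2
  filter_upwards [self_mem_nhdsWithin] with η hη
  have hη0 : (0 : ℝ) < η := hη
  have hbi : Integrable b := hbc.integrable_of_hasCompactSupport hbs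
  have hint : Integrable (fun q : ℝ × ℝ => (p q.1 * Complex.exp (-((η : ℂ) * q.1))) *
      (Complex.exp (((κ * (q.1 * q.2) : ℝ) : ℂ) * Complex.I) * b q.2))
      ((volume.restrict (Set.Ioi (0 : ℝ))).prod volume) := by
    refine ((integrableOn_laplace_of_bound hp hb (z := (η : ℂ)) (by simpa)).mul_prod hbi).mono
      (by fun_prop) (Eventually.of_forall fun q => ?_)
    rw [norm_mul, norm_mul (Complex.exp _) (b _), Complex.norm_exp_ofReal_mul_I, one_mul,
      norm_mul (p _ * _)]
  calc ∫ t in Set.Ioi (0 : ℝ), Real.exp (-(η * t)) • (p t * B t)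
      = ∫ t in Set.Ioi (0 : ℝ), ∫ s, (p t * Complex.exp (-((η : ℂ) * t))) *
          (Complex.exp (((κ * (t * s) : ℝ) : ℂ) * Complex.I) * b s) := by
        refine integral_congr_ae (Eventually.of_forall fun t => ?_)
        simp only []
        rw [integral_const_mul, ← hB, Complex.real_smul]
        push_cast
        ring
    _ = ∫ s, ∫ t in Set.Ioi (0 : ℝ), (p t * Complex.exp (-((η : ℂ) * t))) *
          (Complex.exp (((κ * (t * s) : ℝ) : ℂ) * Complex.I) * b s) := integral_integral_swap hint
    _ = _ := by
        refine integral_congr_ae (Eventually.of_forall fun s => ?_)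
        simp only [abs_of_pos hη0]
        rw [← hpF _ (by simpa), laplace, ← integral_const_mul]
        refine integral_congr_ae (Eventually.of_forall fun t => ?_)
        simp only []
        rw [show -(((η : ℂ) - Complex.I * (κ * s : ℝ)) * t) = -((η : ℂ) * t) +
          ((κ * (t * s) : ℝ) : ℂ) * Complex.I by push_cast; ring, Complex.exp_add]
        ring

/-- The homogeneous model `t ^ n * (A - c * log t)` on the half line. -/
noncomputable def powLog (n : ℕ) (A c : ℂ) (t : ℝ) : ℂ := (t : ℂ) ^ n * (A - c * Real.log t)

theorem measurable_powLog (n : ℕ) (A c : ℂ) : Measurable (powLog n A c) := by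
  unfold powLog
  have := Real.measurable_log
  fun_prop

theorem norm_powLog_le {n : ℕ} (hn : 1 ≤ n) (A c : ℂ) {t : ℝ} (ht : 0 < t) :
    ‖powLog n A c t‖ ≤ (‖A‖ + ‖c‖) * (1 + t ^ (n + 1)) := by
  have h1 := pow_mul_abs_log_le hn ht.ne'
  rw [abs_of_pos ht] at h1
  have h2 : t ^ n ≤ 1 + t ^ (n + 1) := by
    rcases le_total t 1 with h | h
    · exact (pow_le_one₀ ht.le h).trans (le_add_of_nonneg_right (by positivity))
    · exact (pow_le_pow_right₀ h n.le_succ).trans (le_add_of_nonneg_left zero_le_one)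
  calc ‖powLog n A c t‖ ≤ t ^ n * (‖A‖ + ‖c‖ * |Real.log t|) := by
        rw [powLog, norm_mul, norm_pow, Complex.norm_real, Real.norm_of_nonneg ht.le]
        gcongr
        refine (norm_sub_le _ _).trans_eq ?_
        rw [norm_mul, Complex.norm_real, Real.norm_eq_abs]
    _ = ‖A‖ * t ^ n + ‖c‖ * (t ^ n * |Real.log t|) := by ring
    _ ≤ ‖A‖ * (1 + t ^ (n + 1)) + ‖c‖ * (1 + t ^ (n + 1)) := by gcongr
    _ = _ := by ring

theorem integral_pow_mul_cexp_neg (n : ℕ) :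
    ∫ t in Set.Ioi (0 : ℝ), (t : ℂ) ^ n * Complex.exp (-(t : ℂ)) = n.factorial := by
  rw [← Complex.Gamma_nat_eq_factorial, Complex.Gamma_eq_integral (by simp; positivity),
    Complex.GammaIntegral]
  refine setIntegral_congr_fun measurableSet_Ioi fun t _ => ?_
  simp [mul_comm]

/-- The remaining value on the right does not depend on A or c. It is never evaluated, since it
cancels between the two half lines. -/
theorem laplace_powLog_one {n : ℕ} (hn : 1 ≤ n) (A c : ℂ) :
    laplace (powLog n A c) 1 = A * n.factorial + c * laplace (powLog n 0 1) 1 := by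
  have h1 := integrableOn_laplace_of_bound (measurable_powLog n 1 0)
    (fun t ht => norm_powLog_le hn 1 0 ht) (z := 1) (by simp)
  have h2 := integrableOn_laplace_of_bound (measurable_powLog n 0 1)
    (fun t ht => norm_powLog_le hn 0 1 ht) (z := 1) (by simp)
  rw [← integral_pow_mul_cexp_neg, laplace, laplace, ← integral_const_mul, ← integral_const_mul,
    ← integral_add]
  · refine integral_congr_ae (Eventually.of_forall fun t => ?_)
    simp only [powLog, one_mul]
    ring
  · refine (h1.const_mul A).congr (Eventually.of_forall fun t => ?_)
    simp [powLog]
  · exact h2.const_mul c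

theorem laplace_powLog_ofReal {n : ℕ} (hn : 1 ≤ n) (A c : ℂ) {r : ℝ} (hr : 0 < r) :
    laplace (powLog n A c) r = ((r : ℂ) ^ (n + 1))⁻¹ *
      (laplace (powLog n A c) 1 + c * n.factorial * Complex.log r) := by
  have hr' : (r : ℂ) ≠ 0 := by exact_mod_cast hr.ne'
  have h1 := integrableOn_laplace_of_bound (measurable_powLog n A c)
    (fun t ht => norm_powLog_le hn A c ht) (z := 1) (by simp)
  have h2 := integrableOn_laplace_of_bound (measurable_powLog n 1 0)
    (fun t ht => norm_powLog_le hn 1 0 ht) (z := 1) (by simp)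
  -- The substitution u = rt shifts log t by log r; the added multiple of t^n compensates for this
  -- shift.
  have h3 := integral_comp_mul_left_Ioi (fun u : ℝ =>
    powLog n A c u * Complex.exp (-(1 * u)) + c * Complex.log r *
      (powLog n 1 0 u * Complex.exp (-(1 * u)))) 0 hr
  rw [mul_zero, integral_add h1 (h2.const_mul _), integral_const_mul] at h3
  have h4 : ∫ t in Set.Ioi (0 : ℝ), powLog n 1 0 t * Complex.exp (-(1 * t)) = n.factorial := by
    rw [← integral_pow_mul_cexp_neg]
    simp [powLog]
  rw [h4] at h3
  have h5 : ∫ t in Set.Ioi (0 : ℝ), (powLog n A c (r * t) * Complex.exp (-(1 * (r * t : ℝ))) +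
      c * Complex.log r * (powLog n 1 0 (r * t) * Complex.exp (-(1 * (r * t : ℝ))))) =
      (r : ℂ) ^ n * laplace (powLog n A c) r := by
    rw [laplace, ← integral_const_mul]
    refine setIntegral_congr_fun measurableSet_Ioi fun t ht => ?_
    have ht0 : (0 : ℝ) < t := ht
    simp only [powLog, Real.log_mul hr.ne' ht0.ne', ← Complex.ofReal_log hr.le]
    push_cast
    ring_nf
  rw [h5, Complex.real_smul] at h3
  rw [← mul_right_inj' (pow_ne_zero n hr'), h3, pow_succ, laplace]
  push_cast
  field_simp

theorem continuousOn_inv_pow_mul_log (m : ℕ) (a c : ℂ) :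
    ContinuousOn (fun z : ℂ => (z ^ m)⁻¹ * (a + c * Complex.log z)) Complex.slitPlane := fun _ hz =>
  ((((continuousAt_id.pow m).inv₀ (pow_ne_zero _ (Complex.slitPlane_ne_zero hz))).mul
    (continuousAt_const.add (continuousAt_const.mul
      (continuousAt_clog hz)))).continuousWithinAt)

/-- Both sides are holomorphic on the right half plane and agree at positive reals, which accumulate
at 1. The identity theorem extends the equality. -/
theorem laplace_powLog {n : ℕ} (hn : 1 ≤ n) (A c : ℂ) {z : ℂ} (hz : 0 < z.re) :
    laplace (powLog n A c) z = (z ^ (n + 1))⁻¹ *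
      (laplace (powLog n A c) 1 + c * n.factorial * Complex.log z) := by
  have hopen : IsOpen {z : ℂ | 0 < z.re} := isOpen_lt continuous_const Complex.continuous_re
  have h1 := (differentiableOn_laplace (measurable_powLog n A c)
    (fun t ht => norm_powLog_le hn A c ht)).analyticOnNhd hopen
  have h2 : DifferentiableOn ℂ (fun z : ℂ => (z ^ (n + 1))⁻¹ *
      (laplace (powLog n A c) 1 + c * n.factorial * Complex.log z)) {z : ℂ | 0 < z.re} := by
    intro z hz
    have hs : z ∈ Complex.slitPlane := Complex.mem_slitPlane_iff.2 (Or.inl hz)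
    exact (((differentiableAt_id.pow _).inv (pow_ne_zero _ (Complex.slitPlane_ne_zero hs))).mul
      (((Complex.differentiableAt_log hs).const_mul _).const_add _)).differentiableWithinAt
  refine h1.eqOn_of_preconnected_of_frequently_eq (h2.analyticOnNhd hopen)
    (convex_halfSpace_re_gt 0).isPreconnected (z₀ := 1) (by simp) ?_ hz
  have ht : Tendsto (fun r : ℝ => (r : ℂ)) (𝓝[≠] 1) (𝓝[≠] 1) := by
    refine tendsto_nhdsWithin_iff.2 ⟨?_, ?_⟩
    · have h := (Complex.continuous_ofReal.tendsto 1).mono_left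
        (nhdsWithin_le_nhds (s := ({1}ᶜ : Set ℝ)))
      simpa using h
    · filter_upwards [self_mem_nhdsWithin] with r hr
      simpa using hr
  refine ht.frequently (Eventually.frequently ?_)
  filter_upwards [nhdsWithin_le_nhds (lt_mem_nhds (zero_lt_one (α := ℝ)))] with r hr
  exact laplace_powLog_ofReal hn A c hr

end Laplace

/-! ### The density of k on the centre. -/

section Center

variable {n : ℕ} {k : 𝓢'(Heis n, ℂ)} {w : ℕ → Horiz n → ℂ} {β : ℝ → ℂ}

/-- The scale is s = √t, and log √t = (log t)/2 accounts for the coefficient C/2 of the logarithm.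
-/
theorem integral_profile_pos (hn : 1 ≤ n) (hk : IsSymbol k) (hw : IsExpansion k w) {t : ℝ}
    (ht : 0 < t) : ∫ x, profile k w x t =
      powLog n (∫ x, profile k w x 1) (sphereIntegral (w n) / 2) t := by
  have h1 : √t ^ 2 = t := Real.sq_sqrt ht.le
  rw [(integral_profile hn hk hw (Real.sqrt_pos.2 ht) (Or.inl rfl) (by rw [h1, mul_one])).2.1, h1,
    Real.log_sqrt ht.le, powLog]
  push_cast
  ring

theorem integral_profile_neg (hn : 1 ≤ n) (hk : IsSymbol k) (hw : IsExpansion k w) {t : ℝ}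
    (ht : 0 < t) : ∫ x, profile k w x (-t) =
      powLog n (∫ x, profile k w x (-1)) ((-1) ^ n * (sphereIntegral (w n) / 2)) t := by
  have h1 : √t ^ 2 = t := Real.sq_sqrt ht.le
  rw [(integral_profile hn hk hw (Real.sqrt_pos.2 ht) (Or.inr rfl) (by rw [h1]; ring)).2.1, h1,
    Real.log_sqrt ht.le, powLog, Complex.ofReal_neg, neg_pow (t : ℂ)]
  push_cast
  ring

theorem integrableOn_powLog_mul (hn : 1 ≤ n) (A c : ℂ) (B : 𝓢(ℝ, ℂ)) {ε : ℝ}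
    (hε : ε = 1 ∨ ε = -1) : IntegrableOn (fun t => powLog n A c t * B (ε * t)) (Set.Ioi 0) := by
  have h0 := integrable_pow_abs_mul_norm B 0
  have h1 := integrable_pow_abs_mul_norm B (n + 1)
  have hI := ((h0.add h1).comp_mul_left' (R := ε)
    (by rcases hε with rfl | rfl <;> norm_num)).const_mul (‖A‖ + ‖c‖)
  have hm := measurable_powLog n A c
  have hB : Measurable fun t => B (ε * t) := (B.continuous.comp (by fun_prop)).measurable
  refine hI.integrableOn.mono' (by fun_prop) ?_
  refine (ae_restrict_iff' measurableSet_Ioi).2 (Eventually.of_forall fun t ht => ?_)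
  have ht0 : (0 : ℝ) < t := ht
  have habs : |ε * t| = t := by
    rcases hε with rfl | rfl <;> simp [abs_of_pos ht0]
  rw [norm_mul]
  refine (mul_le_mul_of_nonneg_right (norm_powLog_le hn A c ht0) (norm_nonneg _)).trans_eq ?_
  simp only [Pi.add_apply, habs]
  ring

/-- The boundary value `z ↦ z^{-n-1}(M + c n! log z)` of the Laplace transform of `powLog n A c`. -/
noncomputable def powLogTransform (n : ℕ) (A c z : ℂ) : ℂ :=
  (z ^ (n + 1))⁻¹ * (laplace (powLog n A c) 1 + c * n.factorial * Complex.log z)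

theorem integral_powLog_mul_centralInv (hn : 1 ≤ n) (A c : ℂ) (hβ : ContDiff ℝ ∞ β)
    (hc : HasCompactSupport β) (h0 : (0 : ℝ) ∉ tsupport β) {ε : ℝ} (hε : ε = 1 ∨ ε = -1) :
    ∫ t in Set.Ioi (0 : ℝ), powLog n A c t * centralInv hβ hc (ε * t) =
      ∫ s, β (2 * Real.pi * s) *
        powLogTransform n A c (-(Complex.I * (ε * (2 * Real.pi * s) : ℝ))) := by
  have hb0 : (0 : ℝ) ∉ tsupport fun s => β (2 * Real.pi * s) := by
    rw [notMem_tsupport_iff_eventuallyEq] at h0 ⊢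
    have h : Continuous fun s : ℝ => 2 * Real.pi * s := by fun_prop
    have h' := h.tendsto 0
    rw [mul_zero] at h'
    exact h'.eventually h0
  have hmeas : Measurable fun t => centralInv hβ hc (ε * t) :=
    ((centralInv hβ hc).continuous.comp (by fun_prop)).measurable
  have key := integral_Ioi_mul_fourier_eq (measurable_powLog n A c)
    (fun t ht => norm_powLog_le hn A c ht) (F := powLogTransform n A c)
    (continuousOn_inv_pow_mul_log (n + 1) _ (c * n.factorial))
    (fun z hz => laplace_powLog hn A c hz) (contDiff_comp_two_pi hβ).continuous
    (hasCompactSupport_comp_two_pi hc) hb0 (κ := ε * (2 * Real.pi))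
    (mul_ne_zero (by rcases hε with rfl | rfl <;> norm_num) Real.two_pi_pos.ne')
    hmeas (fun t => ?_) (integrableOn_powLog_mul hn A c _ hε)
  · rw [key]
    simp only [mul_assoc]
  · rw [centralInv_apply]
    refine integral_congr_ae (Eventually.of_forall fun s => ?_)
    simp only []
    congr 4
    ring

/-- The density of a symbol on the centre, up to the factor `(2π)^{2n+1}`. -/
noncomputable def centralDensity (n : ℕ) (R C : ℂ) (s : ℝ) : ℂ :=
  n.factorial * ((-(Complex.I * s)) ^ (n + 1))⁻¹ *
    (R - Complex.I * Real.pi / 2 * C * (SignType.sign s : ℝ))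

/-- The two boundary points have equal modulus and arguments ∓π/2 according to the sign of s, so
only the jump of the argument remains. -/
theorem log_neg_I_mul_sub_log {s : ℝ} (hs : s ≠ 0) :
    Complex.log (-(Complex.I * s)) - Complex.log (Complex.I * s) =
      -(Complex.I * Real.pi * (SignType.sign s : ℝ)) := by
  rcases lt_or_gt_of_ne hs with h | h
  · have h1 : -(Complex.I * s) = ((-s : ℝ) : ℂ) * Complex.I := by push_cast; ring
    have h2 : Complex.I * s = ((-s : ℝ) : ℂ) * (-Complex.I) := by push_cast; ring
    have h3 : 0 < -s := neg_pos.2 h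
    rw [h1, h2, Complex.log_ofReal_mul h3 Complex.I_ne_zero,
      Complex.log_ofReal_mul h3 (neg_ne_zero.2 Complex.I_ne_zero), Complex.log_I,
      Complex.log_neg_I, sign_neg h]
    simp only [SignType.coe_neg_one, Complex.ofReal_neg, Complex.ofReal_one]
    ring
  · have h1 : -(Complex.I * s) = (s : ℂ) * (-Complex.I) := by ring
    have h2 : Complex.I * s = (s : ℂ) * Complex.I := by ring
    rw [h1, h2, Complex.log_ofReal_mul h Complex.I_ne_zero,
      Complex.log_ofReal_mul h (neg_ne_zero.2 Complex.I_ne_zero), Complex.log_I,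
      Complex.log_neg_I, sign_pos h]
    simp only [SignType.coe_one, Complex.ofReal_one]
    ring

/-- Since (is)^{n+1} = (-1)^{n+1} (-is)^{n+1}, the second term enters with the factor -(-1)^n. This
combines A₁ and A₂ into A₁ - (-1)^n A₂, removes the unevaluated constant, and leaves a difference of
logarithms. -/
theorem powLogTransform_add (hn : 1 ≤ n) (A₁ A₂ C : ℂ) {s : ℝ} (hs : s ≠ 0) :
    powLogTransform n A₁ (C / 2) (-(Complex.I * (1 * s : ℝ))) +
      powLogTransform n A₂ ((-1) ^ n * (C / 2)) (-(Complex.I * (-1 * s : ℝ))) =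
      centralDensity n (A₁ - (-1) ^ n * A₂) C s := by
  have hs' : (s : ℂ) ≠ 0 := by exact_mod_cast hs
  have hZ : (-(Complex.I * s)) ^ (n + 1) ≠ 0 :=
    pow_ne_zero _ (neg_ne_zero.2 (mul_ne_zero Complex.I_ne_zero hs'))
  have h1 : (Complex.I * (s : ℂ)) ^ (n + 1) = (-1) ^ (n + 1) * (-(Complex.I * s)) ^ (n + 1) := by
    rw [← mul_pow]; ring
  have h2 : ((-1 : ℂ) ^ (n + 1))⁻¹ = -(-1) ^ n := by
    rcases Nat.even_or_odd n with h | h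
    · rw [pow_succ, h.neg_one_pow]; norm_num
    · rw [pow_succ, h.neg_one_pow]; norm_num
  have h3 : ((-1 : ℂ) ^ n) * (-1) ^ n = 1 := by rw [← mul_pow]; norm_num
  have hlog := log_neg_I_mul_sub_log hs
  rw [sub_eq_iff_eq_add] at hlog
  rw [powLogTransform, powLogTransform, centralDensity, laplace_powLog_one hn A₁,
    laplace_powLog_one hn A₂, one_mul, neg_one_mul, Complex.ofReal_neg, mul_neg, neg_neg, h1,
    mul_inv, h2, hlog]
  -- The unevaluated constant and the common logarithm are multiplied by 1 - (-1)^n (-1)^n = 0.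
  linear_combination (-((-(Complex.I * s)) ^ (n + 1))⁻¹ * (C / 2) *
    (laplace (powLog n 0 1) 1 + n.factorial * Complex.log (Complex.I * s))) * h3

theorem continuous_mul_of_notMem_tsupport {f : ℝ → ℂ} (hf : ContinuousOn f {0}ᶜ)
    (hβ : Continuous β) (h0 : (0 : ℝ) ∉ tsupport β) : Continuous fun s => f s * β s := by
  refine continuous_iff_continuousAt.2 fun s => ?_
  by_cases hs : s = 0
  · subst hs
    refine (continuousAt_const (y := (0 : ℂ))).congr ?_
    filter_upwards [notMem_tsupport_iff_eventuallyEq.1 h0] with r hr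
    rw [hr, Pi.zero_apply, mul_zero]
  · exact (hf.continuousAt (isOpen_compl_singleton.mem_nhds hs)).mul hβ.continuousAt

theorem continuousOn_centralDensity (n : ℕ) (R C : ℂ) :
    ContinuousOn (centralDensity n R C) {0}ᶜ := by
  intro s hs
  have hs0 : s ≠ 0 := hs
  have hs' : (s : ℂ) ≠ 0 := by exact_mod_cast hs0
  have hsign : ContinuousAt (fun s : ℝ => ((SignType.sign s : ℝ) : ℂ)) s := by
    have h : ContinuousAt (fun x : SignType => ((x : ℝ) : ℂ)) (SignType.sign s) :=
      continuous_of_discreteTopology.continuousAt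
    exact ContinuousAt.comp (f := fun s : ℝ => SignType.sign s) h (continuousAt_sign_of_ne_zero hs0)
  refine ContinuousAt.continuousWithinAt ?_
  refine ContinuousAt.mul (continuousAt_const.mul (ContinuousAt.inv₀ ?_ ?_))
    (continuousAt_const.sub (continuousAt_const.mul hsign))
  · exact Continuous.continuousAt (by fun_prop)
  · exact pow_ne_zero _ (neg_ne_zero.2 (mul_ne_zero Complex.I_ne_zero hs'))

theorem integral_eq_integral_Ioi_add_integral_Ioi_neg {g : ℝ → ℂ} (hg : Integrable g) :
    ∫ t, g t = (∫ t in Set.Ioi (0 : ℝ), g t) + ∫ t in Set.Ioi (0 : ℝ), g (-t) := by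
  rw [integral_comp_neg_Ioi, neg_zero, add_comm,
    intervalIntegral.integral_Iic_add_Ioi hg.integrableOn hg.integrableOn]

theorem integral_mul_centralDensity (hn : 1 ≤ n) (hk : IsSymbol k) (hβ : ContDiff ℝ ∞ β)
    (hc : HasCompactSupport β) (h0 : (0 : ℝ) ∉ tsupport β) :
    (2 * Real.pi : ℂ) ^ (2 * n + 1) * ∫ s, density k (heisPt 0 s) * β s =
      ∫ s, centralDensity n (∫ x, remainderR k x) (sphereIntegral (coeffW k n)) s * β s := by
  have hw := isExpansion_coeffW hk
  set A₁ := ∫ x, profile k (coeffW k) x 1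
  set A₂ := ∫ x, profile k (coeffW k) x (-1)
  set C := sphereIntegral (coeffW k n)
  set B := centralInv hβ hc with hB
  have hI : Integrable fun t => (∫ x, profile k (coeffW k) x t) * B t := by
    have h := integrable_profile_mul hn hk hw B
    rw [Measure.volume_eq_prod] at h
    refine h.integral_prod_right.congr (Eventually.of_forall fun t => ?_)
    exact integral_mul_const (B t) fun x => profile k (coeffW k) x t
  have e1 : ∫ t in Set.Ioi (0 : ℝ), (∫ x, profile k (coeffW k) x t) * B t =
      ∫ s, β (2 * Real.pi * s) *
        powLogTransform n A₁ (C / 2) (-(Complex.I * (1 * (2 * Real.pi * s) : ℝ))) := by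
    rw [← integral_powLog_mul_centralInv hn A₁ _ hβ hc h0 (Or.inl rfl)]
    refine setIntegral_congr_fun measurableSet_Ioi fun t ht => ?_
    simp only [one_mul, integral_profile_pos hn hk hw ht, ← hB]
    rfl
  have e2 : ∫ t in Set.Ioi (0 : ℝ), (∫ x, profile k (coeffW k) x (-t)) * B (-t) =
      ∫ s, β (2 * Real.pi * s) * powLogTransform n A₂ ((-1) ^ n * (C / 2))
        (-(Complex.I * (-1 * (2 * Real.pi * s) : ℝ))) := by
    rw [← integral_powLog_mul_centralInv hn A₂ _ hβ hc h0 (Or.inr rfl)]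
    refine setIntegral_congr_fun measurableSet_Ioi fun t ht => ?_
    simp only [neg_one_mul, integral_profile_neg hn hk hw ht, ← hB]
    rfl
  have hint : ∀ (A c : ℂ) (ε : ℝ), ε = 1 ∨ ε = -1 → Integrable fun s : ℝ =>
      β s * powLogTransform n A c (-(Complex.I * (ε * s : ℝ))) := by
    intro A c ε hε
    have hε0 : ε ≠ 0 := by rcases hε with rfl | rfl <;> norm_num
    have hco : ContinuousOn (fun s : ℝ => powLogTransform n A c (-(Complex.I * (ε * s : ℝ))))
        {0}ᶜ := by
      refine (continuousOn_inv_pow_mul_log (n + 1) (laplace (powLog n A c) 1)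
        (c * n.factorial)).comp (Continuous.continuousOn (by fun_prop)) fun s hs => ?_
      refine Complex.mem_slitPlane_iff.2 (Or.inr ?_)
      have hs0 : s ≠ 0 := hs
      simp [hε0, hs0]
    refine ((continuous_mul_of_notMem_tsupport hco hβ.continuous h0).integrable_of_hasCompactSupport
      hc.mul_left).congr (Eventually.of_forall fun s => mul_comm _ _)
  have h2 := two_pi_pow_mul_verticalPairing hn hk hw hβ hc h0
  rw [← hB, integral_eq_integral_Ioi_add_integral_Ioi_neg hI, e1, e2, ← integral_add
    ((hint A₁ (C / 2) 1 (Or.inl rfl)).comp_mul_left' Real.two_pi_pos.ne')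
    ((hint A₂ ((-1) ^ n * (C / 2)) (-1) (Or.inr rfl)).comp_mul_left' Real.two_pi_pos.ne')] at h2
  have e3 : ∀ᵐ s : ℝ, β (2 * Real.pi * s) *
        powLogTransform n A₁ (C / 2) (-(Complex.I * (1 * (2 * Real.pi * s) : ℝ))) +
      β (2 * Real.pi * s) * powLogTransform n A₂ ((-1) ^ n * (C / 2))
        (-(Complex.I * (-1 * (2 * Real.pi * s) : ℝ))) =
      centralDensity n (A₁ - (-1) ^ n * A₂) C (2 * Real.pi * s) * β (2 * Real.pi * s) := by
    have hne : ∀ᵐ s : ℝ, s ≠ 0 := ae_ne_zero_of_nontrivial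
    filter_upwards [hne] with s hs
    rw [← mul_add, powLogTransform_add hn A₁ A₂ C (mul_ne_zero Real.two_pi_pos.ne' hs), mul_comm]
  -- The substitution s ↦ 2πs contributes the Jacobian 1/(2π), which raises the exponent of 2π from
  -- 2n to 2n + 1.
  rw [integral_congr_ae e3, Measure.integral_comp_mul_left (fun s =>
    centralDensity n (A₁ - (-1) ^ n * A₂) C s * β s), abs_of_pos (inv_pos.2 Real.two_pi_pos),
    ← integral_remainderR hn hk, verticalPairing, Complex.real_smul] at h2
  have hpi : (2 * Real.pi : ℂ) ≠ 0 := by exact_mod_cast Real.two_pi_pos.ne'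
  rw [pow_succ, mul_right_comm, h2]
  push_cast
  field_simp

/-- The value of a symbol at the nonzero points of the centre. -/
theorem two_pi_pow_mul_density_center (hn : 1 ≤ n) (hk : IsSymbol k) {s : ℝ} (hs : s ≠ 0) :
    (2 * Real.pi : ℂ) ^ (2 * n + 1) * density k (heisPt 0 s) =
      centralDensity n (∫ x, remainderR k x) (sphereIntegral (coeffW k n)) s := by
  have hf : ContinuousOn (fun s : ℝ => density k (heisPt (0 : Horiz n) s)) {0}ᶜ :=
    (isDensityAwayZero_density hk.regular).continuousOn.comp
      (heisPt_continuous.comp (by fun_prop : Continuous fun s : ℝ => ((0 : Horiz n), s))).continuousOn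
      fun s hs => heisPt_ne_zero_of_snd 0 hs
  have hH := continuousOn_centralDensity n (∫ x, remainderR k x) (sphereIntegral (coeffW k n))
  -- The identity is known after pairing with test functions vanishing near s = 0. Both sides are
  -- continuous for s ≠ 0, so it holds pointwise.
  refine sub_eq_zero.1 (eqOn_zero_of_integral_eq_zero (volume : Measure ℝ) isOpen_compl_singleton
    ((hf.const_mul _).sub hH) (fun g hg hgc hgs => ?_) hs)
  set β : ℝ → ℂ := fun s => (g s : ℂ)
  have hβ : ContDiff ℝ ∞ β := Complex.ofRealCLM.contDiff.comp hg
  have hc : HasCompactSupport β := hgc.comp_left (g := fun t : ℝ => (t : ℂ)) (by simp)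
  have h0 : (0 : ℝ) ∉ tsupport β := fun h =>
    hgs (tsupport_subset_of_imp (fun x hx => by simp [β, hx]) h) rfl
  have key := integral_mul_centralDensity hn hk hβ hc h0
  have hi : ∀ {f : ℝ → ℂ}, ContinuousOn f {0}ᶜ → Integrable fun s => f s * β s := fun hf =>
    (continuous_mul_of_notMem_tsupport hf hβ.continuous h0).integrable_of_hasCompactSupport
      hc.mul_left
  rw [← integral_const_mul, ← sub_eq_zero, ← integral_sub ((hi hf).const_mul _) (hi hH)] at key
  rw [← key]
  refine integral_congr_ae (Eventually.of_forall fun x => ?_)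
  simp only [β, Complex.real_smul, Pi.sub_apply]
  ring

end Center

/-! ### The trace formula. -/

theorem proposition5p6 (n : ℕ) (hn : 1 ≤ n) (k : 𝓢'(Heis n, ℂ)) (hk : IsSymbol k) :
    -- the objects entering `τ` and `Res` are well defined
    IsRegularDist (fourierD k) ∧
    (∃ w, IsExpansion k w) ∧
    Integrable (remainderR k) ∧
    -- the formula for `τ_z`, `z = (0, s)`
    ∀ s : ℝ, s ≠ 0 →
      (2 * (Real.pi : ℂ)) ^ (n + 1) * (-(Complex.I * (s : ℂ))) ^ (n + 1) / (n.factorial : ℂ)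
          * tauAt (heisPt 0 s) k
        = if 0 < s then tauTrace k + (Real.pi : ℂ) * Complex.I * resTrace k
          else tauTrace k - (Real.pi : ℂ) * Complex.I * resTrace k := by
  refine ⟨isRegularDist_fourierD hk, exists_isExpansion hk, integrable_remainderR hn hk,
    fun s hs => ?_⟩
  have key := two_pi_pow_mul_density_center hn hk hs
  have hs' : (s : ℂ) ≠ 0 := by exact_mod_cast hs
  have hZ : (-(Complex.I * (s : ℂ))) ^ (n + 1) ≠ 0 :=
    pow_ne_zero _ (neg_ne_zero.2 (mul_ne_zero Complex.I_ne_zero hs'))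
  have hfac : (n.factorial : ℂ) ≠ 0 := by exact_mod_cast n.factorial_ne_zero
  have hpi : (2 * Real.pi : ℂ) ^ n ≠ 0 := pow_ne_zero _ (by exact_mod_cast Real.two_pi_pos.ne')
  have hval : (2 * (Real.pi : ℂ)) ^ (n + 1) * (-(Complex.I * (s : ℂ))) ^ (n + 1) /
      (n.factorial : ℂ) * tauAt (heisPt 0 s) k =
      ((2 * Real.pi : ℂ) ^ n)⁻¹ * ((∫ x, remainderR k x) -
        Complex.I * Real.pi / 2 * sphereIntegral (coeffW k n) * (SignType.sign s : ℝ)) := by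
    -- The factor (2π)^{2n+1} splits as (2π)^n (2π)^{n+1}; the first part is the normalisation of τ
    -- and Res.
    rw [tauAt, eq_inv_mul_iff_mul_eq₀ hpi]
    rw [centralDensity] at key
    have h1 : (2 * Real.pi : ℂ) ^ n * ((2 * (Real.pi : ℂ)) ^ (n + 1) *
        (-(Complex.I * (s : ℂ))) ^ (n + 1) / (n.factorial : ℂ) * density k (heisPt 0 s)) =
        (-(Complex.I * (s : ℂ))) ^ (n + 1) / (n.factorial : ℂ) *
          ((2 * Real.pi : ℂ) ^ (2 * n + 1) * density k (heisPt 0 s)) := by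
      ring
    rw [h1, key, mul_assoc (n.factorial : ℂ), ← mul_assoc, div_mul_cancel₀ _ hfac,
      mul_inv_cancel_left₀ hZ]
  rw [hval, tauTrace, resTrace]
  change _ = if 0 < s then _ + _ * (_ * sphereIntegral (coeffW k n)) else
    _ - _ * (_ * sphereIntegral (coeffW k n))
  rcases lt_or_gt_of_ne hs with h | h
  · rw [if_neg h.le.not_gt, sign_neg h]
    simp only [SignType.coe_neg_one, Complex.ofReal_neg, Complex.ofReal_one]
    field_simp
  · rw [if_pos h, sign_pos h]
    simp only [SignType.coe_one, Complex.ofReal_one]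
    field_simp
    ring
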